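/- Let $n\ge 1$ and let $(M,\xi)$ be a (not necessarily closed) cooriented contact manifold of dimension $2n+1$, i.e. $M$ is a smooth manifold without boundary (Hausdorff, second countable) and $\xi=\ker\alpha$, with its coorientation, for a smooth $1$-form $\alpha$ on $M$ such that $\alpha\wedge(d\alpha)^n$ is a volume form. A \emph{Darboux chart} is an open subset of $M$ that is contactomorphic (diffeomorphic by a diffeomorphism matching the contact structures) to an open subset of $\mathbb R^{2n+1}$ with the standard contact structure $\ker\bigl(dz+\sum_{i=1}^n x_i\,dy_i\bigr)$. Assume that $M$ can be covered by finitely many Darboux charts. A \emph{path of diffeomorphisms} is a family $(f_t)_{t\in[0,1]}$ of $C^\infty$-diffeomorphisms of $M$ such that $(t,x)\mapsto f_t(x)$ is smooth on $[0,1]\times M$; it is \emph{compactly supported} if there is a compact $K\subset M$ such that $f_t(x)=x$ for all $t\in[0,1]$ and $x\notin K$. It generates the time-dependent vector field $X_t$ determined by $\partial_t f_t=X_t\circ f_t$. The path is a \emph{null path} if $\alpha(X_t)=0$ on $M$ for all $t\in[0,1]$, and \emph{positive} if $\alpha(X_t)>0$ on $M$ for all $t\in[0,1]$. Let $(f_t)_{t\in[0,1]}$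 be a compactly supported path of diffeomorphisms of $M$. Then 1. there is a compactly supported null path of diffeomorphisms $(g_t)_{t\in[0,1]}$ with $g_0=f_0$ and $g_1=f_1$; and 2. there is a positive path of diffeomorphisms $(h_t)_{t\in[0,1]}$ (not necessarily compactly supported) with $h_0=f_0$ and $h_1=f_1$. -/

import Mathlib

open Set Bundle
open scoped Manifold ContDiff Topology

noncomputable section

/-- The Euclidean space `ℝ²ⁿ⁺¹`, the model space of the contact manifolds below. -/
abbrev Eucl (n : ℕ) : Type := EuclideanSpace ℝ (Fin (2 * n + 1))

section Forms

variable (n : ℕ) {M : Type*} [TopologicalSpace M] [ChartedSpace (Eucl n) M]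

/-- A (not necessarily continuous) field of linear forms on the tangent spaces of `M`. -/
abbrev OneForm (M : Type*) [TopologicalSpace M] [ChartedSpace (Eucl n) M] : Type _ :=
  (x : M) → (TangentSpace (𝓡 (2 * n + 1)) x →L[ℝ] Trivial M ℝ x)

/-- The `1`-form `α` is `C^∞`, as a section of the cotangent bundle. -/
def OneForm.IsSmooth [IsManifold (𝓡 (2 * n + 1)) ∞ M] (α : OneForm n M) : Prop :=
  ContMDiff (𝓡 (2 * n + 1)) ((𝓡 (2 * n + 1)).prod 𝓘(ℝ, Eucl n →L[ℝ] ℝ)) ∞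
    (fun x : M => TotalSpace.mk' (Eucl n →L[ℝ] ℝ)
      (E := fun x : M => TangentSpace (𝓡 (2 * n + 1)) x →L[ℝ] Trivial M ℝ x) x (α x))

/-- The `1`-form `α` read in the preferred chart at `x₀`: the pull-back of `α` under the inverse
of that chart, a `1`-form on the target of the chart. -/
def OneForm.inChart (α : OneForm n M) (x₀ : M) (y : Eucl n) : Eucl n →L[ℝ] ℝ :=
  (α ((extChartAt (𝓡 (2 * n + 1)) x₀).symm y)).comp
    (mfderiv 𝓘(ℝ, Eucl n) (𝓡 (2 * n + 1)) (extChartAt (𝓡 (2 * n + 1)) x₀).symm y)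

/-- The exterior derivative `dα` at `x`, evaluated on two tangent vectors, computed in the
preferred chart at `x`. -/
def OneForm.d (α : OneForm n M) (x : M) (u v : TangentSpace (𝓡 (2 * n + 1)) x) : ℝ :=
  extDeriv
    (fun y : Eucl n => ContinuousAlternatingMap.ofSubsingleton ℝ (Eucl n) ℝ (0 : Fin 1)
      (α.inChart n x y))
    (extChartAt (𝓡 (2 * n + 1)) x x)
    ![mfderiv (𝓡 (2 * n + 1)) 𝓘(ℝ, Eucl n) (extChartAt (𝓡 (2 * n + 1)) x) x u,
      mfderiv (𝓡 (2 * n + 1)) 𝓘(ℝ, Eucl n) (extChartAt (𝓡 (2 * n + 1)) x) x v]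

/-- The value of the `(2n+1)`-form `α ∧ (dα)ⁿ` at `x` on tangent vectors `v₀, …, v₂ₙ`:
`1 / (1! 2! ⋯ 2!) ∑_σ sgn(σ) α(v_σ(0)) dα(v_σ(1), v_σ(2)) ⋯ dα(v_σ(2n-1), v_σ(2n))`. -/
def OneForm.wedgeDPow (α : OneForm n M) (x : M)
    (v : Fin (2 * n + 1) → TangentSpace (𝓡 (2 * n + 1)) x) : ℝ :=
  (1 / 2 ^ n : ℝ) * ∑ σ : Equiv.Perm (Fin (2 * n + 1)),
    ((Equiv.Perm.sign σ : ℤ) : ℝ) * (α x (v (σ 0)) : ℝ) *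
      ∏ i : Fin n, α.d n x (v (σ ⟨2 * (i : ℕ) + 1, by omega⟩)) (v (σ ⟨2 * (i : ℕ) + 2, by omega⟩))

/-- `α` is a contact form: a smooth `1`-form such that `α ∧ (dα)ⁿ` is a volume form, that is,
vanishes at no point. The contact structure is `ξ = ker α`, cooriented by `α`. -/
structure IsContactForm [IsManifold (𝓡 (2 * n + 1)) ∞ M] (α : OneForm n M) : Prop where
  smooth : α.IsSmooth n
  volume : ∀ x : M, ∃ v : Fin (2 * n + 1) → TangentSpace (𝓡 (2 * n + 1)) x,
    α.wedgeDPow n x v ≠ 0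

/-- The standard contact form `dz + ∑ xᵢ dyᵢ` on `ℝ²ⁿ⁺¹`, with coordinates ordered as
`(x₁, …, xₙ, y₁, …, yₙ, z)`. -/
def stdContactForm (p : Eucl n) : Eucl n →L[ℝ] ℝ :=
  EuclideanSpace.proj (Fin.last (2 * n)) +
    ∑ i : Fin n, p (⟨(i : ℕ), by omega⟩ : Fin (2 * n + 1)) •
      (EuclideanSpace.proj (⟨n + (i : ℕ), by omega⟩ : Fin (2 * n + 1)) : Eucl n →L[ℝ] ℝ)

/-- `U` is a Darboux chart of `(M, ker α)`: it is open and there is a contactomorphism `φ` from `U`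
to an open subset of `ℝ²ⁿ⁺¹`, i.e. a `C^∞` diffeomorphism whose differential at each point of `U`
matches `ker α` with the kernel of the standard contact form. -/
def IsDarbouxChart (α : OneForm n M) (U : Set M) : Prop :=
  ∃ φ : OpenPartialHomeomorph M (Eucl n), φ.source = U ∧
    ContMDiffOn (𝓡 (2 * n + 1)) 𝓘(ℝ, Eucl n) ∞ φ φ.source ∧
    ContMDiffOn 𝓘(ℝ, Eucl n) (𝓡 (2 * n + 1)) ∞ φ.symm φ.target ∧
    ∀ x ∈ U, ∀ v : TangentSpace (𝓡 (2 * n + 1)) x,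
      stdContactForm n (φ x) (mfderiv (𝓡 (2 * n + 1)) 𝓘(ℝ, Eucl n) φ x v) = 0 ↔
        (α x v : ℝ) = 0

/-- `(M, ker α)` is covered by finitely many Darboux charts. -/
def HasFiniteDarbouxCover (α : OneForm n M) : Prop :=
  ∃ (m : ℕ) (U : Fin m → Set M), (∀ i, IsDarbouxChart n α (U i)) ∧ ⋃ i, U i = univ

/-- The group of `C^∞` diffeomorphisms of `M`. -/
abbrev Diffeos (M : Type*) [TopologicalSpace M] [ChartedSpace (Eucl n) M] : Type _ :=
  Diffeomorph (𝓡 (2 * n + 1)) (𝓡 (2 * n + 1)) M M ∞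

/-- A smooth path `(f_t)_{t ∈ [0,1]}` of diffeomorphisms: `(t, x) ↦ f_t(x)` is `C^∞` on
`[0,1] × M`. Only the values for `t ∈ [0,1]` matter, here and below. -/
def IsSmoothPath (f : ℝ → Diffeos n M) : Prop :=
  ContMDiffOn (𝓘(ℝ, ℝ).prod (𝓡 (2 * n + 1))) (𝓡 (2 * n + 1)) ∞
    (fun p : ℝ × M => f p.1 p.2) (Icc (0 : ℝ) 1 ×ˢ univ)

/-- The path is compactly supported: outside one compact set, every `f_t` is the identity. -/
def IsCompactlySupportedPath (f : ℝ → Diffeos n M) : Prop :=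
  ∃ K : Set M, IsCompact K ∧ ∀ t ∈ Icc (0 : ℝ) 1, ∀ x ∉ K, f t x = x

/-- The time-dependent vector field `X_t` generated by the path, `∂_t f_t = X_t ∘ f_t`; that is,
`X_t(p)` is the velocity at time `t` of the curve `s ↦ f_s(f_t⁻¹(p))`, which is at `p` at
time `t`. -/
def generatedField (f : ℝ → Diffeos n M) (t : ℝ) (p : M) : TangentSpace (𝓡 (2 * n + 1)) p :=
  mfderivWithin 𝓘(ℝ, ℝ) (𝓡 (2 * n + 1)) (fun s : ℝ => f s ((f t).symm p)) (Icc (0 : ℝ) 1) t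
    (1 : ℝ)

/-- The path is a null path: `α(X_t) = 0` everywhere on `M`, for all `t ∈ [0,1]`. -/
def IsNullPath (α : OneForm n M) (f : ℝ → Diffeos n M) : Prop :=
  ∀ t ∈ Icc (0 : ℝ) 1, ∀ p : M, (α p (generatedField n f t p) : ℝ) = 0

/-- The path is positive: `α(X_t) > 0` everywhere on `M`, for all `t ∈ [0,1]`. -/
def IsPositivePath (α : OneForm n M) (f : ℝ → Diffeos n M) : Prop :=
  ∀ t ∈ Icc (0 : ℝ) 1, ∀ p : M, (0 : ℝ) < α p (generatedField n f t p)

end Forms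

end

open Set Bundle
open scoped Manifold ContDiff Topology

/-! Null paths. Being joined by a compactly supported null path is an equivalence relation
(`NullIsotopic`; its paths rest near both ends, so that they concatenate smoothly). It is invariant
under composition on the right, which only relabels trajectories. Since `ℝ` is connected, it
suffices to join the members of a family that are close in time, hence to treat diffeomorphisms
close to the identity. These are fragmented, one chart at a time, into small perturbations supported
in Darboux charts (`eventually_nullIsotopic_refl`). In a Darboux chart, a small map `y ↦ y + w y` is
reached along straight segments tangent to `ker (dz + ∑ xᵢ dyᵢ)`: move the `x`-coordinates, then the
`y`-coordinates with the change of `z` that they force. This misses the target by some `u` in the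
`z`-direction. A rectangle in one `(x, y)`-plane (shift `x` by `c`, `y` by `b`, `x` back, `y` back)
changes `z` by `-b c`, so `b = -u / c` repairs the error (`IsDarbouxMap.eventually_nullIsotopic`).

Positive paths. It suffices to find a positive loop `φ` of diffeomorphisms based at the identity: `φ
(N t) ∘ f t` has the ends of `f`, and `α` of its velocity is `N` times a positive function plus a
term which vanishes off the support of `f` and is bounded on it (`exists_positive_path`). The loop
is a composition of one loop per chart, of size `e`, with displacement `(e a, s e b, s (e² c - e x
b))` in one triple `(x, y, z)`, where `c' + a b' = 1`. The standard form takes the value `s e²` on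
its velocity, but its speed is of order `e`, and it distorts the form by an error proportional to
the speed of the loops composed before it. Three devices keep this error below the positive part.
(1) The loops have disjoint active times. When a loop is inactive, `a = b = 0`: it moves in the
`z`-direction only, its speed is of order `e²`, and it preserves the form up to order `e`. At any
time at most one speed is of first order, and a product of two sizes is absorbed into their squares
(`exists_composition`). (2) All lengths are measured by the differential of one map `F` to a vector
space, made of the extended charts, the partition of unity and a proper function `g`. The form `α`
is multiplied by a large positive function, which does not affect positivity, so that speeds are
bounded by the square root of the positive part. (3) The sizes are `Φ(g) ρᵢ`, with `Φ` and its
derivative so small on each level set of `g` that the estimates hold uniformly although `M` need not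
be compact. The number of charts is finite, so the losses, one per chart, and the factors `2` in the
stretching of lengths stay bounded. -/

noncomputable section

/-! ### Inverses of small perturbations of the identity of a vector space -/

section Perturbation

/-- A `1/2`-Lipschitz perturbation of the identity of `E` is bijective; if it is supported in an
open set `O` and depends smoothly on a parameter over `O`, so does its inverse. -/
theorem exists_inverse_id_add {E : Type*} [NormedAddCommGroup E] [NormedSpace ℝ E]
    [FiniteDimensional ℝ E] {O : Set E} (hO : IsOpen O) {w : ℝ → E → E}
    (hw : ContDiffOn ℝ ∞ (fun q : ℝ × E => w q.1 q.2) (univ ×ˢ O))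
    (hlip : ∀ t, LipschitzWith (1 / 2) (w t)) (hzero : ∀ t, ∀ y ∉ O, w t y = 0) :
    ∃ g : ℝ → E → E, (∀ t y, g t (y + w t y) = y) ∧ (∀ t y, g t y + w t (g t y) = y) ∧
      (∀ t, ∀ y ∈ O, y + w t y ∈ O) ∧ (∀ t, ∀ y ∈ O, g t y ∈ O) ∧
      ContDiffOn ℝ ∞ (fun q : ℝ × E => g q.1 q.2) (univ ×ˢ O) := by
  have hbij : ∀ t, Function.Bijective (fun y => y + w t y) := by
    intro t
    by_cases hsub : Subsingleton E
    · exact ⟨fun a b _ => Subsingleton.elim _ _, fun b => ⟨b, Subsingleton.elim _ _⟩⟩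
    have happ : ApproximatesLinearOn (fun y => y + w t y)
        ((ContinuousLinearEquiv.refl ℝ E : E ≃L[ℝ] E) : E →L[ℝ] E) univ (1 / 2) := by
      intro x _ y _
      have := (hlip t).dist_le_mul x y
      rw [dist_eq_norm, dist_eq_norm] at this
      simpa [add_sub_add_comm] using this
    have hc : Subsingleton E ∨ (1 / 2 : NNReal) <
        ‖((ContinuousLinearEquiv.refl ℝ E).symm : E →L[ℝ] E)‖₊⁻¹ := by
      right
      have : Nontrivial E := not_subsingleton_iff_nontrivial.1 hsub
      have h1 : ‖((ContinuousLinearEquiv.refl ℝ E).symm : E →L[ℝ] E)‖₊ = 1 := by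
        ext
        simp
      rw [h1, inv_one]
      exact NNReal.half_lt_self one_ne_zero
    exact (happ.toHomeomorph _ hc).bijective
  choose g hg using fun t y => (hbij t).2 y
  have hg' : ∀ t y, g t (y + w t y) = y := fun t y => (hbij t).1 (hg t _)
  -- Points outside `O` are fixed, so by injectivity no point of `O` can leave it.
  have hmaps : ∀ t, ∀ y ∈ O, y + w t y ∈ O := by
    intro t y hy
    by_contra h
    have h1 := hzero t _ h
    have : (y + w t y) = y := (hbij t).1 (by simp only [h1, add_zero])
    exact h (by rwa [this])
  have hmaps' : ∀ t, ∀ y ∈ O, g t y ∈ O := by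
    intro t y hy
    by_contra h
    have h1 := hg t y
    simp only [hzero t _ h, add_zero] at h1
    exact h (by rwa [h1])
  refine ⟨g, hg', hg, hmaps, hmaps', ?_⟩
  rintro ⟨t, y⟩ ⟨-, hy⟩
  have hxO : g t y ∈ O := hmaps' t y hy
  -- The inverse function theorem is applied to `(t, y) ↦ (t, y + w t y)`, which gives smoothness in
  -- `t` as well. The differential is injective because the `y`-derivative of `w` has norm at most
  -- `1/2`.
  set Ψ : ℝ × E → ℝ × E := fun q => (q.1, q.2 + w q.1 q.2) with hΨ
  have hwat : ContDiffAt ℝ ∞ (fun q : ℝ × E => w q.1 q.2) (t, g t y) :=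
    (hw (t, g t y) ⟨mem_univ _, hxO⟩).contDiffAt
      ((isOpen_univ.prod hO).mem_nhds ⟨mem_univ _, hxO⟩)
  have hΨat : ContDiffAt ℝ ∞ Ψ (t, g t y) :=
    contDiffAt_fst.prodMk (contDiffAt_snd.add hwat)
  set L : ℝ × E →L[ℝ] ℝ × E := fderiv ℝ Ψ (t, g t y) with hL
  have hΨd : HasFDerivAt Ψ L (t, g t y) :=
    (hΨat.differentiableAt (by simp)).hasFDerivAt
  set D := fderiv ℝ (fun q : ℝ × E => w q.1 q.2) (t, g t y) with hD
  have hDd : HasFDerivAt (fun q : ℝ × E => w q.1 q.2) D (t, g t y) :=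
    (hwat.differentiableAt (by simp)).hasFDerivAt
  have hLeq : L = (ContinuousLinearMap.fst ℝ ℝ E).prod (ContinuousLinearMap.snd ℝ ℝ E + D) :=
    hΨd.unique (hasFDerivAt_fst.prodMk (hasFDerivAt_snd.add hDd))
  have hDnorm : ∀ v : E, ‖D (0, v)‖ ≤ 1 / 2 * ‖v‖ := by
    intro v
    have hc : HasFDerivAt (fun x : E => w t x) (D.comp (ContinuousLinearMap.inr ℝ ℝ E)) (g t y) := by
      have hi : HasFDerivAt (fun x : E => ((t, x) : ℝ × E)) (ContinuousLinearMap.inr ℝ ℝ E)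
        (g t y) := hasFDerivAt_prodMk_right t (g t y)
      exact HasFDerivAt.comp (g t y) (f := fun x : E => ((t, x) : ℝ × E)) hDd hi
    have h2 : ‖D.comp (ContinuousLinearMap.inr ℝ ℝ E)‖ ≤ 1 / 2 := by
      have := hc.le_of_lipschitz (hlip t)
      simpa using this
    have h3 := (D.comp (ContinuousLinearMap.inr ℝ ℝ E)).le_of_opNorm_le h2 v
    simpa using h3
  have hinj : Function.Injective L := by
    rw [injective_iff_map_eq_zero]
    rintro ⟨τ, v⟩ h
    rw [hLeq] at h
    simp only [ContinuousLinearMap.prod_apply, ContinuousLinearMap.coe_fst',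
      add_apply, ContinuousLinearMap.coe_snd', Prod.mk_eq_zero] at h
    obtain ⟨h1, h2⟩ := h
    subst h1
    have h3 : v = -D (0, v) := eq_neg_of_add_eq_zero_left h2
    have h4 : ‖v‖ ≤ 1 / 2 * ‖v‖ := by
      conv_lhs => rw [h3, norm_neg]
      exact hDnorm v
    have : v = 0 := by
      rw [← norm_eq_zero]
      linarith [norm_nonneg v]
    rw [this]
    rfl
  let Le : (ℝ × E) ≃L[ℝ] (ℝ × E) :=
    (LinearEquiv.ofInjectiveEndo (L : ℝ × E →ₗ[ℝ] ℝ × E) hinj).toContinuousLinearEquiv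
  have hLe : (Le : ℝ × E →L[ℝ] ℝ × E) = L := by
    ext q <;> rfl
  have hΨd' : HasFDerivAt Ψ (Le : ℝ × E →L[ℝ] ℝ × E) (t, g t y) := by rwa [hLe]
  have hΨval : Ψ (t, g t y) = (t, y) := by simp [hΨ, hg]
  have hloc := hΨat.to_localInverse hΨd' (by simp)
  rw [hΨval] at hloc
  have hs : HasStrictFDerivAt Ψ (Le : ℝ × E →L[ℝ] ℝ × E) (t, g t y) :=
    hΨat.hasStrictFDerivAt' hΨd' (by simp)
  have hev : ∀ᶠ z in 𝓝 (t, y), Ψ (hΨat.localInverse hΨd' (by simp) z) = z := by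
    have := hs.eventually_right_inverse
    rw [hΨval] at this
    exact this
  have heq : (fun q : ℝ × E => g q.1 q.2) =ᶠ[𝓝 (t, y)]
      fun z => (hΨat.localInverse hΨd' (by simp) z).2 := by
    filter_upwards [hev] with z hz
    set u := hΨat.localInverse hΨd' (by simp) z
    rw [← hz]
    simp only [hΨ]
    exact hg' _ _
  exact ((contDiffAt_snd.comp (t, y) hloc).congr_of_eventuallyEq heq).contDiffWithinAt

end Perturbation

/-! ### Diffeomorphisms of the manifold supported in one chart -/

section ChartPerturbation

set_option linter.unusedSectionVars false

variable {n : ℕ} {M : Type*} [TopologicalSpace M] [ChartedSpace (Eucl n) M]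

/-- The self-map of `M` which reads `y ↦ y + v y` in the chart `ψ` and fixes all points outside
its domain. -/
def perturb (ψ : OpenPartialHomeomorph M (Eucl n)) (v : Eucl n → Eucl n) (p : M) : M :=
  open Classical in if p ∈ ψ.source then ψ.symm (ψ p + v (ψ p)) else p

/-- `w` is a smooth family of small perturbations of the identity, supported in the chart `ψ`. -/
structure IsChartPerturbation (ψ : OpenPartialHomeomorph M (Eucl n))
    (w : ℝ → Eucl n → Eucl n) : Prop where
  chart : ContMDiffOn (𝓡 (2 * n + 1)) 𝓘(ℝ, Eucl n) ∞ ψ ψ.source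
  chart_symm : ContMDiffOn 𝓘(ℝ, Eucl n) (𝓡 (2 * n + 1)) ∞ ψ.symm ψ.target
  smooth : ContDiffOn ℝ ∞ (fun q : ℝ × Eucl n => w q.1 q.2) (univ ×ˢ ψ.target)
  lip : ∀ t, LipschitzWith (1 / 2) (w t)
  supp : ∃ S : Set M, IsClosed S ∧ S ⊆ ψ.source ∧ ∀ t y, w t y ≠ 0 → y ∈ ψ '' S

variable {ψ : OpenPartialHomeomorph M (Eucl n)} {w : ℝ → Eucl n → Eucl n}

theorem perturb_of_mem (v : Eucl n → Eucl n) {p : M} (hp : p ∈ ψ.source) :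
    perturb ψ v p = ψ.symm (ψ p + v (ψ p)) := by
  simp [perturb, hp]

theorem perturb_of_eq_zero {v : Eucl n → Eucl n} {p : M} (hv : v (ψ p) = 0) :
    perturb ψ v p = p := by
  by_cases hp : p ∈ ψ.source
  · rw [perturb_of_mem v hp, hv, add_zero, ψ.left_inv hp]
  · simp [perturb, hp]

theorem perturb_of_notMem (v : Eucl n → Eucl n) {p : M} (hp : p ∉ ψ.source) :
    perturb ψ v p = p := by
  simp [perturb, hp]

/-- The two open sets `ψ.source` and `Sᶜ` cover `M`. On the first the map is smooth as read in the
chart, on the second it is the identity. Only closedness of `S` in `M` matters, so noncompact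
supports are allowed. -/
theorem contMDiff_perturb_of_local {v : ℝ → Eucl n → Eucl n}
    (h1 : ContMDiffOn (𝓡 (2 * n + 1)) 𝓘(ℝ, Eucl n) ∞ ψ ψ.source)
    (h2 : ContMDiffOn 𝓘(ℝ, Eucl n) (𝓡 (2 * n + 1)) ∞ ψ.symm ψ.target)
    (hv : ContDiffOn ℝ ∞ (fun q : ℝ × Eucl n => v q.1 q.2) (univ ×ˢ ψ.target))
    (hmaps : ∀ t, ∀ y ∈ ψ.target, v t y ∈ ψ.target)
    {f : ℝ → M → M} {S : Set M} (hS : IsClosed S) (hSψ : S ⊆ ψ.source)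
    (hf : ∀ t, ∀ p ∈ ψ.source, f t p = ψ.symm (v t (ψ p))) (hf' : ∀ t, ∀ p ∉ S, f t p = p) :
    ContMDiff (𝓘(ℝ, ℝ).prod (𝓡 (2 * n + 1))) (𝓡 (2 * n + 1)) ∞
      (fun q : ℝ × M => f q.1 q.2) := by
  rintro ⟨t, p⟩
  by_cases hp : p ∈ S
  · have hU : (univ : Set ℝ) ×ˢ ψ.source ∈ 𝓝 (t, p) :=
      (isOpen_univ.prod ψ.open_source).mem_nhds ⟨mem_univ _, hSψ hp⟩
    have hψp : ψ p ∈ ψ.target := ψ.map_source (hSψ hp)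
    have ha : ContMDiffAt (𝓘(ℝ, ℝ).prod (𝓡 (2 * n + 1))) 𝓘(ℝ, ℝ × Eucl n) ∞
        (fun q : ℝ × M => ((q.1, ψ q.2) : ℝ × Eucl n)) (t, p) := by
      refine contMDiffAt_fst.prodMk_space ?_
      exact ContMDiffAt.comp (t, p) ((h1 p (hSψ hp)).contMDiffAt
        (ψ.open_source.mem_nhds (hSψ hp))) contMDiffAt_snd
    have hb : ContMDiffAt 𝓘(ℝ, ℝ × Eucl n) 𝓘(ℝ, Eucl n) ∞
        (fun q : ℝ × Eucl n => v q.1 q.2) (t, ψ p) := ((hv (t, ψ p) ⟨mem_univ _, hψp⟩).contDiffAt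
        ((isOpen_univ.prod ψ.open_target).mem_nhds ⟨mem_univ _, hψp⟩)).contMDiffAt
    have hc : ContMDiffAt 𝓘(ℝ, Eucl n) (𝓡 (2 * n + 1)) ∞ ψ.symm (v t (ψ p)) :=
      (h2 _ (hmaps t _ hψp)).contMDiffAt (ψ.open_target.mem_nhds (hmaps t _ hψp))
    have hd := ContMDiffAt.comp (t, p) (g := ψ.symm) (f := fun q : ℝ × M => v q.1 (ψ q.2)) hc
      (ContMDiffAt.comp (t, p) (g := fun q : ℝ × Eucl n => v q.1 q.2)
        (f := fun q : ℝ × M => ((q.1, ψ q.2) : ℝ × Eucl n)) hb ha)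
    refine hd.congr_of_eventuallyEq ?_
    filter_upwards [hU] with q hq
    exact hf _ _ hq.2
  · have hU : (univ : Set ℝ) ×ˢ Sᶜ ∈ 𝓝 (t, p) :=
      (isOpen_univ.prod hS.isOpen_compl).mem_nhds ⟨mem_univ _, hp⟩
    refine (contMDiffAt_snd (I := 𝓘(ℝ, ℝ)) (J := 𝓡 (2 * n + 1))).congr_of_eventuallyEq ?_
    filter_upwards [hU] with q hq
    exact hf' _ _ hq.2

theorem IsChartPerturbation.eq_zero (h : IsChartPerturbation ψ w) (t : ℝ) {y : Eucl n}
    (hy : y ∉ ψ.target) : w t y = 0 := by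
  obtain ⟨S, -, hS, h3⟩ := h.supp
  by_contra h0
  obtain ⟨x, hx, rfl⟩ := h3 t y h0
  exact hy (ψ.map_source (hS hx))

theorem IsChartPerturbation.add_mem (h : IsChartPerturbation ψ w) (t : ℝ) {y : Eucl n}
    (hy : y ∈ ψ.target) : y + w t y ∈ ψ.target := by
  obtain ⟨g, -, -, h3, -⟩ := exists_inverse_id_add ψ.open_target h.smooth h.lip
    (fun t y hy => h.eq_zero t hy)
  exact h3 t y hy

theorem IsChartPerturbation.exists_diffeos (h : IsChartPerturbation ψ w) :
    ∃ G : ℝ → Diffeos n M, (∀ t p, G t p = perturb ψ (w t) p) ∧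
      ContMDiff (𝓘(ℝ, ℝ).prod (𝓡 (2 * n + 1))) (𝓡 (2 * n + 1)) ∞
        (fun q : ℝ × M => G q.1 q.2) ∧
      ContMDiff (𝓘(ℝ, ℝ).prod (𝓡 (2 * n + 1))) (𝓡 (2 * n + 1)) ∞
        (fun q : ℝ × M => (G q.1).symm q.2) := by
  obtain ⟨g, hg1, hg2, hm1, hm2, hgs⟩ := exists_inverse_id_add ψ.open_target h.smooth h.lip
    (fun t y hy => h.eq_zero t hy)
  obtain ⟨S, hS, hSψ, hSw⟩ := h.supp
  -- The inverse diffeomorphism is again a `perturb`, with the displacement of the inverse map `g`.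
  set v : ℝ → Eucl n → Eucl n := fun t y => g t y - y with hv
  have hS0 : ∀ t, ∀ p ∉ S, p ∈ ψ.source → w t (ψ p) = 0 := by
    intro t p hp hpψ
    by_contra h0
    obtain ⟨x, hx, hxp⟩ := hSw t _ h0
    exact hp (ψ.injOn (hSψ hx) hpψ hxp ▸ hx)
  have hf : ∀ t, ∀ p ∈ ψ.source, perturb ψ (w t) p = ψ.symm (ψ p + w t (ψ p)) :=
    fun t p hp => perturb_of_mem _ hp
  have hf' : ∀ t, ∀ p ∉ S, perturb ψ (w t) p = p := by
    intro t p hp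
    by_cases hpψ : p ∈ ψ.source
    · exact perturb_of_eq_zero (hS0 t p hp hpψ)
    · exact perturb_of_notMem _ hpψ
  have hi : ∀ t, ∀ p ∈ ψ.source, perturb ψ (v t) p = ψ.symm (g t (ψ p)) := by
    intro t p hp
    rw [perturb_of_mem _ hp]
    simp [hv]
  have hi' : ∀ t, ∀ p ∉ S, perturb ψ (v t) p = p := by
    intro t p hp
    by_cases hpψ : p ∈ ψ.source
    · refine perturb_of_eq_zero ?_
      have h1 := hg1 t (ψ p)
      rw [hS0 t p hp hpψ, add_zero] at h1
      simp [hv, h1]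
    · exact perturb_of_notMem _ hpψ
  have hsm1 := contMDiff_perturb_of_local h.chart h.chart_symm
    (v := fun t y => y + w t y) (contDiffOn_snd.add h.smooth) hm1 hS hSψ hf hf'
  have hsm2 := contMDiff_perturb_of_local h.chart h.chart_symm (v := g) hgs hm2 hS hSψ hi hi'
  have hl : ∀ t p, perturb ψ (v t) (perturb ψ (w t) p) = p := by
    intro t p
    by_cases hpψ : p ∈ ψ.source
    · have h1 := hm1 t _ (ψ.map_source hpψ)
      rw [hf t p hpψ, hi t _ (ψ.map_target h1), ψ.right_inv h1, hg1, ψ.left_inv hpψ]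
    · rw [perturb_of_notMem _ hpψ, perturb_of_notMem _ hpψ]
  have hr : ∀ t p, perturb ψ (w t) (perturb ψ (v t) p) = p := by
    intro t p
    by_cases hpψ : p ∈ ψ.source
    · have h1 := hm2 t _ (ψ.map_source hpψ)
      rw [hi t p hpψ, hf t _ (ψ.map_target h1), ψ.right_inv h1, hg2, ψ.left_inv hpψ]
    · rw [perturb_of_notMem _ hpψ, perturb_of_notMem _ hpψ]
  have hin : ∀ t : ℝ, ContMDiff (𝓡 (2 * n + 1)) (𝓘(ℝ, ℝ).prod (𝓡 (2 * n + 1))) ∞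
      (fun p : M => (t, p)) := fun t => contMDiff_const.prodMk contMDiff_id
  exact ⟨fun t =>
    { toFun := perturb ψ (w t)
      invFun := perturb ψ (v t)
      left_inv := hl t
      right_inv := hr t
      contMDiff_toFun := hsm1.comp (hin t)
      contMDiff_invFun := hsm2.comp (hin t) }, fun t p => rfl, hsm1, hsm2⟩

end ChartPerturbation

/-! ### Velocities of smooth families of maps -/

section Velocity

set_option linter.unusedSectionVars false

variable {n : ℕ} {M : Type*} [TopologicalSpace M] [ChartedSpace (Eucl n) M]

/-- The velocity at time `t` of the trajectory of `p` under the family of maps `G`. -/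
def velocity (G : ℝ → M → M) (t : ℝ) (p : M) : TangentSpace (𝓡 (2 * n + 1)) (G t p) :=
  mfderiv 𝓘(ℝ, ℝ) (𝓡 (2 * n + 1)) (fun s : ℝ => G s p) t (1 : ℝ)

/-- `(t, p) ↦ G t p` is smooth on `ℝ × M`. -/
def IsSmoothFamily (G : ℝ → M → M) : Prop :=
  ContMDiff (𝓘(ℝ, ℝ).prod (𝓡 (2 * n + 1))) (𝓡 (2 * n + 1)) ∞ (fun q : ℝ × M => G q.1 q.2)

theorem IsSmoothFamily.contMDiff_curve {G : ℝ → M → M} (hG : IsSmoothFamily (n := n) G) (p : M) :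
    ContMDiff 𝓘(ℝ, ℝ) (𝓡 (2 * n + 1)) ∞ (fun s : ℝ => G s p) :=
  hG.comp (contMDiff_id.prodMk contMDiff_const)

theorem IsSmoothFamily.contMDiff_map {G : ℝ → M → M} (hG : IsSmoothFamily (n := n) G) (t : ℝ) :
    ContMDiff (𝓡 (2 * n + 1)) (𝓡 (2 * n + 1)) ∞ (G t) :=
  hG.comp (contMDiff_const.prodMk contMDiff_id)

theorem IsSmoothFamily.mdifferentiableAt_curve {G : ℝ → M → M}
    (hG : IsSmoothFamily (n := n) G) (p : M) (t : ℝ) :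
    MDifferentiableAt 𝓘(ℝ, ℝ) (𝓡 (2 * n + 1)) (fun s : ℝ => G s p) t :=
  (hG.contMDiff_curve p).mdifferentiableAt (by simp)

theorem IsSmoothFamily.reparam {G : ℝ → M → M} (hG : IsSmoothFamily (n := n) G) {θ : ℝ → ℝ}
    (hθ : ContDiff ℝ ∞ θ) : IsSmoothFamily (n := n) (fun t => G (θ t)) :=
  hG.comp ((hθ.contMDiff.comp contMDiff_fst).prodMk contMDiff_snd)

theorem IsSmoothFamily.comp {G H : ℝ → M → M} (hG : IsSmoothFamily (n := n) G)
    (hH : IsSmoothFamily (n := n) H) : IsSmoothFamily (n := n) (fun t p => G t (H t p)) :=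
  ContMDiff.comp (g := fun q : ℝ × M => G q.1 q.2) (f := fun q : ℝ × M => (q.1, H q.1 q.2))
    hG (contMDiff_fst.prodMk hH)

theorem isSmoothFamily_const {f : M → M}
    (hf : ContMDiff (𝓡 (2 * n + 1)) (𝓡 (2 * n + 1)) ∞ f) :
    IsSmoothFamily (n := n) (fun _ => f) :=
  hf.comp contMDiff_snd

theorem IsSmoothFamily.velocity_reparam {G : ℝ → M → M} (hG : IsSmoothFamily (n := n) G)
    {θ : ℝ → ℝ} (hθ : ContDiff ℝ ∞ θ) (t : ℝ) (p : M) :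
    velocity (n := n) (fun s => G (θ s)) t p = deriv θ t • velocity (n := n) G (θ t) p := by
  have h1 := hG.mdifferentiableAt_curve p (θ t)
  have h2 : MDifferentiableAt 𝓘(ℝ, ℝ) 𝓘(ℝ, ℝ) θ t :=
    (hθ.differentiable (by simp) t).mdifferentiableAt
  have := mfderiv_comp t h1 h2
  unfold velocity
  refine (congrArg (fun L => L (1 : ℝ)) this).trans ?_
  rw [mfderiv_eq_fderiv]
  change (mfderiv 𝓘(ℝ, ℝ) (𝓡 (2 * n + 1)) (fun s : ℝ => G s p) (θ t)) (fderiv ℝ θ t (1 : ℝ)) = _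
  have h3 : fderiv ℝ θ t (1 : ℝ) = deriv θ t • (1 : ℝ) := by simp
  rw [h3]
  exact map_smul _ _ _

theorem velocity_congr {G H : ℝ → M → M} {t : ℝ} {p : M}
    (h : (fun s => G s p) =ᶠ[𝓝 t] fun s => H s p) :
    (velocity (n := n) G t p : Eucl n) = velocity (n := n) H t p := by
  unfold velocity
  exact congrArg (fun L : ℝ →L[ℝ] Eucl n => L (1 : ℝ)) h.mfderiv_eq

theorem velocity_const (f : M → M) (t : ℝ) (p : M) :
    velocity (n := n) (fun _ => f) t p = 0 := by
  unfold velocity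
  rw [mfderiv_const]
  rfl

theorem velocity_eq_zero {G : ℝ → M → M} {t : ℝ} {p q : M}
    (h : (fun s => G s p) =ᶠ[𝓝 t] fun _ => q) : velocity (n := n) G t p = 0 :=
  (velocity_congr (n := n) (H := fun _ _ => q) h).trans (velocity_const (n := n) (fun _ => q) t p)

/-- The velocity of a composition of two families. -/
theorem IsSmoothFamily.velocity_comp {G H : ℝ → M → M} (hG : IsSmoothFamily (n := n) G)
    (hH : IsSmoothFamily (n := n) H) (t : ℝ) (p : M) :
    velocity (n := n) (fun s p => G s (H s p)) t p =
      (mfderiv (𝓡 (2 * n + 1)) (𝓡 (2 * n + 1)) (G t) (H t p) (velocity (n := n) H t p) +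
        velocity (n := n) G t (H t p) : Eucl n) := by
  have h1 : MDifferentiableAt (𝓘(ℝ, ℝ).prod (𝓡 (2 * n + 1))) (𝓡 (2 * n + 1))
      (fun q : ℝ × M => G q.1 q.2) (t, H t p) := ContMDiff.mdifferentiableAt hG (by simp)
  have h2 := hH.mdifferentiableAt_curve p t
  have h3 : MDifferentiableAt 𝓘(ℝ, ℝ) (𝓘(ℝ, ℝ).prod (𝓡 (2 * n + 1)))
      (fun s : ℝ => (s, H s p)) t := mdifferentiableAt_id.prodMk h2
  have h4 := mfderiv_comp (x := t) (g := fun q : ℝ × M => G q.1 q.2)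
    (f := fun s : ℝ => (s, H s p)) h1 h3
  refine (congrArg (fun L : ℝ →L[ℝ] Eucl n => L (1 : ℝ)) h4).trans ?_
  have h5 := mdifferentiableAt_id.mfderiv_prod (I := 𝓘(ℝ, ℝ)) (x := t) h2
  change mfderiv (𝓘(ℝ, ℝ).prod (𝓡 (2 * n + 1))) (𝓡 (2 * n + 1))
    (fun q : ℝ × M => G q.1 q.2) (t, H t p) (mfderiv 𝓘(ℝ, ℝ) (𝓘(ℝ, ℝ).prod (𝓡 (2 * n + 1)))
      (fun s : ℝ => (s, H s p)) t (1 : ℝ)) = _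
  have h6 : mfderiv 𝓘(ℝ, ℝ) (𝓘(ℝ, ℝ).prod (𝓡 (2 * n + 1))) (fun s : ℝ => (s, H s p)) t (1 : ℝ) =
      ((1 : ℝ), velocity (n := n) H t p) := by
    refine (congrArg (fun L : ℝ →L[ℝ] ℝ × Eucl n => L (1 : ℝ)) h5).trans ?_
    rw [mfderiv_id]
    rfl
  rw [h6]
  refine (mfderiv_prod_eq_add_apply h1
    (v := (((1 : ℝ), velocity (n := n) H t p) : ℝ × Eucl n))).trans ?_
  exact add_comm (_ : Eucl n) _

end Velocity

/-! ### Perturbations read in a chart, and the equivalence relation of null isotopy -/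

section NullIsotopy

set_option linter.unusedSectionVars false

variable {n : ℕ} {M : Type*} [TopologicalSpace M] [ChartedSpace (Eucl n) M]
  {ψ : OpenPartialHomeomorph M (Eucl n)} {w : ℝ → Eucl n → Eucl n}

theorem IsChartPerturbation.isSmoothFamily (h : IsChartPerturbation ψ w) :
    IsSmoothFamily (n := n) (fun t => perturb ψ (w t)) := by
  obtain ⟨G, hG, hs, -⟩ := h.exists_diffeos
  have : (fun t => perturb ψ (w t)) = fun t => ⇑(G t) := by
    funext t p
    exact (hG t p).symm
  rw [this]
  exact hs

theorem IsChartPerturbation.perturb_mem (h : IsChartPerturbation ψ w) (t : ℝ) {p : M}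
    (hp : p ∈ ψ.source) : perturb ψ (w t) p ∈ ψ.source := by
  rw [perturb_of_mem _ hp]
  exact ψ.map_target (h.add_mem t (ψ.map_source hp))

theorem IsChartPerturbation.chart_perturb (h : IsChartPerturbation ψ w) (t : ℝ) {p : M}
    (hp : p ∈ ψ.source) : ψ (perturb ψ (w t) p) = ψ p + w t (ψ p) := by
  rw [perturb_of_mem _ hp, ψ.right_inv (h.add_mem t (ψ.map_source hp))]

theorem IsChartPerturbation.mdifferentiableAt_chart (h : IsChartPerturbation ψ w) {p : M}
    (hp : p ∈ ψ.source) : MDifferentiableAt (𝓡 (2 * n + 1)) 𝓘(ℝ, Eucl n) ψ p :=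
  ((h.chart p hp).contMDiffAt (ψ.open_source.mem_nhds hp)).mdifferentiableAt (by simp)

theorem IsChartPerturbation.contDiffAt (h : IsChartPerturbation ψ w) (t : ℝ) {y : Eucl n}
    (hy : y ∈ ψ.target) : ContDiffAt ℝ ∞ (fun q : ℝ × Eucl n => w q.1 q.2) (t, y) :=
  (h.smooth (t, y) ⟨mem_univ _, hy⟩).contDiffAt
    ((isOpen_univ.prod ψ.open_target).mem_nhds ⟨mem_univ _, hy⟩)

theorem IsChartPerturbation.differentiableAt_space (h : IsChartPerturbation ψ w) (t : ℝ)
    {y : Eucl n} (hy : y ∈ ψ.target) : DifferentiableAt ℝ (w t) y :=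
  ((h.contDiffAt t hy).differentiableAt (by simp)).comp (f := fun x : Eucl n => (t, x)) y
    ((differentiableAt_const t).prodMk differentiableAt_id)

/-- The differential at `p` of an `ℝ²ⁿ⁺¹`-valued map, as a linear endomorphism of `ℝ²ⁿ⁺¹`. -/
def coordDeriv (ψ : M → Eucl n) (p : M) : Eucl n →L[ℝ] Eucl n :=
  mfderiv (𝓡 (2 * n + 1)) 𝓘(ℝ, Eucl n) ψ p

theorem OneForm.apply_congr (α : OneForm n M) {p q : M} (h : p = q) (v : Eucl n) :
    (α p v : ℝ) = α q v := by
  subst h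
  rfl

/-- The velocity of a perturbation supported in a chart, read in that chart. -/
theorem IsChartPerturbation.mfderiv_velocity (h : IsChartPerturbation ψ w) (t : ℝ) {p : M}
    (hp : p ∈ ψ.source) :
    coordDeriv ψ (perturb ψ (w t) p)
      (velocity (n := n) (fun s => perturb ψ (w s)) t p) = deriv (fun s => w s (ψ p)) t := by
  have h1 := h.mdifferentiableAt_chart (h.perturb_mem t hp)
  have h2 := h.isSmoothFamily.mdifferentiableAt_curve p t
  have h3 := mfderiv_comp (x := t) (g := ψ) (f := fun s => perturb ψ (w s) p) h1 h2
  have h4 : (ψ ∘ fun s => perturb ψ (w s) p) = fun s => ψ p + w s (ψ p) := by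
    funext s
    exact h.chart_perturb s hp
  rw [h4, mfderiv_eq_fderiv] at h3
  have h5 := congrArg (fun L : ℝ →L[ℝ] Eucl n => L (1 : ℝ)) h3
  refine Eq.trans h5.symm ?_
  change fderiv ℝ (fun s => ψ p + w s (ψ p)) t 1 = _
  rw [fderiv_const_add, fderiv_apply_one_eq_deriv]

/-- The differential of a perturbation supported in a chart, read in that chart. -/
theorem IsChartPerturbation.mfderiv_mfderiv (h : IsChartPerturbation ψ w) (t : ℝ) {p : M}
    (hp : p ∈ ψ.source) (v : TangentSpace (𝓡 (2 * n + 1)) p) :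
    coordDeriv ψ (perturb ψ (w t) p)
      (mfderiv (𝓡 (2 * n + 1)) (𝓡 (2 * n + 1)) (perturb ψ (w t)) p v) =
      coordDeriv ψ p v + fderiv ℝ (w t) (ψ p) (coordDeriv ψ p v) := by
  have h1 := h.mdifferentiableAt_chart (h.perturb_mem t hp)
  have h2 : MDifferentiableAt (𝓡 (2 * n + 1)) (𝓡 (2 * n + 1)) (perturb ψ (w t)) p :=
    (h.isSmoothFamily.contMDiff_map t).mdifferentiableAt (by simp)
  have h3 := mfderiv_comp (x := p) (g := ψ) (f := perturb ψ (w t)) h1 h2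
  have h0 := h.mdifferentiableAt_chart hp
  have hd : DifferentiableAt ℝ (fun y => y + w t y) (ψ p) :=
    differentiableAt_id.add (h.differentiableAt_space t (ψ.map_source hp))
  have h4 := mfderiv_comp (x := p) (g := fun y => y + w t y) (f := ψ) hd.mdifferentiableAt h0
  have h5 : (ψ ∘ perturb ψ (w t)) =ᶠ[𝓝 p] ((fun y => y + w t y) ∘ ψ) := by
    filter_upwards [ψ.open_source.mem_nhds hp] with q hq
    exact h.chart_perturb t hq
  have h6 := h3.symm.trans (h5.mfderiv_eq.trans h4)
  have h7 := congrArg (fun L : Eucl n →L[ℝ] Eucl n => L v) h6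
  refine Eq.trans h7 ?_
  change mfderiv 𝓘(ℝ, Eucl n) 𝓘(ℝ, Eucl n) (fun y => y + w t y) (ψ p)
    (mfderiv (𝓡 (2 * n + 1)) 𝓘(ℝ, Eucl n) ψ p v) = _
  rw [mfderiv_eq_fderiv]
  have h8 : HasFDerivAt (fun y => y + w t y)
      (ContinuousLinearMap.id ℝ (Eucl n) + fderiv ℝ (w t) (ψ p)) (ψ p) :=
    (hasFDerivAt_id _).add (h.differentiableAt_space t (ψ.map_source hp)).hasFDerivAt
  rw [h8.fderiv]
  rfl

theorem IsChartPerturbation.velocity_eq_zero (_ : IsChartPerturbation ψ w) (t : ℝ) {p : M}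
    (hp : p ∉ ψ.source) : velocity (n := n) (fun s => perturb ψ (w s)) t p = 0 :=
  _root_.velocity_eq_zero (q := p) (Filter.Eventually.of_forall fun _ => perturb_of_notMem _ hp)

/-- `b` is the end of a smooth path of diffeomorphisms that starts at `a`, has velocity in the
kernel of `α` and is constant outside a compact set. -/
def NullIsotopic (α : OneForm n M) (a b : Diffeos n M) : Prop :=
  ∃ G : ℝ → Diffeos n M, IsSmoothFamily (n := n) (fun t => ⇑(G t)) ∧
    (∀ t ≤ 1 / 4, G t = a) ∧ (∀ t, 3 / 4 ≤ t → G t = b) ∧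
    (∀ t p, (α (G t p) (velocity (n := n) (fun s => ⇑(G s)) t p) : ℝ) = 0) ∧
    ∃ K : Set M, IsCompact K ∧ ∀ t, ∀ x ∉ K, G t x = a x

variable {α : OneForm n M} {a b c : Diffeos n M}

theorem NullIsotopic.refl (a : Diffeos n M) : NullIsotopic α a a :=
  ⟨fun _ => a, isSmoothFamily_const a.contMDiff, fun _ _ => rfl, fun _ _ => rfl,
    fun t p => by
      have := velocity_const (n := n) (⇑a) t p
      exact (congrArg (α (a p)) this).trans (map_zero _),
    ∅, isCompact_empty, fun _ _ _ => rfl⟩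

theorem null_reparam {G : ℝ → M → M} (hG : IsSmoothFamily (n := n) G) {θ : ℝ → ℝ}
    (hθ : ContDiff ℝ ∞ θ) {t : ℝ} {p : M}
    (h : (α (G (θ t) p) (velocity (n := n) G (θ t) p) : ℝ) = 0) :
    (α (G (θ t) p) (velocity (n := n) (fun s => G (θ s)) t p) : ℝ) = 0 := by
  have h1 := hG.velocity_reparam hθ t p
  refine (congrArg (α (G (θ t) p)) h1).trans ?_
  refine (map_smul _ _ _).trans ?_
  exact (congrArg (fun r : ℝ => deriv θ t • r) h).trans (smul_zero _)

theorem NullIsotopic.symm (h : NullIsotopic α a b) : NullIsotopic α b a := by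
  obtain ⟨G, hs, h0, h1, hn, K, hK, hKa⟩ := h
  have hθ : ContDiff ℝ ∞ (fun t : ℝ => 1 - t) := contDiff_const.sub contDiff_id
  refine ⟨fun t => G (1 - t), hs.reparam hθ, fun t ht => h1 _ (by linarith),
    fun t ht => h0 _ (by linarith), fun t p => null_reparam hs hθ (hn _ p), K, hK,
    fun t x hx => ?_⟩
  rw [hKa _ x hx, ← h1 1 (by norm_num), hKa _ x hx]

/-- Precomposition with `c` turns the trajectory of `c p` into that of `p`, with the same velocity.
Composition on the left would not preserve `ker α`. -/
theorem NullIsotopic.comp_right (h : NullIsotopic α a b) (c : Diffeos n M) :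
    NullIsotopic α (c.trans a) (c.trans b) := by
  obtain ⟨G, hs, h0, h1, hn, K, hK, hKa⟩ := h
  refine ⟨fun t => c.trans (G t), hs.comp (isSmoothFamily_const c.contMDiff),
    fun t ht => congrArg _ (h0 t ht), fun t ht => congrArg _ (h1 t ht), fun t p => hn t (c p),
    c ⁻¹' K, ?_, fun t x hx => hKa t (c x) hx⟩
  exact c.toHomeomorph.isCompact_preimage.2 hK

theorem NullIsotopic.trans (h : NullIsotopic α a b) (h' : NullIsotopic α b c) :
    NullIsotopic α a c := by
  obtain ⟨G, hs, h0, h1, hn, K, hK, hKa⟩ := h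
  obtain ⟨G', hs', h0', h1', hn', K', hK', hKa'⟩ := h'
  have hθ : ContDiff ℝ ∞ (fun t : ℝ => 4 * t - 3 / 4) :=
    (contDiff_const.mul contDiff_id).sub contDiff_const
  have hθ' : ContDiff ℝ ∞ (fun t : ℝ => 4 * t - 9 / 4) :=
    (contDiff_const.mul contDiff_id).sub contDiff_const
  -- For `3/8 < t < 5/8` both formulas give `b`, since each path rests near its ends. So `H` is
  -- locally given by one smooth formula.
  set H : ℝ → Diffeos n M := fun t => if t < 1 / 2 then G (4 * t - 3 / 4) else G' (4 * t - 9 / 4)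
    with hH
  have hH1 : ∀ t < 5 / 8, H t = G (4 * t - 3 / 4) := by
    intro t ht
    by_cases h : t < 1 / 2
    · exact if_pos h
    · push Not at h
      rw [hH]
      simp only [not_lt.2 h, if_false]
      rw [h0' _ (by linarith), h1 _ (by linarith)]
  have hH2 : ∀ t, 3 / 8 < t → H t = G' (4 * t - 9 / 4) := by
    intro t ht
    by_cases h : t < 1 / 2
    · rw [hH]
      simp only [h, if_true]
      rw [h0' _ (by linarith), h1 _ (by linarith)]
    · exact if_neg h
  have hab : ∀ x ∉ K, b x = a x := fun x hx => by rw [← h1 1 (by norm_num), hKa 1 x hx]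
  refine ⟨H, ?_, fun t ht => ?_, fun t ht => ?_, fun t p => ?_, K ∪ K', hK.union hK',
    fun t x hx => ?_⟩
  · rintro ⟨t, p⟩
    rcases lt_or_ge t (1 / 2) with h | h
    · refine ((hs.reparam hθ) (t, p)).congr_of_eventuallyEq ?_
      have : Iio (5 / 8 : ℝ) ×ˢ (univ : Set M) ∈ 𝓝 (t, p) :=
        (isOpen_Iio.prod isOpen_univ).mem_nhds ⟨by simp only [mem_Iio]; linarith, mem_univ _⟩
      filter_upwards [this] with q hq
      rw [hH1 _ hq.1]
    · refine ((hs'.reparam hθ') (t, p)).congr_of_eventuallyEq ?_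
      have : Ioi (3 / 8 : ℝ) ×ˢ (univ : Set M) ∈ 𝓝 (t, p) :=
        (isOpen_Ioi.prod isOpen_univ).mem_nhds ⟨by simp only [mem_Ioi]; linarith, mem_univ _⟩
      filter_upwards [this] with q hq
      rw [hH2 _ hq.1]
  · rw [hH1 t (by linarith), h0 _ (by linarith)]
  · rw [hH2 t (by linarith), h1' _ (by linarith)]
  · rcases lt_or_ge t (1 / 2) with h | h
    · have hv : (velocity (n := n) (fun s => ⇑(H s)) t p : Eucl n) =
          velocity (n := n) (fun s => ⇑(G (4 * s - 3 / 4))) t p := by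
        refine velocity_congr ?_
        filter_upwards [Iio_mem_nhds (show t < 5 / 8 by linarith)] with s hs
        rw [hH1 s hs]
      refine (congrArg (α _) hv).trans ((α.apply_congr
        (congrArg (fun D : Diffeos n M => D p) (hH1 t (by linarith))) _).trans ?_)
      exact null_reparam hs hθ (hn _ p)
    · have hv : (velocity (n := n) (fun s => ⇑(H s)) t p : Eucl n) =
          velocity (n := n) (fun s => ⇑(G' (4 * s - 9 / 4))) t p := by
        refine velocity_congr ?_
        filter_upwards [Ioi_mem_nhds (show 3 / 8 < t by linarith)] with s hs
        rw [hH2 s hs]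
      refine (congrArg (α _) hv).trans ((α.apply_congr
        (congrArg (fun D : Diffeos n M => D p) (hH2 t (by linarith))) _).trans ?_)
      exact null_reparam hs' hθ' (hn' _ p)
  · have hx1 : x ∉ K := fun h => hx (Or.inl h)
    have hx2 : x ∉ K' := fun h => hx (Or.inr h)
    by_cases h : t < 1 / 2
    · rw [hH1 t (by linarith), hKa _ x hx1]
    · push Not at h
      rw [hH2 t (by linarith), hKa' _ x hx2, hab x hx1]

end NullIsotopy

/-! ### Straight Legendrian segments in a Darboux chart -/

section ChartNull

/-- The index of the coordinate `xᵢ`. -/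
def xIdx {n : ℕ} (i : Fin n) : Fin (2 * n + 1) := ⟨(i : ℕ), by omega⟩

/-- The index of the coordinate `yᵢ`. -/
def yIdx {n : ℕ} (i : Fin n) : Fin (2 * n + 1) := ⟨n + (i : ℕ), by omega⟩

/-- The index of the coordinate `z`. -/
def zIdx {n : ℕ} : Fin (2 * n + 1) := Fin.last (2 * n)

/-- The coordinate vectors of `ℝ²ⁿ⁺¹`. -/
def basisVec {n : ℕ} (k : Fin (2 * n + 1)) : Eucl n := EuclideanSpace.single k (1 : ℝ)

section

variable {n : ℕ} (i j : Fin n)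

theorem basisVec_apply (k l : Fin (2 * n + 1)) :
    (basisVec k : Eucl n) l = if l = k then 1 else 0 := by
  simp [basisVec]

@[simp] theorem basisVec_self (k : Fin (2 * n + 1)) : (basisVec k : Eucl n) k = 1 := by
  simp [basisVec_apply]

@[simp] theorem norm_basisVec (k : Fin (2 * n + 1)) : ‖(basisVec k : Eucl n)‖ = 1 := by
  simp [basisVec]

@[simp] theorem basisVec_x_x : (basisVec (xIdx i) : Eucl n) (xIdx j) = if j = i then 1 else 0 := by
  simp [basisVec_apply, xIdx, Fin.ext_iff]

@[simp] theorem basisVec_x_y : (basisVec (xIdx i) : Eucl n) (yIdx j) = 0 := by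
  have : n + (j : ℕ) ≠ i := by omega
  simp [basisVec_apply, xIdx, yIdx, this]

@[simp] theorem basisVec_x_z : (basisVec (xIdx i) : Eucl n) zIdx = 0 := by
  have : 2 * n ≠ i := by omega
  simp [basisVec_apply, xIdx, zIdx, Fin.ext_iff, this]

@[simp] theorem basisVec_y_x : (basisVec (yIdx i) : Eucl n) (xIdx j) = 0 := by
  have : (j : ℕ) ≠ n + i := by omega
  simp [basisVec_apply, xIdx, yIdx, this]

@[simp] theorem basisVec_y_y : (basisVec (yIdx i) : Eucl n) (yIdx j) = if j = i then 1 else 0 := by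
  simp [basisVec_apply, yIdx, Fin.ext_iff]

@[simp] theorem basisVec_y_z : (basisVec (yIdx i) : Eucl n) zIdx = 0 := by
  have : 2 * n ≠ n + i := by omega
  simp [basisVec_apply, yIdx, zIdx, Fin.ext_iff, this]

@[simp] theorem basisVec_z_x : (basisVec zIdx : Eucl n) (xIdx j) = 0 := by
  have : (j : ℕ) ≠ 2 * n := by omega
  simp [basisVec_apply, xIdx, zIdx, Fin.ext_iff, this]

@[simp] theorem basisVec_z_y : (basisVec zIdx : Eucl n) (yIdx j) = 0 := by
  have : n + (j : ℕ) ≠ 2 * n := by omega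
  simp [basisVec_apply, yIdx, zIdx, Fin.ext_iff, this]

theorem stdContactForm_apply (p v : Eucl n) :
    stdContactForm n p v = v zIdx + ∑ i : Fin n, p (xIdx i) * v (yIdx i) := by
  simp [stdContactForm, zIdx, xIdx, yIdx]

end

/-- A chart of `M`, smooth together with its inverse, which matches `ker α` with the standard
contact structure. -/
structure IsDarbouxMap {n : ℕ} {M : Type*} [TopologicalSpace M] [ChartedSpace (Eucl n) M]
    (α : OneForm n M) (ψ : OpenPartialHomeomorph M (Eucl n)) : Prop where
  chart : ContMDiffOn (𝓡 (2 * n + 1)) 𝓘(ℝ, Eucl n) ∞ ψ ψ.source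
  chart_symm : ContMDiffOn 𝓘(ℝ, Eucl n) (𝓡 (2 * n + 1)) ∞ ψ.symm ψ.target
  ker : ∀ x ∈ ψ.source, ∀ v : TangentSpace (𝓡 (2 * n + 1)) x,
    stdContactForm n (ψ x) (coordDeriv ψ x v) = 0 ↔ (α x v : ℝ) = 0

/-- A smooth family of maps supported in a compact set which is `1/4`-Lipschitz at one time is
`1/2`-Lipschitz at nearby times. -/
theorem eventually_lipschitzWith {E : Type*} [NormedAddCommGroup E] [NormedSpace ℝ E]
    {w : ℝ → E → E} (hw : ContDiff ℝ ∞ (fun q : ℝ × E => w q.1 q.2)) {Q : Set E}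
    (hQ : IsCompact Q) (hz : ∀ t, ∀ y ∉ Q, w t y = 0) {t₀ : ℝ}
    (h0 : LipschitzWith (1 / 4) (w t₀)) : ∀ᶠ t in 𝓝 t₀, LipschitzWith (1 / 2) (w t) := by
  have hd : ∀ t y, HasFDerivAt (w t)
      ((fderiv ℝ (fun q : ℝ × E => w q.1 q.2) (t, y)).comp (ContinuousLinearMap.inr ℝ ℝ E)) y := by
    intro t y
    have hi : HasFDerivAt (fun x : E => ((t, x) : ℝ × E)) (ContinuousLinearMap.inr ℝ ℝ E) y :=
      hasFDerivAt_prodMk_right t y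
    exact HasFDerivAt.comp y (f := fun x : E => ((t, x) : ℝ × E))
      ((hw.differentiable (by simp) (t, y)).hasFDerivAt) hi
  have hc : Continuous (fun q : ℝ × E =>
      ‖(fderiv ℝ (fun q : ℝ × E => w q.1 q.2) q).comp (ContinuousLinearMap.inr ℝ ℝ E)‖) :=
    ((hw.continuous_fderiv (by simp)).clm_comp continuous_const).norm
  have key : ∀ᶠ t in 𝓝 t₀, ∀ y ∈ Q,
      ‖(fderiv ℝ (fun q : ℝ × E => w q.1 q.2) (t, y)).comp (ContinuousLinearMap.inr ℝ ℝ E)‖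
        < 1 / 2 := by
    refine hQ.eventually_forall_of_forall_eventually fun y _ => ?_
    refine (hc.tendsto (t₀, y)).eventually_lt_const ?_
    have := (hd t₀ y).le_of_lipschitz h0
    have h4 : ((1 / 4 : NNReal) : ℝ) < 1 / 2 := by norm_num
    exact this.trans_lt h4
  filter_upwards [key] with t ht
  refine lipschitzWith_of_nnnorm_fderiv_le (fun y => (hd t y).differentiableAt) fun y => ?_
  by_cases hy : y ∈ Q
  · rw [(hd t y).fderiv]
    have := (ht y hy).le
    rw [← NNReal.coe_le_coe]
    simpa using this
  · have : w t =ᶠ[𝓝 y] fun _ => 0 := by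
      filter_upwards [hQ.isClosed.isOpen_compl.mem_nhds hy] with z hz'
      exact hz t z hz'
    rw [this.fderiv_eq]
    simp

variable {n : ℕ} {M : Type*} [TopologicalSpace M] [T2Space M] [ChartedSpace (Eucl n) M]
  {ψ : OpenPartialHomeomorph M (Eucl n)} {α : OneForm n M}

/-- A compact support in the target of the chart is closed in all of `M`, because `M` is Hausdorff.
-/
theorem IsDarbouxMap.isChartPerturbation (hψ : IsDarbouxMap α ψ) {Q : Set (Eucl n)}
    (hQ : IsCompact Q) (hQψ : Q ⊆ ψ.target) {w : ℝ → Eucl n → Eucl n}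
    (hw : ContDiff ℝ ∞ (fun q : ℝ × Eucl n => w q.1 q.2))
    (hlip : ∀ t, LipschitzWith (1 / 2) (w t)) (hz : ∀ t, ∀ y ∉ Q, w t y = 0) :
    IsChartPerturbation ψ w where
  chart := hψ.chart
  chart_symm := hψ.chart_symm
  smooth := hw.contDiffOn
  lip := hlip
  supp := by
    refine ⟨ψ.symm '' Q, (hQ.image_of_continuousOn (ψ.continuousOn_symm.mono hQψ)).isClosed, ?_,
      fun t y hy => ?_⟩
    · rintro _ ⟨y, hy, rfl⟩
      exact ψ.map_target (hQψ hy)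
    · have hyQ : y ∈ Q := by
        by_contra h
        exact hy (hz t y h)
      exact ⟨ψ.symm y, ⟨y, hyQ, rfl⟩, ψ.right_inv (hQψ hyQ)⟩

/-- Two perturbations in a Darboux chart are related by a null path if the segments between them
are tangent to the standard contact structure. -/
theorem IsDarbouxMap.nullIsotopic_of_segment (hψ : IsDarbouxMap α ψ) {Q : Set (Eucl n)}
    (hQ : IsCompact Q) (hQψ : Q ⊆ ψ.target) {v v' : Eucl n → Eucl n} (hv : ContDiff ℝ ∞ v)
    (hv' : ContDiff ℝ ∞ v') (hlip : LipschitzWith (1 / 2) v) (hlip' : LipschitzWith (1 / 2) v')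
    (hz : ∀ y ∉ Q, v y = 0) (hz' : ∀ y ∉ Q, v' y = 0)
    (hnull : ∀ (τ : ℝ) (y : Eucl n),
      stdContactForm n (y + (v y + τ • (v' y - v y))) (v' y - v y) = 0)
    {a b : Diffeos n M} (ha : ∀ p, a p = perturb ψ v p) (hb : ∀ p, b p = perturb ψ v' p) :
    NullIsotopic α a b := by
  -- This runs from `0` to `1` and is constant for `t ≤ 1/4` and for `t ≥ 3/4`, as `NullIsotopic`
  -- asks.
  set s : ℝ → ℝ := fun t => Real.smoothTransition (2 * t - 1 / 2) with hs
  have hss : ContDiff ℝ ∞ s :=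
    Real.smoothTransition.contDiff.comp ((contDiff_const.mul contDiff_id).sub contDiff_const)
  set w : ℝ → Eucl n → Eucl n := fun t y => v y + s t • (v' y - v y) with hw
  have hP : IsChartPerturbation ψ w := by
    refine hψ.isChartPerturbation hQ hQψ ?_ (fun t => ?_) (fun t y hy => ?_)
    · exact (hv.comp contDiff_snd).add ((hss.comp contDiff_fst).smul
        ((hv'.comp contDiff_snd).sub (hv.comp contDiff_snd)))
    · refine LipschitzWith.of_dist_le_mul fun x y => ?_
      have h1 := hlip.dist_le_mul x y
      have h2 := hlip'.dist_le_mul x y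
      rw [dist_eq_norm] at h1 h2 ⊢
      -- Convex combinations of `1/2`-Lipschitz maps are `1/2`-Lipschitz, so every map along the
      -- segment is still a diffeomorphism.
      have h3 : w t x - w t y = (1 - s t) • (v x - v y) + s t • (v' x - v' y) := by
        simp only [hw]
        module
      have h4 : 0 ≤ s t := Real.smoothTransition.nonneg _
      have h5 : 0 ≤ 1 - s t := sub_nonneg.2 (Real.smoothTransition.le_one _)
      rw [h3]
      calc _ ≤ (1 - s t) * ‖v x - v y‖ + s t * ‖v' x - v' y‖ := by
            refine (norm_add_le _ _).trans_eq ?_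
            rw [norm_smul, norm_smul, Real.norm_of_nonneg h4, Real.norm_of_nonneg h5]
        _ ≤ (1 - s t) * (((1 / 2 : NNReal) : ℝ) * dist x y) +
            s t * (((1 / 2 : NNReal) : ℝ) * dist x y) := by gcongr
        _ = _ := by ring
    · simp [hw, hz y hy, hz' y hy]
  obtain ⟨G, hG, hGs, -⟩ := hP.exists_diffeos
  have hs0 : ∀ t ≤ 1 / 4, s t = 0 := fun t ht =>
    Real.smoothTransition.zero_of_nonpos (by linarith)
  have hs1 : ∀ t, 3 / 4 ≤ t → s t = 1 := fun t ht =>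
    Real.smoothTransition.one_of_one_le (by linarith)
  have hGv : ∀ t p, (velocity (n := n) (fun s => ⇑(G s)) t p : Eucl n) =
      velocity (n := n) (fun s => perturb ψ (w s)) t p := fun t p =>
    velocity_congr (Filter.Eventually.of_forall fun s => hG s p)
  refine ⟨G, hGs, fun t ht => ?_, fun t ht => ?_, fun t p => ?_, ψ.symm '' Q,
    hQ.image_of_continuousOn (ψ.continuousOn_symm.mono hQψ), fun t p hp => ?_⟩
  · ext p
    rw [hG, ha]
    simp [hw, hs0 t ht]
  · ext p
    rw [hG, hb]
    simp [hw, hs1 t ht]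
  · refine (α.apply_congr (hG t p) _).trans ?_
    refine (congrArg (α (perturb ψ (w t) p)) (hGv t p)).trans ?_
    by_cases hp : p ∈ ψ.source
    · have h1 := hP.mfderiv_velocity t hp
      refine (hψ.ker _ (hP.perturb_mem t hp) _).1 ?_
      rw [h1, hP.chart_perturb t hp]
      have h2 : HasDerivAt (fun r => w r (ψ p)) (deriv s t • (v' (ψ p) - v (ψ p))) t := by
        have := ((hss.differentiable (by simp) t).hasDerivAt).smul_const (v' (ψ p) - v (ψ p))
        exact this.const_add (v (ψ p))
      rw [h2.deriv, map_smul, hnull, smul_zero]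
    · exact (congrArg (α _) (hP.velocity_eq_zero t hp)).trans (map_zero _)
  · have h0 : ∀ u : Eucl n → Eucl n, (∀ y ∉ Q, u y = 0) → perturb ψ u p = p := by
      intro u hu
      by_cases hpψ : p ∈ ψ.source
      · refine perturb_of_eq_zero (hu _ fun h => hp ⟨ψ p, h, ψ.left_inv hpψ⟩)
      · exact perturb_of_notMem _ hpψ
    rw [hG, ha, h0 v hz, h0 (w t) (fun y hy => by simp [hw, hz y hy, hz' y hy])]

end ChartNull

/-! ### Small perturbations in a Darboux chart as chains of six segments -/

section ChartChain

theorem contDiff_coord {n : ℕ} {E : Type*} [NormedAddCommGroup E] [NormedSpace ℝ E]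
    {f : E → Eucl n} (hf : ContDiff ℝ ∞ f) (k : Fin (2 * n + 1)) :
    ContDiff ℝ ∞ (fun q => f q k) :=
  (EuclideanSpace.proj k : Eucl n →L[ℝ] ℝ).contDiff.comp hf

/-- A smooth cutoff function of a compact set. -/
theorem exists_contDiff_cutoff {E : Type*} [NormedAddCommGroup E] [NormedSpace ℝ E]
    [FiniteDimensional ℝ E] {Q O : Set E} (hQ : IsCompact Q) (hO : IsOpen O) (hQO : Q ⊆ O) :
    ∃ (χ : E → ℝ) (L : Set E), ContDiff ℝ ∞ χ ∧ IsCompact L ∧ L ⊆ O ∧ Q ⊆ L ∧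
      (∀ y ∈ Q, χ y = 1) ∧ ∀ y ∉ L, χ y = 0 := by
  obtain ⟨L, hL, hQL, hLO⟩ := exists_compact_between hQ hO hQO
  obtain ⟨χ, h0, h1, -⟩ := exists_contMDiffMap_zero_one_of_isClosed (n := ⊤) 𝓘(ℝ, E)
    (s := (interior L)ᶜ) (t := Q) isOpen_interior.isClosed_compl hQ.isClosed
    (disjoint_left.2 fun x hx hx' => hx (hQL hx'))
  refine ⟨χ, L, χ.contMDiff.contDiff, hL, hLO, hQL.trans interior_subset, fun y hy => h1 hy,
    fun y hy => h0 fun h => hy (interior_subset h)⟩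

variable {n : ℕ} {M : Type*} [TopologicalSpace M] [T2Space M] [ChartedSpace (Eucl n) M]
  {ψ : OpenPartialHomeomorph M (Eucl n)} {α : OneForm n M}

/-- A diffeomorphism which is a small perturbation of the identity supported in a Darboux chart is
the end of a null path starting at the identity. -/
theorem IsDarbouxMap.eventually_nullIsotopic (hn : 1 ≤ n) (hψ : IsDarbouxMap α ψ)
    {Q : Set (Eucl n)} (hQ : IsCompact Q) (hQψ : Q ⊆ ψ.target) {w : ℝ → Eucl n → Eucl n}
    (hw : ContDiff ℝ ∞ (fun q : ℝ × Eucl n => w q.1 q.2)) (hz : ∀ t, ∀ y ∉ Q, w t y = 0)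
    {t₀ : ℝ} (h0 : ∀ y, w t₀ y = 0) :
    ∀ᶠ t in 𝓝 t₀, ∀ a b : Diffeos n M, (∀ p, a p = p) → (∀ p, b p = perturb ψ (w t) p) →
      NullIsotopic α a b := by
  obtain ⟨χ, L, hχ, hL, hLψ, hQL, hχ1, hχ0⟩ := exists_contDiff_cutoff hQ ψ.open_target hQψ
  obtain ⟨K, hK⟩ := hχ.lipschitzWith_of_hasCompactSupport
    (HasCompactSupport.intro hL hχ0) (by simp)
  -- With this `c` the function `c χ` is `1/4`-Lipschitz. At `t₀` the stages `w3` and `w4` equal the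
  -- shift by `c χ` in one `x`-coordinate, so they remain `1/2`-Lipschitz at nearby times.
  set c : ℝ := 1 / (4 * (K + 1)) with hc
  have hKpos : (0 : ℝ) < K + 1 := by positivity
  have hcpos : 0 < c := by positivity
  let o : Fin n := ⟨0, hn⟩
  -- `u` is the error in `z` left after moving `x`, then `y` together with the forced change of `z`.
  set u : ℝ → Eucl n → ℝ := fun t y =>
    w t y zIdx + ∑ i : Fin n, w t y (yIdx i) * (y (xIdx i) + w t y (xIdx i)) with hu
  set b : ℝ → Eucl n → ℝ := fun t y => -(u t y / c) with hb
  -- Stages of the chain: `w1` moves all `x`; `w2` moves all `y` and the forced `z`. The remaining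
  -- stages run around a rectangle in the plane of `xIdx o` and `yIdx o`: `x` by `c χ`, `y` by `b`,
  -- `x` back, and finally `y` back, which ends at `w`. In each of them either only `x` moves, or
  -- `x` is constant and `z` compensates `y`.
  set w1 : ℝ → Eucl n → Eucl n := fun t y => ∑ i : Fin n, w t y (xIdx i) • basisVec (xIdx i)
    with hw1
  set w2 : ℝ → Eucl n → Eucl n := fun t y => w t y - u t y • basisVec zIdx with hw2
  set w3 : ℝ → Eucl n → Eucl n := fun t y => w2 t y + (c * χ y) • basisVec (xIdx o) with hw3
  set w4 : ℝ → Eucl n → Eucl n := fun t y =>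
    w3 t y + b t y • (basisVec (yIdx o) - (y (xIdx o) + w t y (xIdx o) + c * χ y) • basisVec zIdx)
    with hw4
  set w5 : ℝ → Eucl n → Eucl n := fun t y => w4 t y - (c * χ y) • basisVec (xIdx o) with hw5
  have hwc := fun k => contDiff_coord hw k
  have hyc := fun k => contDiff_coord (contDiff_snd (E := ℝ) (F := Eucl n) (𝕜 := ℝ) (n := ∞)) k
  have hχ' : ContDiff ℝ ∞ (fun q : ℝ × Eucl n => c * χ q.2) :=
    contDiff_const.mul (hχ.comp contDiff_snd)
  have su : ContDiff ℝ ∞ (fun q : ℝ × Eucl n => u q.1 q.2) :=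
    (hwc _).add (ContDiff.sum fun i _ => (hwc _).mul ((hyc _).add (hwc _)))
  have sb : ContDiff ℝ ∞ (fun q : ℝ × Eucl n => b q.1 q.2) := (su.div_const c).neg
  have s1 : ContDiff ℝ ∞ (fun q : ℝ × Eucl n => w1 q.1 q.2) :=
    ContDiff.sum fun i _ => (hwc _).smul contDiff_const
  have s2 : ContDiff ℝ ∞ (fun q : ℝ × Eucl n => w2 q.1 q.2) := hw.sub (su.smul contDiff_const)
  have s3 : ContDiff ℝ ∞ (fun q : ℝ × Eucl n => w3 q.1 q.2) := s2.add (hχ'.smul contDiff_const)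
  have s4 : ContDiff ℝ ∞ (fun q : ℝ × Eucl n => w4 q.1 q.2) :=
    s3.add (sb.smul (contDiff_const.sub ((((hyc _).add (hwc _)).add hχ').smul contDiff_const)))
  have s5 : ContDiff ℝ ∞ (fun q : ℝ × Eucl n => w5 q.1 q.2) := s4.sub (hχ'.smul contDiff_const)
  have zu : ∀ t, ∀ y ∉ Q, u t y = 0 := fun t y hy => by simp [hu, hz t y hy]
  have zb : ∀ t, ∀ y ∉ Q, b t y = 0 := fun t y hy => by simp [hb, zu t y hy]
  have z1 : ∀ t, ∀ y ∉ L, w1 t y = 0 := fun t y hy => by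
    simp [hw1, hz t y fun h => hy (hQL h)]
  have z2 : ∀ t, ∀ y ∉ L, w2 t y = 0 := fun t y hy => by
    simp [hw2, hz t y fun h => hy (hQL h), zu t y fun h => hy (hQL h)]
  have z3 : ∀ t, ∀ y ∉ L, w3 t y = 0 := fun t y hy => by simp [hw3, z2 t y hy, hχ0 y hy]
  have z4 : ∀ t, ∀ y ∉ L, w4 t y = 0 := fun t y hy => by
    simp [hw4, z3 t y hy, zb t y fun h => hy (hQL h)]
  have z5 : ∀ t, ∀ y ∉ L, w5 t y = 0 := fun t y hy => by simp [hw5, z4 t y hy, hχ0 y hy]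
  have z0 : ∀ t, ∀ y ∉ L, w t y = 0 := fun t y hy => hz t y fun h => hy (hQL h)
  have hu0 : ∀ y, u t₀ y = 0 := fun y => by simp [hu, h0]
  have hb0 : ∀ y, b t₀ y = 0 := fun y => by simp [hb, hu0]
  have l0 : LipschitzWith (1 / 4) (fun _ : Eucl n => (0 : Eucl n)) := LipschitzWith.const' 0
  have l3 : LipschitzWith (1 / 4) (fun y : Eucl n => (c * χ y) • (basisVec (xIdx o) : Eucl n)) := by
    refine LipschitzWith.of_dist_le_mul fun x y => ?_
    have h1 := hK.dist_le_mul x y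
    rw [dist_eq_norm, ← sub_smul, norm_smul, norm_basisVec, mul_one, ← mul_sub, norm_mul,
      ← dist_eq_norm, Real.norm_of_nonneg hcpos.le]
    calc c * dist (χ x) (χ y) ≤ c * ((K + 1) * dist x y) := by
          gcongr
          exact h1.trans (by gcongr; linarith)
      _ = (c * (K + 1)) * dist x y := by ring
      _ = _ := by
          congr 1
          rw [hc]
          push_cast
          field_simp
  have e0 := eventually_lipschitzWith hw hL z0 (t₀ := t₀) (by simpa [funext h0] using l0)
  have e1 := eventually_lipschitzWith s1 hL z1 (t₀ := t₀) (by simpa [hw1, h0] using l0)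
  have e2 := eventually_lipschitzWith s2 hL z2 (t₀ := t₀) (by simpa [hw2, h0, hu0] using l0)
  have e3 := eventually_lipschitzWith s3 hL z3 (t₀ := t₀) (by simpa [hw3, hw2, h0, hu0] using l3)
  have e4 := eventually_lipschitzWith s4 hL z4 (t₀ := t₀)
    (by simpa [hw4, hw3, hw2, h0, hu0, hb0] using l3)
  have e5 := eventually_lipschitzWith s5 hL z5 (t₀ := t₀)
    (by simpa [hw5, hw4, hw3, hw2, h0, hu0, hb0] using l0)
  filter_upwards [e0, e1, e2, e3, e4, e5] with t le0 le1 le2 le3 le4 le5 a₀ a₆ ha₀ ha₆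
  have slice : ∀ {f : ℝ → Eucl n → Eucl n}, ContDiff ℝ ∞ (fun q : ℝ × Eucl n => f q.1 q.2) →
      ContDiff ℝ ∞ (f t) := fun hf => hf.comp (contDiff_const.prodMk contDiff_id)
  have hex : ∀ f : Eucl n → Eucl n, ContDiff ℝ ∞ f → LipschitzWith (1 / 2) f →
      (∀ y ∉ L, f y = 0) → ∃ G : Diffeos n M, ∀ p, G p = perturb ψ f p := by
    intro f hf hl hf0
    obtain ⟨G, hG, -⟩ := (hψ.isChartPerturbation hL hLψ (w := fun _ => f) (hf.comp contDiff_snd)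
      (fun _ => hl) (fun _ => hf0)).exists_diffeos
    exact ⟨G 0, hG 0⟩
  obtain ⟨a₁, ha₁⟩ := hex _ (slice s1) le1 (z1 t)
  obtain ⟨a₂, ha₂⟩ := hex _ (slice s2) le2 (z2 t)
  obtain ⟨a₃, ha₃⟩ := hex _ (slice s3) le3 (z3 t)
  obtain ⟨a₄, ha₄⟩ := hex _ (slice s4) le4 (z4 t)
  obtain ⟨a₅, ha₅⟩ := hex _ (slice s5) le5 (z5 t)
  have lz : LipschitzWith (1 / 2) (fun _ : Eucl n => (0 : Eucl n)) := LipschitzWith.const' 0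
  have n01 : NullIsotopic α a₀ a₁ := by
    refine hψ.nullIsotopic_of_segment hL hLψ (v := fun _ => 0) (v' := w1 t) contDiff_const
      (slice s1) lz le1 (fun _ _ => rfl) (z1 t) (fun τ y => ?_)
      (fun p => by rw [ha₀, perturb_of_eq_zero rfl]) ha₁
    simp [stdContactForm_apply, hw1]
  have n12 : NullIsotopic α a₁ a₂ := by
    refine hψ.nullIsotopic_of_segment hL hLψ (slice s1) (slice s2) le1 le2 (z1 t) (z2 t)
      (fun τ y => ?_) ha₁ ha₂
    simp [stdContactForm_apply, hw1, hw2, hu, mul_comm]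
  have n23 : NullIsotopic α a₂ a₃ := by
    refine hψ.nullIsotopic_of_segment hL hLψ (slice s2) (slice s3) le2 le3 (z2 t) (z3 t)
      (fun τ y => ?_) ha₂ ha₃
    simp [stdContactForm_apply, hw3]
  have n34 : NullIsotopic α a₃ a₄ := by
    refine hψ.nullIsotopic_of_segment hL hLψ (slice s3) (slice s4) le3 le4 (z3 t) (z4 t)
      (fun τ y => ?_) ha₃ ha₄
    simp [stdContactForm_apply, hw4, hw3, hw2]
    right
    ring
  have n45 : NullIsotopic α a₄ a₅ := by
    refine hψ.nullIsotopic_of_segment hL hLψ (slice s4) (slice s5) le4 le5 (z4 t) (z5 t)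
      (fun τ y => ?_) ha₄ ha₅
    simp [stdContactForm_apply, hw5]
  have n56 : NullIsotopic α a₅ a₆ := by
    have hd : ∀ y, w t y - w5 t y =
        -(b t y) • (basisVec (yIdx o) - (y (xIdx o) + w t y (xIdx o)) • basisVec zIdx) := by
      intro y
      -- The rectangle closes up exactly at `w`: on `Q` the cutoff is `1` and `b = -u / c`, and off
      -- `Q` both `u` and `b` vanish.
      have h1 : u t y = -(b t y * (c * χ y)) := by
        by_cases hy : y ∈ Q
        · rw [hχ1 y hy, hb]
          field_simp
        · rw [zu t y hy, zb t y hy, zero_mul, neg_zero]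
      simp only [hw5, hw4, hw3, hw2]
      rw [h1]
      module
    refine hψ.nullIsotopic_of_segment hL hLψ (slice s5) (slice hw) le5 le0 (z5 t) (z0 t)
      (fun τ y => ?_) ha₅ ha₆
    rw [hd y]
    simp [stdContactForm_apply, hw5, hw4, hw3, hw2]
    ring
  exact ((((n01.trans n12).trans n23).trans n34).trans n45).trans n56

end ChartChain

/-! ### Fragmentation of diffeomorphisms close to the identity -/

section Fragmentation

set_option linter.unusedSectionVars false

/-- A smooth function with small values which is the identity near `0`. -/
theorem exists_contDiff_eq_id_near_zero {δ : ℝ} (hδ : 0 < δ) :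
    ∃ θ : ℝ → ℝ, ContDiff ℝ ∞ θ ∧ (∀ s, |θ s| < δ) ∧ ∀ᶠ s in 𝓝 0, θ s = s := by
  let b : ContDiffBump (0 : ℝ) := ⟨δ / 4, δ / 2, by positivity, by linarith⟩
  refine ⟨fun s => s * b s, contDiff_id.mul b.contDiff, fun s => ?_, ?_⟩
  · by_cases hs : s ∈ Metric.ball (0 : ℝ) (δ / 2)
    · rw [abs_mul, abs_of_nonneg b.nonneg]
      have h1 : |s| < δ / 2 := by simpa using hs
      have h2 := b.le_one (x := s)
      nlinarith [abs_nonneg s, b.nonneg (x := s)]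
    · have : b s = 0 := b.zero_of_le_dist (by simpa using hs)
      simpa [this] using hδ
  · filter_upwards [b.eventuallyEq_one] with s hs
    rw [hs]
    simp

variable {n : ℕ} {M : Type*} [TopologicalSpace M] [T2Space M] [SigmaCompactSpace M]
  [ChartedSpace (Eucl n) M] [IsManifold (𝓡 (2 * n + 1)) ∞ M]
  {α : OneForm n M}

/-- Turns a family on `M` supported in a compact part of a chart into a displacement defined and
smooth on the whole vector space. -/
theorem ContMDiffOn.contDiff_chart_sub {ψ : OpenPartialHomeomorph M (Eucl n)}
    (h1 : ContMDiffOn (𝓡 (2 * n + 1)) 𝓘(ℝ, Eucl n) ∞ ψ ψ.source)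
    (h2 : ContMDiffOn 𝓘(ℝ, Eucl n) (𝓡 (2 * n + 1)) ∞ ψ.symm ψ.target)
    {k : ℝ → M → M} (hk : IsSmoothFamily (n := n) k) {D : Set M} (hD : IsCompact D)
    (hDψ : D ⊆ ψ.source) (hkD : ∀ t, ∀ p ∈ D, k t p ∈ ψ.source) (hkD' : ∀ t, ∀ p ∉ D, k t p = p)
    {w : ℝ → Eucl n → Eucl n} (hw : ∀ t, ∀ y ∈ ψ.target, w t y = ψ (k t (ψ.symm y)) - y)
    (hw' : ∀ t, ∀ y ∉ ψ.target, w t y = 0) :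
    ContDiff ℝ ∞ (fun q : ℝ × Eucl n => w q.1 q.2) ∧ ∀ t, ∀ y ∉ ψ '' D, w t y = 0 := by
  have hz : ∀ t, ∀ y ∉ ψ '' D, w t y = 0 := by
    intro t y hy
    by_cases hyψ : y ∈ ψ.target
    · have : ψ.symm y ∉ D := fun h => hy ⟨_, h, ψ.right_inv hyψ⟩
      rw [hw t y hyψ, hkD' t _ this, ψ.right_inv hyψ, sub_self]
    · exact hw' t y hyψ
  refine ⟨?_, hz⟩
  rw [contDiff_iff_contDiffAt]
  rintro ⟨t, y⟩
  by_cases hy : y ∈ ψ '' D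
  · have hyψ : y ∈ ψ.target := by
      obtain ⟨p, hp, rfl⟩ := hy
      exact ψ.map_source (hDψ hp)
    have hyD : ψ.symm y ∈ D := by
      obtain ⟨p, hp, rfl⟩ := hy
      rwa [ψ.left_inv (hDψ hp)]
    have a1 : ContMDiffAt 𝓘(ℝ, ℝ × Eucl n) (𝓘(ℝ, ℝ).prod (𝓡 (2 * n + 1))) ∞
        (fun q : ℝ × Eucl n => (q.1, ψ.symm q.2)) (t, y) := by
      refine ContMDiffAt.prodMk contDiffAt_fst.contMDiffAt ?_
      exact ContMDiffAt.comp (t, y) (g := ψ.symm) (f := fun q : ℝ × Eucl n => q.2)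
        ((h2 y hyψ).contMDiffAt (ψ.open_target.mem_nhds hyψ)) contDiffAt_snd.contMDiffAt
    have a2 : ContMDiffAt 𝓘(ℝ, ℝ × Eucl n) (𝓡 (2 * n + 1)) ∞
        (fun q : ℝ × Eucl n => k q.1 (ψ.symm q.2)) (t, y) :=
      ContMDiffAt.comp (t, y) (g := fun q : ℝ × M => k q.1 q.2) (hk.contMDiffAt) a1
    have a3 : ContMDiffAt 𝓘(ℝ, ℝ × Eucl n) 𝓘(ℝ, Eucl n) ∞
        (fun q : ℝ × Eucl n => ψ (k q.1 (ψ.symm q.2))) (t, y) :=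
      ContMDiffAt.comp (t, y) (g := ψ) ((h1 _ (hkD t _ hyD)).contMDiffAt
        (ψ.open_source.mem_nhds (hkD t _ hyD))) a2
    have a4 := a3.contDiffAt.sub contDiffAt_snd
    refine a4.congr_of_eventuallyEq ?_
    filter_upwards [(isOpen_univ.prod ψ.open_target).mem_nhds
      (show (t, y) ∈ (univ : Set ℝ) ×ˢ ψ.target from ⟨mem_univ _, hyψ⟩)] with q hq
    exact hw _ _ hq.2
  · have hcl : IsClosed (ψ '' D) :=
      (hD.image_of_continuousOn (ψ.continuousOn.mono hDψ)).isClosed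
    refine (contDiffAt_const (c := (0 : Eucl n))).congr_of_eventuallyEq ?_
    filter_upwards [(isOpen_univ.prod hcl.isOpen_compl).mem_nhds
      (show (t, y) ∈ (univ : Set ℝ) ×ˢ (ψ '' D)ᶜ from ⟨mem_univ _, hy⟩)] with q hq
    exact hz _ _ hq.2

/-- Induction on the charts that cover the support. A cutoff of the time parameter splits off a
factor `G` in the chart `ψ i` which agrees with `h` where the other charts do not reach, so `h ∘
G⁻¹` is supported in the other charts. With no chart left, `h` is the identity. -/
theorem eventually_nullIsotopic_refl (hn : 1 ≤ n) {ι : Type*}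
    {ψ : ι → OpenPartialHomeomorph M (Eucl n)} (hψ : ∀ i, IsDarbouxMap α (ψ i)) (t₀ : ℝ)
    (s : Finset ι) : ∀ (h : ℝ → Diffeos n M) (K : Set M),
      IsSmoothFamily (n := n) (fun t => ⇑(h t)) → IsCompact K → K ⊆ ⋃ i ∈ s, (ψ i).source →
      (∀ᶠ t in 𝓝 t₀, ∀ x ∉ K, h t x = x) → (∀ x, h t₀ x = x) →
      ∀ᶠ t in 𝓝 t₀, NullIsotopic α (Diffeomorph.refl _ _ _) (h t) := by
  classical
  induction s using Finset.induction_on with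
  | empty =>
    intro h K hs hK hKs hhK h0
    filter_upwards [hhK] with t ht
    have : h t = Diffeomorph.refl _ _ _ := by
      ext x
      exact ht x fun hx => by simpa using hKs hx
    rw [this]
    exact NullIsotopic.refl _
  | insert i s _ ih =>
    intro h K hs hK hKs hhK h0
    have hVo : IsOpen (⋃ j ∈ s, (ψ j).source) := isOpen_biUnion fun j _ => (ψ j).open_source
    have hLc : IsCompact (K \ ⋃ j ∈ s, (ψ j).source) := hK.diff hVo
    have hLU : K \ (⋃ j ∈ s, (ψ j).source) ⊆ (ψ i).source := by
      rintro x ⟨hx, hx'⟩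
      have := hKs hx
      rw [Finset.set_biUnion_insert] at this
      exact this.resolve_right hx'
    have : LocallyCompactSpace M := Manifold.locallyCompact_of_finiteDimensional (𝓡 (2 * n + 1))
    -- The part of `K` covered by `ψ i` alone lies in the interior of `C'`, and `C'`, `C`, `D` are
    -- nested. The cutoff `ρ` is `1` on `C` and `0` off `D`. The layer between `C'` and `C` prevents
    -- points outside `C` from being carried into `C'`.
    obtain ⟨C', hC', hLC', hC'U⟩ := exists_compact_between hLc (ψ i).open_source hLU
    obtain ⟨C, hC, hC'C, hCU⟩ := exists_compact_between hC' (ψ i).open_source hC'U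
    obtain ⟨D, hD, hCD, hDU⟩ := exists_compact_between hC (ψ i).open_source hCU
    obtain ⟨ρ, hρ0, hρ1, hρI⟩ := exists_contMDiffMap_zero_one_of_isClosed (n := ⊤)
      (𝓡 (2 * n + 1)) (s := (interior D)ᶜ) (t := C) isOpen_interior.isClosed_compl hC.isClosed
      (disjoint_left.2 fun x hx hx' => hx (hCD hx'))
    have hρD : ∀ p ∉ D, ρ p = 0 := fun p hp => hρ0 fun h => hp (interior_subset h)
    have hρC : ∀ p ∈ C, ρ p = 1 := fun p hp => hρ1 hp
    have e1 : ∀ᶠ t in 𝓝 t₀, ∀ p ∈ D, h t p ∈ (ψ i).source := by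
      refine hD.eventually_forall_of_forall_eventually fun p hp => ?_
      refine (hs.continuous.continuousAt (x := (t₀, p))).eventually_mem
        ((ψ i).open_source.mem_nhds ?_)
      simpa [h0] using hDU hp
    have e2 : ∀ᶠ t in 𝓝 t₀, ∀ p ∈ D \ interior C, h t p ∉ C' := by
      refine (hD.diff isOpen_interior).eventually_forall_of_forall_eventually fun p hp => ?_
      refine (hs.continuous.continuousAt (x := (t₀, p))).eventually_mem
        (hC'.isClosed.isOpen_compl.mem_nhds ?_)
      simpa [h0] using fun h => hp.2 (hC'C h)
    obtain ⟨δ, hδ, hball⟩ := Metric.eventually_nhds_iff.1 ((e1.and e2).and hhK)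
    -- Time is truncated, so that what holds near `t₀` holds for all values of the parameter;
    -- nothing changes near `t₀`.
    obtain ⟨θ, hθ, hθδ, hθid⟩ := exists_contDiff_eq_id_near_zero hδ
    have hθ0 : θ 0 = 0 := hθid.self_of_nhds
    -- Each point follows `h` for a time scaled by `ρ`: near `t₀`, `k` is `h` on `C`, and it rests
    -- off `D`.
    set k : ℝ → M → M := fun t p => h (t₀ + ρ p * θ (t - t₀)) p with hk
    have hks : IsSmoothFamily (n := n) k := by
      refine ContMDiff.comp (g := fun q : ℝ × M => h q.1 q.2)
        (f := fun q : ℝ × M => (t₀ + ρ q.2 * θ (q.1 - t₀), q.2)) hs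
        (ContMDiff.prodMk ?_ contMDiff_snd)
      have b1 : ContMDiff (𝓘(ℝ, ℝ).prod (𝓡 (2 * n + 1))) 𝓘(ℝ, ℝ × ℝ) ∞
          (fun q : ℝ × M => (q.1, ρ q.2)) :=
        contMDiff_fst.prodMk_space (ρ.contMDiff.comp contMDiff_snd)
      have b2 : ContDiff ℝ ∞ (fun r : ℝ × ℝ => t₀ + r.2 * θ (r.1 - t₀)) :=
        contDiff_const.add (contDiff_snd.mul (hθ.comp (contDiff_fst.sub contDiff_const)))
      exact b2.contMDiff.comp b1
    have hτ : ∀ t p, dist (t₀ + ρ p * θ (t - t₀)) t₀ < δ := by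
      intro t p
      have h1 := hρI p
      rw [dist_eq_norm, add_sub_cancel_left, Real.norm_eq_abs, abs_mul, abs_of_nonneg h1.1]
      have := hθδ (t - t₀)
      nlinarith [abs_nonneg (θ (t - t₀)), h1.1, h1.2]
    have hkD : ∀ t, ∀ p ∈ D, k t p ∈ (ψ i).source := fun t p hp => (hball (hτ t p)).1.1 p hp
    have hkD' : ∀ t, ∀ p ∉ D, k t p = p := fun t p hp => by simp [hk, hρD p hp, h0]
    set W : ℝ → Eucl n → Eucl n := fun t y =>
      if y ∈ (ψ i).target then ψ i (k t ((ψ i).symm y)) - y else 0 with hW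
    obtain ⟨hWs, hWz⟩ := ContMDiffOn.contDiff_chart_sub (hψ i).chart (hψ i).chart_symm hks hD hDU
      hkD hkD' (w := W) (fun t y hy => by simp [hW, hy]) (fun t y hy => by simp [hW, hy])
    have hW0 : ∀ y, W t₀ y = 0 := by
      intro y
      by_cases hy : y ∈ (ψ i).target
      · simp [hW, hk, hy, hθ0, h0]
      · simp [hW, hy]
    have hQ : IsCompact (ψ i '' D) := hD.image_of_continuousOn ((ψ i).continuousOn.mono hDU)
    have hQψ : ψ i '' D ⊆ (ψ i).target := by
      rintro _ ⟨p, hp, rfl⟩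
      exact (ψ i).map_source (hDU hp)
    have e3 := eventually_lipschitzWith hWs hQ hWz (t₀ := t₀)
      (by simpa [funext hW0] using LipschitzWith.const' 0)
    obtain ⟨δ', hδ', hball'⟩ := Metric.eventually_nhds_iff.1 e3
    -- A second truncation of time makes all the displacements `1/2`-Lipschitz.
    obtain ⟨θ', hθ', hθδ', hθid'⟩ := exists_contDiff_eq_id_near_zero hδ'
    have hθ0' : θ' 0 = 0 := hθid'.self_of_nhds
    set w : ℝ → Eucl n → Eucl n := fun t => W (t₀ + θ' (t - t₀)) with hw
    have hws : ContDiff ℝ ∞ (fun q : ℝ × Eucl n => w q.1 q.2) :=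
      hWs.comp (f := fun q : ℝ × Eucl n => (t₀ + θ' (q.1 - t₀), q.2))
        ((contDiff_const.add (hθ'.comp (contDiff_fst.sub contDiff_const))).prodMk contDiff_snd)
    have hwP : IsChartPerturbation (ψ i) w :=
      (hψ i).isChartPerturbation hQ hQψ hws (fun t => hball' (by simpa using hθδ' (t - t₀)))
        (fun t => hWz _)
    obtain ⟨G, hG, hGs, hGi⟩ := hwP.exists_diffeos
    have hsub : Filter.Tendsto (fun t => t - t₀) (𝓝 t₀) (𝓝 0) := by
      have : Continuous fun t : ℝ => t - t₀ := by fun_prop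
      simpa using this.tendsto t₀
    have hGk : ∀ᶠ t in 𝓝 t₀, ∀ p, G t p = h (t₀ + ρ p * (t - t₀)) p := by
      filter_upwards [hsub.eventually hθid, hsub.eventually hθid'] with t ht ht' p
      have hkt : k t p = h (t₀ + ρ p * (t - t₀)) p := by simp [hk, ht]
      rw [← hkt, hG]
      by_cases hp : p ∈ (ψ i).source
      · have h1 : w t (ψ i p) = ψ i (k t p) - ψ i p := by
          simp [hw, hW, ht', (ψ i).map_source hp, (ψ i).left_inv hp]
        have h2 : k t p ∈ (ψ i).source := by
          by_cases hpD : p ∈ D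
          · exact hkD t p hpD
          · rwa [hkD' t p hpD]
        rw [perturb_of_mem _ hp, h1, add_sub_cancel, (ψ i).left_inv h2]
      · rw [perturb_of_notMem _ hp, hkD' t p fun h => hp (hDU h)]
    have hG0 : ∀ p, G t₀ p = p := fun p => by
      rw [hG]
      exact perturb_of_eq_zero (by simp [hw, hθ0', hW0])
    have eG := (hψ i).eventually_nullIsotopic hn hQ hQψ hws (fun t => hWz _) (t₀ := t₀)
      (fun y => by simp [hw, hθ0', hW0])
    have eh := ih (fun t => (G t).symm.trans (h t)) (K \ interior C') (hs.comp hGi)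
      (hK.diff isOpen_interior) ?_ ?_ ?_
    · filter_upwards [eG, eh] with t h1 h2
      have h3 := h1 (Diffeomorph.refl _ _ _) (G t) (fun p => rfl) (hG t)
      have h4 := h2.comp_right (G t)
      have h5 : (G t).trans (Diffeomorph.refl _ _ _) = G t := by
        ext x
        rfl
      have h6 : (G t).trans ((G t).symm.trans (h t)) = h t := by
        ext x
        simp
      rw [h5, h6] at h4
      exact h3.trans h4
    · rintro x ⟨hx, hx'⟩
      by_contra hxs
      exact hx' (hLC' ⟨hx, hxs⟩)
    · filter_upwards [hGk, Metric.ball_mem_nhds t₀ hδ] with t ht htδ x hx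
      obtain ⟨q, rfl⟩ := (G t).surjective x
      change G t q ∉ K \ interior C' at hx
      change h t ((G t).symm (G t q)) = G t q
      rw [(G t).symm_apply_apply, ht]
      have hd : dist (t₀ + ρ q * (t - t₀)) t₀ < δ := by
        have h1 := hρI q
        rw [dist_eq_norm, add_sub_cancel_left, Real.norm_eq_abs, abs_mul, abs_of_nonneg h1.1]
        rw [Metric.mem_ball, dist_eq_norm, Real.norm_eq_abs] at htδ
        nlinarith [abs_nonneg (t - t₀), h1.1, h1.2]
      -- On `C` the time is not slowed down. Suppose `q ∉ C`. If `G t q` is in `K`, it is in the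
      -- interior of `C'`, which is reached neither from `D \ interior C` nor by a fixed point off
      -- `D`. If `G t q` is not in `K`, it is fixed by `h` at the slowed time, so injectivity shows
      -- that `q` itself is fixed.
      by_cases hqC : q ∈ C
      · rw [hρC q hqC, one_mul, add_sub_cancel]
      · rw [ht] at hx
        by_cases hxK : h (t₀ + ρ q * (t - t₀)) q ∈ K
        · have hxC' : h (t₀ + ρ q * (t - t₀)) q ∈ interior C' := by
            by_contra hcon
            exact hx ⟨hxK, hcon⟩
          by_cases hqD : q ∈ D
          · exact absurd (interior_subset hxC')
              ((hball hd).1.2 q ⟨hqD, fun h => hqC (interior_subset h)⟩)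
          · rw [hρD q hqD, zero_mul, add_zero, h0] at hxC'
            exact absurd (interior_subset (hC'C (interior_subset hxC'))) hqC
        · have h1 := (hball hd).2 _ hxK
          have h2 : h (t₀ + ρ q * (t - t₀)) q = q := (h _).injective h1
          rw [h2]
          rw [h2] at hxK
          exact (hball htδ).2 q hxK
    · intro x
      change h t₀ ((G t₀).symm x) = x
      rw [h0, ← hG0 ((G t₀).symm x), (G t₀).apply_symm_apply]

end Fragmentation

/-! ### The compactly supported null path -/

section NullPath

set_option linter.unusedSectionVars false

variable {n : ℕ} {M : Type*} [TopologicalSpace M] [T2Space M] [SigmaCompactSpace M]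
  [ChartedSpace (Eucl n) M] [IsManifold (𝓡 (2 * n + 1)) ∞ M]
  {α : OneForm n M}

/-- Applying the fragmentation to `F t ∘ (F t₀)⁻¹` shows that the null isotopy class of `F t` is
locally constant in `t`, hence constant on the connected line. -/
theorem nullIsotopic_of_family (hn : 1 ≤ n) {ι : Type*} [Fintype ι]
    {ψ : ι → OpenPartialHomeomorph M (Eucl n)} (hψ : ∀ i, IsDarbouxMap α (ψ i))
    (hcov : ⋃ i, (ψ i).source = univ) {F : ℝ → Diffeos n M}
    (hF : IsSmoothFamily (n := n) (fun t => ⇑(F t))) {K : Set M} (hK : IsCompact K)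
    (hFK : ∀ t, ∀ x ∉ K, F t x = x) (a b : ℝ) : NullIsotopic α (F a) (F b) := by
  have : Std.Symm (fun a b => NullIsotopic α (F a) (F b)) := ⟨fun _ _ h => h.symm⟩
  refine PreconnectedSpace.induction₂ (fun a b => NullIsotopic α (F a) (F b)) (fun t₀ => ?_)
    ⟨fun _ _ _ h h' => h.trans h'⟩ a b
  have hfix : ∀ x ∉ K, (F t₀).symm x = x := fun x hx => by
    conv_lhs => rw [← hFK t₀ x hx]
    exact (F t₀).symm_apply_apply x
  have := eventually_nullIsotopic_refl hn hψ t₀ Finset.univ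
    (fun t => (F t₀).symm.trans (F t)) K
    (hF.comp (isSmoothFamily_const (F t₀).symm.contMDiff)) hK
    (by simp [hcov])
    (Filter.Eventually.of_forall fun t x hx => by
      change F t ((F t₀).symm x) = x
      rw [hfix x hx, hFK t x hx])
    (fun x => (F t₀).apply_symm_apply x)
  filter_upwards [this] with t ht
  have h1 := ht.comp_right (F t₀)
  have h2 : (F t₀).trans (Diffeomorph.refl _ _ _) = F t₀ := by
    ext x
    rfl
  have h3 : (F t₀).trans ((F t₀).symm.trans (F t)) = F t := by
    ext x
    simp
  rwa [h2, h3] at h1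

/-- Links the one-sided derivatives on `[0,1]` of the statement with derivatives on all of `ℝ`: the
interval has unique derivatives, also at its ends. -/
theorem generatedField_eq_velocity {G : ℝ → Diffeos n M}
    (hG : IsSmoothFamily (n := n) (fun t => ⇑(G t))) {t : ℝ} (ht : t ∈ Icc (0 : ℝ) 1) (p : M) :
    (generatedField n G t p : Eucl n) =
      velocity (n := n) (fun s => ⇑(G s)) t ((G t).symm p) := by
  have h1 : UniqueMDiffWithinAt 𝓘(ℝ, ℝ) (Icc (0 : ℝ) 1) t :=
    ((uniqueDiffOn_Icc zero_lt_one) t ht).uniqueMDiffWithinAt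
  exact congrArg (fun L : ℝ →L[ℝ] Eucl n => L (1 : ℝ))
    (mfderivWithin_eq_mfderiv h1 (hG.mdifferentiableAt_curve ((G t).symm p) t))

/-- A path of diffeomorphisms, reparametrised so as to be smooth for all times. -/
theorem IsSmoothPath.isSmoothFamily_smoothTransition {f : ℝ → Diffeos n M}
    (hf : IsSmoothPath n f) :
    IsSmoothFamily (n := n) (fun t => ⇑(f (Real.smoothTransition t))) := by
  have h1 : ContMDiff (𝓘(ℝ, ℝ).prod (𝓡 (2 * n + 1))) (𝓘(ℝ, ℝ).prod (𝓡 (2 * n + 1))) ∞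
      (fun q : ℝ × M => (Real.smoothTransition q.1, q.2)) :=
    (Real.smoothTransition.contDiff.contMDiff.comp contMDiff_fst).prodMk contMDiff_snd
  exact hf.comp_contMDiff h1 fun q =>
    ⟨⟨Real.smoothTransition.nonneg _, Real.smoothTransition.le_one _⟩, mem_univ _⟩

theorem HasFiniteDarbouxCover.exists_darbouxMaps (h : HasFiniteDarbouxCover n α) :
    ∃ (m : ℕ) (ψ : Fin m → OpenPartialHomeomorph M (Eucl n)), (∀ i, IsDarbouxMap α (ψ i)) ∧
      ⋃ i, (ψ i).source = univ := by
  obtain ⟨m, U, hU, hcov⟩ := h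
  choose ψ hs h1 h2 h3 using hU
  refine ⟨m, ψ, fun i => ⟨h1 i, h2 i, fun x hx v => h3 i x (hs i ▸ hx) v⟩, ?_⟩
  rw [← hcov]
  exact iUnion_congr hs

theorem exists_null_path (hn : 1 ≤ n) (hcover : HasFiniteDarbouxCover n α)
    {f : ℝ → Diffeos n M} (hf : IsSmoothPath n f) (hfc : IsCompactlySupportedPath n f) :
    ∃ g : ℝ → Diffeos n M, IsSmoothPath n g ∧ IsCompactlySupportedPath n g ∧
        IsNullPath n α g ∧ g 0 = f 0 ∧ g 1 = f 1 := by
  obtain ⟨m, ψ, hψ, hcov⟩ := hcover.exists_darbouxMaps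
  obtain ⟨K, hK, hfK⟩ := hfc
  obtain ⟨G, hG, hG0, hG1, hGn, K', hK', hGK'⟩ := nullIsotopic_of_family hn hψ hcov
    hf.isSmoothFamily_smoothTransition hK (fun t => hfK _ ⟨Real.smoothTransition.nonneg _,
      Real.smoothTransition.le_one _⟩) 0 1
  have h0 : Real.smoothTransition 0 = 0 := Real.smoothTransition.zero
  have h1 : Real.smoothTransition 1 = 1 := Real.smoothTransition.one
  refine ⟨G, ContMDiff.contMDiffOn hG, ⟨K ∪ K', hK.union hK', fun t _ x hx => ?_⟩,
    fun t ht p => ?_, ?_, ?_⟩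
  · rw [hGK' t x fun h => hx (Or.inr h), h0,
      hfK 0 (by simp) x fun h => hx (Or.inl h)]
  · have := hGn t ((G t).symm p)
    refine (congrArg (α p) (generatedField_eq_velocity hG ht p)).trans ?_
    exact (α.apply_congr ((G t).apply_symm_apply p).symm _).trans this
  · rw [hG0 0 (by norm_num), h0]
  · rw [hG1 1 (by norm_num), h1]

end NullPath

/-! ### Smooth dependence of a form evaluated on velocities -/

section FormVelocity

variable {n : ℕ} {M : Type*} [TopologicalSpace M] [ChartedSpace (Eucl n) M]
  [IsManifold (𝓡 (2 * n + 1)) ∞ M] {α : OneForm n M}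
  {EN : Type*} [NormedAddCommGroup EN] [NormedSpace ℝ EN] {HN : Type*} [TopologicalSpace HN]
  {J : ModelWithCorners ℝ EN HN} {N : Type*} [TopologicalSpace N] [ChartedSpace HN N]
  [IsManifold J ∞ N]

/-- A smooth `1`-form, evaluated on the velocities of a smooth family of curves, is smooth in all
parameters. -/
theorem OneForm.IsSmooth.contMDiffAt_velocity (hα : α.IsSmooth n) {Γ : ℝ × N → M} {q₀ : ℝ × N}
    (hΓ : ContMDiffAt (𝓘(ℝ, ℝ).prod J) (𝓡 (2 * n + 1)) ∞ Γ q₀) :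
    ContMDiffAt (𝓘(ℝ, ℝ).prod J) 𝓘(ℝ, ℝ) ∞ (fun q : ℝ × N =>
      (α (Γ q) (mfderiv 𝓘(ℝ, ℝ) (𝓡 (2 * n + 1)) (fun s => Γ (s, q.2)) q.1 (1 : ℝ)) : ℝ)) q₀ := by
  -- The variable of the curve is made independent of the time in `q`, so that the derivative in it
  -- depends smoothly on `q`; it is then taken at `q.1`.
  have hf : ContMDiffAt ((𝓘(ℝ, ℝ).prod J).prod 𝓘(ℝ, ℝ)) (𝓡 (2 * n + 1)) ∞
      (Function.uncurry (fun (q : ℝ × N) (s : ℝ) => Γ (s, q.2))) (q₀, q₀.1) := by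
    refine ContMDiffAt.comp (q₀, q₀.1) (g := Γ)
      (f := fun r : (ℝ × N) × ℝ => (r.2, r.1.2)) hΓ ?_
    exact contMDiffAt_snd.prodMk (contMDiffAt_snd.comp _ contMDiffAt_fst)
  have h1 := ContMDiffAt.mfderiv (x₀ := q₀) (m := ∞) (fun (q : ℝ × N) (s : ℝ) => Γ (s, q.2))
    Prod.fst hf contMDiffAt_fst (by simp)
  have h2 : ContMDiffAt (𝓘(ℝ, ℝ).prod J) 𝓘(ℝ, ℝ).tangent ∞
      (fun q : ℝ × N => (⟨q.1, (1 : ℝ)⟩ : TangentBundle 𝓘(ℝ, ℝ) ℝ)) q₀ := by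
    have h3 : ContMDiffAt 𝓘(ℝ, ℝ) 𝓘(ℝ, ℝ).tangent ∞
        (fun t : ℝ => (⟨t, (1 : ℝ)⟩ : TangentBundle 𝓘(ℝ, ℝ) ℝ)) q₀.1 :=
      contMDiffAt_vectorSpace_iff_contDiffAt.2 contDiffAt_const
    exact ContMDiffAt.comp (x := q₀) (f := Prod.fst) h3 contMDiffAt_fst
  have h3 := ContMDiffAt.clm_apply_of_inCoordinates
    (b₁ := fun q : ℝ × N => q.1) (b₂ := fun q : ℝ × N => Γ q)
    (ϕ := fun q : ℝ × N => mfderiv 𝓘(ℝ, ℝ) (𝓡 (2 * n + 1)) (fun s => Γ (s, q.2)) q.1)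
    h1 h2 hΓ
  have h4 : ContMDiffAt (𝓘(ℝ, ℝ).prod J)
      ((𝓡 (2 * n + 1)).prod 𝓘(ℝ, Eucl n →L[ℝ] ℝ)) ∞
      (fun q : ℝ × N => TotalSpace.mk' (Eucl n →L[ℝ] ℝ)
        (E := fun x : M => TangentSpace (𝓡 (2 * n + 1)) x →L[ℝ] Trivial M ℝ x) (Γ q) (α (Γ q)))
      q₀ := ContMDiffAt.comp (x := q₀) (f := Γ) (hα (Γ q₀)) hΓ
  have h5 := ContMDiffAt.clm_bundle_apply h4 h3
  rw [contMDiffAt_totalSpace] at h5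
  exact h5.2

end FormVelocity

/-! ### From a positive loop to a positive path -/

section PositivePath

set_option linter.unusedSectionVars false

variable {n : ℕ} {M : Type*} [TopologicalSpace M] [T2Space M] [SigmaCompactSpace M]
  [ChartedSpace (Eucl n) M] [IsManifold (𝓡 (2 * n + 1)) ∞ M]
  {α : OneForm n M}

/-- A smooth `1`-periodic loop of diffeomorphisms, based at the identity, whose velocity is
positively transverse to `ker α`. -/
structure IsPositiveLoop (α : OneForm n M) (φ : ℝ → Diffeos n M) : Prop where
  smooth : IsSmoothFamily (n := n) (fun t => ⇑(φ t))
  periodic : ∀ t, φ (t + 1) = φ t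
  zero : ∀ x, φ 0 x = x
  pos : ∀ t p, (0 : ℝ) < α (φ t p) (velocity (n := n) (fun s => ⇑(φ s)) t p)

theorem IsPositiveLoop.form_periodic {φ : ℝ → Diffeos n M} (h : IsPositiveLoop α φ) (t : ℝ)
    (p : M) : (α (φ (t + 1) p) (velocity (n := n) (fun s => ⇑(φ s)) (t + 1) p) : ℝ) =
      α (φ t p) (velocity (n := n) (fun s => ⇑(φ s)) t p) := by
  have h1 := h.smooth.velocity_reparam (θ := fun s => s + 1) (contDiff_id.add contDiff_const) t p
  have h3 : (velocity (n := n) (fun s => ⇑(φ (s + 1))) t p : Eucl n) =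
      velocity (n := n) (fun s => ⇑(φ s)) t p :=
    velocity_congr (Filter.Eventually.of_forall fun s =>
      congrArg (fun D : Diffeos n M => D p) (h.periodic s))
  have h4 : deriv (fun s : ℝ => s + 1) t = 1 := by simp
  rw [h4] at h1
  have h5 : (velocity (n := n) (fun s => ⇑(φ s)) (t + 1) p : Eucl n) =
      velocity (n := n) (fun s => ⇑(φ s)) t p :=
    ((one_smul ℝ _).symm.trans h1.symm).trans h3
  exact (congrArg (α (φ (t + 1) p)) h5).trans
    (α.apply_congr (congrArg (fun D : Diffeos n M => D p) (h.periodic t)) _)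

/-- The value of `α` on the velocity is `B + N P`, with `P > 0` from the loop run `N` times and `B`
from `F`. Over the compact set `K` of moving points `P` has a positive minimum and `B` is bounded,
independently of `N` by periodicity; off `K` the term `B` is zero. -/
theorem IsPositiveLoop.exists_positive (hα : α.IsSmooth n) {φ : ℝ → Diffeos n M}
    (h : IsPositiveLoop α φ) {F : ℝ → Diffeos n M}
    (hF : IsSmoothFamily (n := n) (fun t => ⇑(F t))) {K : Set M} (hK : IsCompact K)
    (hFK : ∀ t, ∀ x ∉ K, F t x = x) :
    ∃ N : ℕ, ∀ t ∈ Icc (0 : ℝ) 1, ∀ p, (0 : ℝ) < α (φ (N * t) (F t p))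
      (velocity (n := n) (fun s x => φ (N * s) (F s x)) t p) := by
  set P : ℝ × M → ℝ := fun q => α (φ q.1 q.2) (velocity (n := n) (fun s => ⇑(φ s)) q.1 q.2) with hP
  have hPc : Continuous P := by
    rw [continuous_iff_continuousAt]
    intro q
    exact (hα.contMDiffAt_velocity (J := 𝓡 (2 * n + 1)) (Γ := fun q : ℝ × M => φ q.1 q.2)
      h.smooth.contMDiffAt).continuousAt
  have hPper : ∀ q, Function.Periodic (fun s => P (s, q)) 1 := fun q s => h.form_periodic s q
  -- The contribution of `F`, with the time of the loop frozen as a separate variable.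
  set B : ℝ × ℝ × M → ℝ := fun q => α (φ q.2.1 (F q.1 q.2.2))
    (mfderiv 𝓘(ℝ, ℝ) (𝓡 (2 * n + 1)) (fun s => φ q.2.1 (F s q.2.2)) q.1 (1 : ℝ)) with hB
  have hBc : Continuous B := by
    rw [continuous_iff_continuousAt]
    intro q
    refine (hα.contMDiffAt_velocity (J := 𝓘(ℝ, ℝ).prod (𝓡 (2 * n + 1)))
      (Γ := fun q : ℝ × ℝ × M => φ q.2.1 (F q.1 q.2.2)) ?_).continuousAt
    refine ContMDiffAt.comp q (g := fun r : ℝ × M => φ r.1 r.2)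
      (f := fun q : ℝ × ℝ × M => (q.2.1, F q.1 q.2.2)) h.smooth.contMDiffAt ?_
    refine (contMDiffAt_fst.comp _ contMDiffAt_snd).prodMk ?_
    exact ContMDiffAt.comp q (g := fun r : ℝ × M => F r.1 r.2)
      (f := fun q : ℝ × ℝ × M => (q.1, q.2.2)) hF.contMDiffAt
      (contMDiffAt_fst.prodMk (contMDiffAt_snd.comp _ contMDiffAt_snd))
  have hBper : ∀ t p, Function.Periodic (fun s => B (t, s, p)) 1 := by
    intro t p s
    exact congrArg (fun D : Diffeos n M => (α (D (F t p))
      (mfderiv 𝓘(ℝ, ℝ) (𝓡 (2 * n + 1)) (fun r => D (F r p)) t (1 : ℝ)) : ℝ)) (h.periodic s)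
  have hcomp : IsCompact (Icc (0 : ℝ) 1 ×ˢ Icc (0 : ℝ) 1 ×ˢ K) :=
    isCompact_Icc.prod (isCompact_Icc.prod hK)
  obtain ⟨b, hb⟩ := hcomp.exists_bound_of_continuousOn hBc.continuousOn
  have hPc' : Continuous fun q : ℝ × ℝ × M => P (q.2.1, F q.1 q.2.2) := by
    have : Continuous fun r : ℝ × M => F r.1 r.2 := hF.continuous
    exact hPc.comp ((continuous_fst.comp continuous_snd).prodMk
      (this.comp (continuous_fst.prodMk (continuous_snd.comp continuous_snd))))
  obtain ⟨m, hm, hPm⟩ : ∃ m > 0, ∀ q ∈ Icc (0 : ℝ) 1 ×ˢ Icc (0 : ℝ) 1 ×ˢ K,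
      m ≤ P (q.2.1, F q.1 q.2.2) :=
    hcomp.exists_forall_le' hPc'.continuousOn fun q _ => h.pos _ _
  obtain ⟨N, hN⟩ := exists_nat_gt (max (b / m) 0)
  have hN0 : (0 : ℝ) < N := (le_max_right _ _).trans_lt hN
  have hNb : b < N * m := by
    have := (le_max_left _ _).trans_lt hN
    rwa [div_lt_iff₀ hm] at this
  refine ⟨N, fun t ht p => ?_⟩
  have hθ : ContDiff ℝ ∞ (fun s : ℝ => N * s) := contDiff_const.mul contDiff_id
  have hφ := h.smooth.reparam hθ
  have e1 := hφ.velocity_comp hF t p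
  have e2 := h.smooth.velocity_reparam hθ t (F t p)
  have e3 : deriv (fun s : ℝ => N * s) t = N := by simp
  rw [e3] at e2
  have e4 : (mfderiv 𝓘(ℝ, ℝ) (𝓡 (2 * n + 1)) (fun s => φ (N * t) (F s p)) t (1 : ℝ) : Eucl n) =
      mfderiv (𝓡 (2 * n + 1)) (𝓡 (2 * n + 1)) (φ (N * t)) (F t p)
        (velocity (n := n) (fun s => ⇑(F s)) t p) := by
    have := mfderiv_comp (x := t) (g := φ (N * t)) (f := fun s => F s p)
      ((φ (N * t)).contMDiff.mdifferentiable (by simp) _) (hF.mdifferentiableAt_curve p t)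
    exact congrArg (fun L : ℝ →L[ℝ] Eucl n => L (1 : ℝ)) this
  have key : (α (φ (N * t) (F t p)) (velocity (n := n) (fun s x => φ (N * s) (F s x)) t p) : ℝ) =
      B (t, N * t, p) + N * P (N * t, F t p) := by
    refine (congrArg (α (φ (N * t) (F t p))) e1).trans ?_
    refine (map_add _ _ _).trans ?_
    refine congrArg₂ (fun x y : ℝ => x + y) ?_ ?_
    · exact (congrArg (α (φ (N * t) (F t p))) e4).symm
    · exact (congrArg (α (φ (N * t) (F t p))) e2).trans (map_smul _ _ _)
  rw [key]
  -- Periodicity brings the loop time `N t` back to `[0,1]`, where the bounds chosen before `N`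
  -- apply.
  obtain ⟨s, hs, hsP, hsB⟩ : ∃ s ∈ Icc (0 : ℝ) 1, P (N * t, F t p) = P (s, F t p) ∧
      B (t, N * t, p) = B (t, s, p) := by
    refine ⟨Int.fract (N * t : ℝ), ⟨Int.fract_nonneg _, (Int.fract_lt_one _).le⟩, ?_, ?_⟩
    · have := (hPper (F t p)).sub_int_mul_eq (x := N * t) ⌊(N * t : ℝ)⌋
      rw [mul_one] at this
      exact this.symm
    · have := (hBper t p).sub_int_mul_eq (x := N * t) ⌊(N * t : ℝ)⌋
      rw [mul_one] at this
      exact this.symm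
  rw [hsP, hsB]
  by_cases hp : p ∈ K
  · have h1 := hb (t, s, p) ⟨ht, hs, hp⟩
    have h2 := hPm (t, s, p) ⟨ht, hs, hp⟩
    rw [Real.norm_eq_abs] at h1
    have h3 := (abs_le.1 h1).1
    simp only at h2
    nlinarith
  · have h1 : B (t, s, p) = 0 := by
      have h2 : (mfderiv 𝓘(ℝ, ℝ) (𝓡 (2 * n + 1)) (fun r => φ s (F r p)) t (1 : ℝ) : Eucl n) = 0 := by
        have : (fun r => φ s (F r p)) = fun _ => φ s p := by
          funext r
          rw [hFK r p hp]
        rw [this, mfderiv_const]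
        rfl
      exact (congrArg (α (φ s (F t p))) h2).trans (map_zero _)
    rw [h1, zero_add]
    exact mul_pos hN0 (h.pos _ _)

theorem exists_positive_path (hα : α.IsSmooth n) {φ : ℝ → Diffeos n M}
    (h : IsPositiveLoop α φ) {f : ℝ → Diffeos n M} (hf : IsSmoothPath n f)
    (hfc : IsCompactlySupportedPath n f) :
    ∃ g : ℝ → Diffeos n M, IsSmoothPath n g ∧ IsPositivePath n α g ∧ g 0 = f 0 ∧ g 1 = f 1 := by
  obtain ⟨K, hK, hfK⟩ := hfc
  have hF := hf.isSmoothFamily_smoothTransition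
  obtain ⟨N, hN⟩ := h.exists_positive hα hF hK (fun t => hfK _ ⟨Real.smoothTransition.nonneg _,
      Real.smoothTransition.le_one _⟩)
  have hθ : ContDiff ℝ ∞ (fun s : ℝ => N * s) := contDiff_const.mul contDiff_id
  set G : ℝ → Diffeos n M := fun t => (f (Real.smoothTransition t)).trans (φ (N * t)) with hG
  have hGs : IsSmoothFamily (n := n) (fun t => ⇑(G t)) := (h.smooth.reparam hθ).comp hF
  have hφN : φ (N : ℝ) = φ 0 := by
    have : Function.Periodic φ 1 := h.periodic
    simpa using this.nat_mul_eq N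
  refine ⟨G, ContMDiff.contMDiffOn hGs, fun t ht p => ?_, ?_, ?_⟩
  · have := hN t ht ((G t).symm p)
    refine this.trans_eq ?_
    refine Eq.trans ?_ (congrArg (α p) (generatedField_eq_velocity hGs ht p)).symm
    exact α.apply_congr ((G t).apply_symm_apply p) _
  · ext x
    simp [hG, h.zero, Real.smoothTransition.zero]
  · ext x
    simp [hG, hφN, h.zero, Real.smoothTransition.one]

end PositivePath

/-! ### Periodic loops transverse to the standard structure, with disjoint active times -/

section Loops

/-- Smooth `1`-periodic functions `a`, `b`, `c` based at `0`, with `c' + a b' = 1`: a loop positively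
transverse to the standard contact structure of `ℝ³`. The components `a`, `b` vanish outside the
times in `J`, and everything is bounded by `B`. -/
structure IsTransverseLoop (a b c : ℝ → ℝ) (J : Set ℝ) (B : ℝ) : Prop where
  contDiff_a : ContDiff ℝ ∞ a
  contDiff_b : ContDiff ℝ ∞ b
  contDiff_c : ContDiff ℝ ∞ c
  periodic_a : Function.Periodic a 1
  periodic_b : Function.Periodic b 1
  periodic_c : Function.Periodic c 1
  zero_a : a 0 = 0
  zero_b : b 0 = 0
  zero_c : c 0 = 0
  transverse : ∀ t, deriv c t + a t * deriv b t = 1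
  off_J : ∀ t ∉ J, a t = 0 ∧ b t = 0 ∧ deriv a t = 0 ∧ deriv b t = 0
  bound : ∀ t, |a t| ≤ B ∧ |b t| ≤ B ∧ |c t| ≤ B ∧ |deriv a t| ≤ B ∧ |deriv b t| ≤ B ∧
    |deriv c t| ≤ B

theorem Function.Periodic.deriv_periodic {f : ℝ → ℝ} (hf : Function.Periodic f 1) :
    Function.Periodic (deriv f) 1 := by
  intro t
  have : (fun s => f (s + 1)) = f := funext hf
  conv_rhs => rw [← this]
  rw [deriv_comp_add_const]

theorem exists_bound_of_periodic {f : ℝ → ℝ} (hf : Function.Periodic f 1) (hc : Continuous f) :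
    ∃ B, ∀ t, |f t| ≤ B := by
  obtain ⟨B, hB⟩ := isCompact_Icc.exists_bound_of_continuousOn (s := Icc (0 : ℝ) 1) hc.continuousOn
  refine ⟨B, fun t => ?_⟩
  obtain ⟨y, hy, hy'⟩ := hf.exists_mem_Ico₀ one_pos t
  rw [hy']
  exact hB y ⟨hy.1, hy.2.le⟩

/-- With `b = η` and `a = C η'`, the equation forces `c' = 1 - C (η')²`. The constant `C` is the
inverse of the integral of `(η')²` over a period, which makes `c` periodic. -/
theorem exists_transverseLoop {η : ℝ → ℝ} (hη : ContDiff ℝ ∞ η) (hper : Function.Periodic η 1)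
    (hη0 : η =ᶠ[𝓝 0] 0) {t₁ : ℝ} (ht₁ : t₁ ∈ Ioc (0 : ℝ) 1) (hη1 : η t₁ ≠ 0) {J : Set ℝ}
    (hJ : ∀ t ∉ J, η =ᶠ[𝓝 t] 0) :
    ∃ a b c : ℝ → ℝ, ∃ B, IsTransverseLoop a b c J B := by
  have hη' : ContDiff ℝ ∞ (deriv η) := (contDiff_infty_iff_deriv.1 hη).2
  have hsq : ContDiff ℝ ∞ (fun t => deriv η t ^ 2) := hη'.pow 2
  have hI : 0 < ∫ t in (0 : ℝ)..1, deriv η t ^ 2 := by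
    -- As `η` is `0` at `0` but not at `t₁`, its derivative is nonzero somewhere, so the integral is
    -- positive.
    obtain ⟨t₂, ht₂, h2⟩ := exists_deriv_eq_slope η ht₁.1 hη.continuous.continuousOn
      (hη.differentiable (by simp)).differentiableOn
    refine intervalIntegral.integral_pos one_pos hsq.continuous.continuousOn
      (fun x _ => sq_nonneg _) ⟨t₂, ⟨ht₂.1.le, ht₂.2.le.trans ht₁.2⟩, ?_⟩
    rw [h2, hη0.self_of_nhds, Pi.zero_apply, sub_zero, sub_zero]
    have := ht₁.1
    positivity
  set C : ℝ := (∫ t in (0 : ℝ)..1, deriv η t ^ 2)⁻¹ with hC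
  have hperd := hper.deriv_periodic
  set c : ℝ → ℝ := fun t => t - C * ∫ s in (0 : ℝ)..t, deriv η s ^ 2 with hc
  have hcd : ∀ t, HasDerivAt c (1 - C * deriv η t ^ 2) t := by
    intro t
    refine (hasDerivAt_id t).sub (HasDerivAt.const_mul C ?_)
    exact intervalIntegral.integral_hasDerivAt_right (hsq.continuous.intervalIntegrable _ _)
      (hsq.continuous.stronglyMeasurableAtFilter _ _) hsq.continuous.continuousAt
  have hcd' : deriv c = fun t => 1 - C * deriv η t ^ 2 := funext fun t => (hcd t).deriv
  have hcs : ContDiff ℝ ∞ c := by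
    rw [contDiff_infty_iff_deriv, hcd']
    exact ⟨fun t => (hcd t).differentiableAt, contDiff_const.sub (contDiff_const.mul hsq)⟩
  have hcper : Function.Periodic c 1 := by
    intro t
    have h1 : (∫ s in (0 : ℝ)..(t + 1), deriv η s ^ 2) =
        (∫ s in (0 : ℝ)..t, deriv η s ^ 2) + ∫ s in (0 : ℝ)..1, deriv η s ^ 2 := by
      rw [← intervalIntegral.integral_add_adjacent_intervals
        (hsq.continuous.intervalIntegrable 0 t) (hsq.continuous.intervalIntegrable t (t + 1))]
      congr 1
      have h2 : Function.Periodic (fun s => deriv η s ^ 2) 1 := fun s => by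
        simp only [hperd s]
      have := h2.intervalIntegral_add_eq t 0
      simpa using this
    have h3 : C * (∫ s in (0 : ℝ)..1, deriv η s ^ 2) = 1 := inv_mul_cancel₀ hI.ne'
    simp only [hc]
    rw [h1, mul_add, h3]
    ring
  have hzero : ∀ t, η =ᶠ[𝓝 t] 0 → deriv η =ᶠ[𝓝 t] 0 := fun t ht => by
    have := ht.deriv
    have h0 : deriv (0 : ℝ → ℝ) = 0 := by
      funext x
      exact deriv_const x (0 : ℝ)
    rwa [h0] at this
  have hap : Function.Periodic (fun t => C * deriv η t) 1 := fun t => by simp only [hperd t]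
  have has : ContDiff ℝ ∞ (fun t => C * deriv η t) := contDiff_const.mul hη'
  have hdc : ∀ {f : ℝ → ℝ}, ContDiff ℝ ∞ f → Continuous (deriv f) := fun hf =>
    (contDiff_infty_iff_deriv.1 hf).2.continuous
  obtain ⟨B1, hB1⟩ := exists_bound_of_periodic hap has.continuous
  obtain ⟨B2, hB2⟩ := exists_bound_of_periodic hper hη.continuous
  obtain ⟨B3, hB3⟩ := exists_bound_of_periodic hcper hcs.continuous
  obtain ⟨B4, hB4⟩ := exists_bound_of_periodic hap.deriv_periodic (hdc has)
  obtain ⟨B5, hB5⟩ := exists_bound_of_periodic hperd (hdc hη)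
  obtain ⟨B6, hB6⟩ := exists_bound_of_periodic hcper.deriv_periodic (hdc hcs)
  have hn : ∀ {B : ℝ} {f : ℝ → ℝ}, (∀ t, |f t| ≤ B) → 0 ≤ B := fun h =>
    (abs_nonneg _).trans (h 0)
  have p1 := hn hB1
  have p2 := hn hB2
  have p3 := hn hB3
  have p4 := hn hB4
  have p5 := hn hB5
  have p6 := hn hB6
  refine ⟨fun t => C * deriv η t, η, c, B1 + B2 + B3 + B4 + B5 + B6, has, hη, hcs, hap, hper, hcper,
    ?_, hη0.self_of_nhds, by simp [hc], fun t => ?_, fun t ht => ?_, fun t => ?_⟩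
  · simp [(hzero 0 hη0).self_of_nhds]
  · rw [hcd']
    ring
  · have h1 := hzero t (hJ t ht)
    have h2 : (fun t => C * deriv η t) =ᶠ[𝓝 t] fun _ => 0 := by
      filter_upwards [h1] with s hs
      simp [hs]
    refine ⟨h2.self_of_nhds, (hJ t ht).self_of_nhds, ?_, h1.self_of_nhds⟩
    rw [h2.deriv_eq]
    exact deriv_const _ _
  · exact ⟨by linarith [hB1 t], by linarith [hB2 t], by linarith [hB3 t], by linarith [hB4 t],
      by linarith [hB5 t], by linarith [hB6 t]⟩

/-- Finitely many transverse loops whose active times are pairwise disjoint. -/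
theorem exists_transverseLoops (m : ℕ) :
    ∃ (a b c : Fin m → ℝ → ℝ) (J : Fin m → Set ℝ) (B : ℝ), 1 ≤ B ∧
      (∀ k, IsTransverseLoop (a k) (b k) (c k) (J k) B) ∧
      ∀ t k l, t ∈ J k → t ∈ J l → k = l := by
  let β : ContDiffBump (0 : ℝ) := ⟨1 / 8, 1 / 4, by norm_num, by norm_num⟩
  -- Composing with the cosine gives periodicity for free. The values `m cos (2πt)` within `1/2` of
  -- distinct integers `k` occur at disjoint times, and none of the `k < m` is approached at `t =
  -- 0`, where the value is `m`.
  let u : Fin m → ℝ → ℝ := fun k t => m * Real.cos (2 * Real.pi * t) - k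
  let J : Fin m → Set ℝ := fun k => {t | |u k t| < 1 / 2}
  have hu : ∀ k, ContDiff ℝ ∞ (u k) := fun k =>
    (contDiff_const.mul (Real.contDiff_cos.comp (contDiff_const.mul contDiff_id))).sub
      contDiff_const
  have hnear : ∀ k t, 1 / 2 ≤ |u k t| → (fun t => β (u k t)) =ᶠ[𝓝 t] 0 := by
    intro k t ht
    have : ∀ᶠ s in 𝓝 t, 1 / 4 < |u k s| :=
      ((hu k).continuous.abs.tendsto t).eventually_const_lt (by linarith)
    filter_upwards [this] with s hs
    refine β.zero_of_le_dist ?_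
    rw [Real.dist_eq, sub_zero]
    exact hs.le
  have key : ∀ k, ∃ a b c : ℝ → ℝ, ∃ B, IsTransverseLoop a b c (J k) B := by
    intro k
    have hkm : (k : ℝ) + 1 ≤ m := by exact_mod_cast k.2
    have hm : (0 : ℝ) < m := by
      have : (0 : ℝ) ≤ k := Nat.cast_nonneg _
      linarith
    refine exists_transverseLoop (η := fun t => β (u k t)) (β.contDiff.comp (hu k)) ?_ ?_
      (t₁ := Real.arccos (k / m) / (2 * Real.pi)) ⟨?_, ?_⟩ ?_ ?_
    · intro t
      have : Real.cos (2 * Real.pi * (t + 1)) = Real.cos (2 * Real.pi * t) := by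
        rw [mul_add, mul_one, Real.cos_add_two_pi]
      simp only [u, this]
    · refine hnear k 0 ?_
      simp only [u, mul_zero, Real.cos_zero, mul_one]
      rw [abs_of_nonneg] <;> linarith
    · have : 0 < Real.arccos (k / m) := by
        rw [Real.arccos_pos, div_lt_one hm]
        linarith
      positivity
    · rw [div_le_one (by positivity)]
      have := Real.arccos_le_pi ((k : ℝ) / m)
      linarith [Real.pi_pos]
    · have h1 : 2 * Real.pi * (Real.arccos ((k : ℝ) / m) / (2 * Real.pi)) =
          Real.arccos ((k : ℝ) / m) := by
        field_simp
      have h2 : u k (Real.arccos ((k : ℝ) / m) / (2 * Real.pi)) = 0 := by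
        have h0 : (0 : ℝ) ≤ (k : ℝ) / m := by positivity
        have h3 : (k : ℝ) / m ≤ 1 := by
          rw [div_le_one hm]
          linarith
        simp only [u]
        rw [h1, Real.cos_arccos (by linarith) h3]
        field_simp
        ring
      change β (u k _) ≠ 0
      rw [h2]
      exact (β.one_of_mem_closedBall (Metric.mem_closedBall_self β.rIn_pos.le)).trans_ne one_ne_zero
    · intro t ht
      exact hnear k t (not_lt.1 ht)
  choose a b c B hB using key
  refine ⟨a, b, c, J, 1 + ∑ k, |B k|, by simp [Finset.sum_nonneg], fun k => ?_, ?_⟩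
  · have hle : B k ≤ 1 + ∑ k, |B k| := by
      have := Finset.single_le_sum (f := fun k => |B k|) (fun i _ => abs_nonneg _)
        (Finset.mem_univ k)
      have h2 := le_abs_self (B k)
      linarith
    have h := hB k
    refine { h with bound := fun t => ?_ }
    obtain ⟨h1, h2, h3, h4, h5, h6⟩ := h.bound t
    exact ⟨h1.trans hle, h2.trans hle, h3.trans hle, h4.trans hle, h5.trans hle, h6.trans hle⟩
  · intro t k l hk hl
    have h1 : |(k : ℝ) - l| < 1 := by
      have e : (k : ℝ) - l = u l t - u k t := by
        simp only [u]
        ring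
      rw [e]
      have h2 : |u k t| < 1 / 2 := hk
      have h3 : |u l t| < 1 / 2 := hl
      calc _ ≤ |u l t| + |u k t| := abs_sub _ _
        _ < 1 := by linarith
    have h2 : |((k : ℕ) : ℤ) - ((l : ℕ) : ℤ)| < 1 := by exact_mod_cast h1
    have h3 := Int.abs_lt_one_iff.1 h2
    exact Fin.ext (by omega)

end Loops

/-! ### The loop in a chart: values of the standard form and crude bounds -/

section ChartEstimates

variable {n : ℕ}

/-- The displacement of `y` in the transverse loop of size `e` and sign `s`. It is the value of a
linear function of `(a, b, c)`. -/
def loopDisplacement (o : Fin n) (s a b c e : ℝ) (y : Eucl n) : Eucl n :=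
  (e * a) • basisVec (xIdx o) + (s * e * b) • basisVec (yIdx o) +
    (s * (e ^ 2 * c - e * y (xIdx o) * b)) • basisVec zIdx

/-- The differential in `y` of `loopDisplacement`, where `e` is a function of `y` with differential
`δ` in the direction `v`. -/
def loopDifferential (o : Fin n) (s a b c e : ℝ) (y v : Eucl n) (δ : ℝ) : Eucl n :=
  (δ * a) • basisVec (xIdx o) + (s * δ * b) • basisVec (yIdx o) +
    (s * (2 * e * δ * c - δ * y (xIdx o) * b - e * v (xIdx o) * b)) • basisVec zIdx

theorem hasFDerivAt_loopDisplacement (o : Fin n) (s a b c : ℝ) {e : Eucl n → ℝ} {y : Eucl n}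
    (he : DifferentiableAt ℝ e y) :
    ∃ L : Eucl n →L[ℝ] Eucl n, HasFDerivAt (fun y => loopDisplacement o s a b c (e y) y) L y ∧
      ∀ v, L v = loopDifferential o s a b c (e y) y v (fderiv ℝ e y v) := by
  have h := he.hasFDerivAt
  have hx : HasFDerivAt (fun y : Eucl n => y (xIdx o))
      (EuclideanSpace.proj (xIdx o) : Eucl n →L[ℝ] ℝ) y :=
    (EuclideanSpace.proj (xIdx o) : Eucl n →L[ℝ] ℝ).hasFDerivAt
  refine ⟨_, (((h.mul_const a).smul_const _).add (((h.const_mul s).mul_const b).smul_const _)).add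
    (((((h.pow 2).mul_const c).sub ((h.mul hx).mul_const b)).const_mul s).smul_const _),
    fun v => ?_⟩
  simp only [loopDifferential, add_apply, ContinuousLinearMap.smulRight_apply,
    sub_apply, smul_apply, smul_eq_mul,
    PiLp.proj_apply]
  congr 1
  · congr 2 <;> ring
  · congr 1
    simp
    left
    ring

theorem hasDerivAt_loopDisplacement (o : Fin n) (s e : ℝ) {a b c : ℝ → ℝ} (y : Eucl n) {t : ℝ}
    (ha : DifferentiableAt ℝ a t) (hb : DifferentiableAt ℝ b t) (hc : DifferentiableAt ℝ c t) :
    HasDerivAt (fun t => loopDisplacement o s (a t) (b t) (c t) e y)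
      (loopDisplacement o s (deriv a t) (deriv b t) (deriv c t) e y) t :=
  (((ha.hasDerivAt.const_mul e).smul_const _).add ((hb.hasDerivAt.const_mul (s * e)).smul_const
    _)).add ((((hc.hasDerivAt.const_mul (e ^ 2)).sub
      (hb.hasDerivAt.const_mul (e * y (xIdx o)))).const_mul s).smul_const _)

theorem stdContactForm_add_left (o : Fin n) (p : Eucl n) (q r u : ℝ) (v : Eucl n) :
    stdContactForm n (p + (q • basisVec (xIdx o) + r • basisVec (yIdx o) + u • basisVec zIdx)) v =
      stdContactForm n p v + q * v (yIdx o) := by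
  simp [stdContactForm_apply, add_mul, Finset.sum_add_distrib, add_assoc]

theorem stdContactForm_basis (o : Fin n) (p : Eucl n) (q r u : ℝ) :
    stdContactForm n p (q • basisVec (xIdx o) + r • basisVec (yIdx o) + u • basisVec zIdx) =
      p (xIdx o) * r + u := by
  simp [stdContactForm_apply, add_comm]

/-- The term `-e x b` in the displacement cancels the dependence on the base point, so only the
planar identity `c' + a b'` survives. The sign `s` makes the loop negatively transverse in charts
that reverse the coorientation. -/
theorem stdContactForm_loopDisplacement (o : Fin n) (s a b c a' b' c' e : ℝ) (y : Eucl n) :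
    stdContactForm n (y + loopDisplacement o s a b c e y) (loopDisplacement o s a' b' c' e y) =
      s * e ^ 2 * (c' + a * b') := by
  rw [loopDisplacement, loopDisplacement, stdContactForm_add_left, stdContactForm_basis]
  simp
  ring

/-- The distortion of the form has a factor `e`; when `a = b = 0` only the term with `δ`, the
variation of the size, remains. -/
theorem stdContactForm_loopDifferential (o : Fin n) (s a b c e δ : ℝ) (y v : Eucl n) :
    stdContactForm n (y + loopDisplacement o s a b c e y)
      (v + loopDifferential o s a b c e y v δ) =
      stdContactForm n y v +
        e * (s * (2 * c + a * b) * δ - s * b * v (xIdx o) + a * v (yIdx o)) := by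
  rw [loopDisplacement, loopDifferential, stdContactForm_add_left, map_add, stdContactForm_basis]
  simp
  ring

theorem abs_coord_le (y : Eucl n) (k : Fin (2 * n + 1)) : |y k| ≤ ‖y‖ := PiLp.norm_apply_le y k

theorem abs_stdContactForm_le (y v : Eucl n) :
    |stdContactForm n y v| ≤ (n + 1) * (1 + ‖y‖) * ‖v‖ := by
  rw [stdContactForm_apply]
  have h1 : |∑ i : Fin n, y (xIdx i) * v (yIdx i)| ≤ n * (‖y‖ * ‖v‖) := by
    refine (Finset.abs_sum_le_sum_abs _ _).trans ?_
    refine (Finset.sum_le_sum (g := fun _ => ‖y‖ * ‖v‖) fun i _ => ?_).trans (by simp)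
    rw [abs_mul]
    gcongr
    · exact abs_coord_le _ _
    · exact abs_coord_le _ _
  have h2 := abs_coord_le v zIdx
  have h3 := norm_nonneg y
  have h4 := norm_nonneg v
  have h5 : (0 : ℝ) ≤ n := Nat.cast_nonneg _
  calc _ ≤ |v zIdx| + |∑ i : Fin n, y (xIdx i) * v (yIdx i)| := abs_add_le _ _
    _ ≤ ‖v‖ + n * (‖y‖ * ‖v‖) := add_le_add h2 h1
    _ ≤ _ := by nlinarith [mul_nonneg h3 h4, mul_nonneg h5 h4]

theorem norm_comb_le (o : Fin n) (q r u : ℝ) :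
    ‖(q • basisVec (xIdx o) + r • basisVec (yIdx o) + u • basisVec zIdx : Eucl n)‖ ≤
      |q| + |r| + |u| := by
  refine (norm_add₃_le).trans_eq ?_
  simp [norm_smul]

theorem norm_loopDisplacement_le (o : Fin n) {s a b c e B : ℝ} (hs : |s| = 1) (he : 0 ≤ e)
    (he1 : e ≤ 1) (ha : |a| ≤ B) (hb : |b| ≤ B) (hc : |c| ≤ B) (y : Eucl n) :
    ‖loopDisplacement o s a b c e y‖ ≤ 3 * e * B * (1 + ‖y‖) := by
  refine (norm_comb_le o _ _ _).trans ?_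
  have hB : 0 ≤ B := (abs_nonneg a).trans ha
  have hy := abs_coord_le y (xIdx o)
  have h1 : |e * a| ≤ e * B := by
    rw [abs_mul, abs_of_nonneg he]
    gcongr
  have h2 : |s * e * b| ≤ e * B := by
    rw [abs_mul, abs_mul, hs, abs_of_nonneg he, one_mul]
    gcongr
  have h3 : |s * (e ^ 2 * c - e * y (xIdx o) * b)| ≤ e * B + e * ‖y‖ * B := by
    rw [abs_mul, hs, one_mul]
    refine (abs_sub _ _).trans ?_
    rw [abs_mul, abs_mul, abs_mul, abs_of_nonneg he, abs_of_nonneg (sq_nonneg e)]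
    gcongr
    nlinarith
  have := norm_nonneg y
  nlinarith [mul_nonneg (mul_nonneg he hB) this]

theorem norm_loopDifferential_le (o : Fin n) {s a b c e B : ℝ} (hs : |s| = 1) (he : 0 ≤ e)
    (he1 : e ≤ 1) (ha : |a| ≤ B) (hb : |b| ≤ B) (hc : |c| ≤ B) (y v : Eucl n) (δ : ℝ) :
    ‖loopDifferential o s a b c e y v δ‖ ≤ 4 * B * (1 + ‖y‖) * |δ| + e * B * ‖v‖ := by
  refine (norm_comb_le o _ _ _).trans ?_
  have hB : 0 ≤ B := (abs_nonneg a).trans ha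
  have hy := abs_coord_le y (xIdx o)
  have hv := abs_coord_le v (xIdx o)
  have h1 : |δ * a| ≤ |δ| * B := by
    rw [abs_mul]
    gcongr
  have h2 : |s * δ * b| ≤ |δ| * B := by
    rw [abs_mul, abs_mul, hs, one_mul]
    gcongr
  have h3 : |s * (2 * e * δ * c - δ * y (xIdx o) * b - e * v (xIdx o) * b)| ≤
      2 * 1 * |δ| * B + |δ| * ‖y‖ * B + e * ‖v‖ * B := by
    rw [abs_mul, hs, one_mul]
    refine (abs_sub _ _).trans (add_le_add ((abs_sub _ _).trans (add_le_add ?_ ?_)) ?_)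
    · rw [abs_mul, abs_mul, abs_mul, abs_of_nonneg he, abs_two]
      gcongr
    · rw [abs_mul, abs_mul]
      gcongr
    · rw [abs_mul, abs_mul, abs_of_nonneg he]
      gcongr
  have := norm_nonneg y
  nlinarith [mul_nonneg (mul_nonneg (abs_nonneg δ) hB) this]

end ChartEstimates

/-! ### Estimates for one loop in terms of a good radius -/

section RadiusEstimates

variable {n : ℕ} {V : Type*} [NormedAddCommGroup V] [NormedSpace ℝ V]

/-- On the ball of radius `d` around `y`, inside `O`, the differential of `H` and the function `Λ`
are controlled in terms of `d`. -/
structure IsGoodRadius (O : Set (Eucl n)) (H : Eucl n → V) (Λ : Eucl n → ℝ) (y : Eucl n)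
    (d : ℝ) : Prop where
  pos : 0 < d
  le_one : d ≤ 1
  ball : Metric.ball y d ⊆ O
  fderiv : ∀ y' ∈ Metric.ball y d, ‖fderiv ℝ H y' - fderiv ℝ H y‖ ≤ 1 / 4
  lip : ∀ y' ∈ Metric.ball y d, d * |Λ y' - Λ y| ≤ ‖y' - y‖
  norm : d * (1 + ‖y‖) ≤ 1
  norm_fderiv : d * ‖_root_.fderiv ℝ H y‖ ≤ 1
  le_scale : d ≤ Λ y
  scale_le : d * Λ y ≤ 1

/-- Bounds on a transverse loop of size `e` at `y`, in terms of a good radius. -/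
structure IsLoopBound (O : Set (Eucl n)) (H : Eucl n → V) (Λ : Eucl n → ℝ) (y : Eucl n)
    (d B κ e : ℝ) (δ : Eucl n →L[ℝ] ℝ) : Prop where
  good : IsGoodRadius O H Λ y d
  one_le : (n : ℝ) + 1 ≤ B
  kappa_pos : 0 < κ
  kappa_le : κ ≤ 1
  nonneg : 0 ≤ e
  small : e ≤ κ * d ^ 4 / (100 * B ^ 2)
  small_deriv : ∀ v, |δ v| ≤ κ * d ^ 4 / (100 * B ^ 2) * ‖fderiv ℝ H y v‖
  norm_le : ∀ v, ‖v‖ ≤ ‖fderiv ℝ H y v‖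
  scale : 2 * (3 * B * (‖fderiv ℝ H y‖ + 1) * (1 + ‖y‖)) ^ 2 ≤ Λ y

variable {O : Set (Eucl n)} {H : Eucl n → V} {Λ : Eucl n → ℝ} {y : Eucl n}
  {d B κ e : ℝ} {δ : Eucl n →L[ℝ] ℝ}

namespace IsLoopBound

theorem one_le_B (h : IsLoopBound O H Λ y d B κ e δ) : 1 ≤ B := by
  have : (0 : ℝ) ≤ n := Nat.cast_nonneg _
  linarith [h.one_le]

theorem eta_le (h : IsLoopBound O H Λ y d B κ e δ) :
    κ * d ^ 4 / (100 * B ^ 2) * B ^ 2 = κ * d ^ 4 / 100 := by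
  have := h.one_le_B
  field_simp

theorem size_mul_sq (h : IsLoopBound O H Λ y d B κ e δ) : e * B ^ 2 ≤ κ * d ^ 4 / 100 := by
  rw [← h.eta_le]
  exact mul_le_mul_of_nonneg_right h.small (sq_nonneg _)

theorem size_mul (h : IsLoopBound O H Λ y d B κ e δ) : e * B ≤ κ * d ^ 4 / 100 := by
  refine le_trans ?_ h.size_mul_sq
  have := h.one_le_B
  exact mul_le_mul_of_nonneg_left (by nlinarith) h.nonneg

theorem deriv_mul_sq (h : IsLoopBound O H Λ y d B κ e δ) (v : Eucl n) :
    |δ v| * B ^ 2 ≤ κ * d ^ 4 / 100 * ‖fderiv ℝ H y v‖ := by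
  rw [← h.eta_le, mul_right_comm]
  exact mul_le_mul_of_nonneg_right (h.small_deriv v) (sq_nonneg _)

theorem deriv_mul (h : IsLoopBound O H Λ y d B κ e δ) (v : Eucl n) :
    |δ v| * B ≤ κ * d ^ 4 / 100 * ‖fderiv ℝ H y v‖ := by
  refine le_trans ?_ (h.deriv_mul_sq v)
  have := h.one_le_B
  exact mul_le_mul_of_nonneg_left (by nlinarith) (abs_nonneg _)

theorem kappa_pow_le (h : IsLoopBound O H Λ y d B κ e δ) (k : ℕ) : κ * d ^ k ≤ 1 :=
  mul_le_one₀ h.kappa_le (pow_nonneg h.good.pos.le k) (pow_le_one₀ h.good.pos.le h.good.le_one)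

theorem size_le_one (h : IsLoopBound O H Λ y d B κ e δ) : e ≤ 1 := by
  have h1 := h.size_mul
  have h2 := h.kappa_pow_le 4
  nlinarith [h.one_le_B, h.nonneg]

variable {o : Fin n} {s a b c : ℝ}

theorem norm_displacement_le (h : IsLoopBound O H Λ y d B κ e δ) (hs : |s| = 1) (ha : |a| ≤ B)
    (hb : |b| ≤ B) (hc : |c| ≤ B) :
    ‖loopDisplacement o s a b c e y‖ ≤ 3 * e * B / d := by
  refine (norm_loopDisplacement_le o hs h.nonneg h.size_le_one ha hb hc y).trans ?_
  rw [le_div_iff₀ h.good.pos, mul_assoc _ _ d, mul_comm _ d]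
  have : 0 ≤ 3 * e * B := by
    have := h.one_le_B
    have := h.nonneg
    positivity
  exact mul_le_of_le_one_right this h.good.norm

theorem norm_displacement_le_cube (h : IsLoopBound O H Λ y d B κ e δ) (hs : |s| = 1)
    (ha : |a| ≤ B) (hb : |b| ≤ B) (hc : |c| ≤ B) :
    ‖loopDisplacement o s a b c e y‖ ≤ κ * d ^ 3 / 10 := by
  refine (h.norm_displacement_le hs ha hb hc).trans ?_
  rw [div_le_iff₀ h.good.pos]
  have h1 := h.size_mul
  have h2 : 0 < κ * d ^ 4 := mul_pos h.kappa_pos (pow_pos h.good.pos 4)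
  nlinarith

/-- The square of `d` serves twice: the displaced point stays in the ball of radius `d`, and the
displacement vanishes to second order at the boundary of the chart. -/
theorem norm_displacement_le_sq (h : IsLoopBound O H Λ y d B κ e δ) (hs : |s| = 1)
    (ha : |a| ≤ B) (hb : |b| ≤ B) (hc : |c| ≤ B) :
    ‖loopDisplacement o s a b c e y‖ ≤ d ^ 2 / 10 := by
  refine (h.norm_displacement_le_cube hs ha hb hc).trans ?_
  have h1 := h.kappa_pow_le 1
  have h2 := sq_nonneg d
  have : κ * d ^ 3 = (κ * d ^ 1) * d ^ 2 := by ring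
  rw [this]
  nlinarith

theorem displacement_mem (h : IsLoopBound O H Λ y d B κ e δ) (hs : |s| = 1)
    (ha : |a| ≤ B) (hb : |b| ≤ B) (hc : |c| ≤ B) :
    y + loopDisplacement o s a b c e y ∈ Metric.ball y d := by
  rw [mem_ball_iff_norm, add_sub_cancel_left]
  refine (h.norm_displacement_le_sq hs ha hb hc).trans_lt ?_
  nlinarith [h.good.pos, h.good.le_one]

theorem abs_scale_sub_le (h : IsLoopBound O H Λ y d B κ e δ) (hs : |s| = 1)
    (ha : |a| ≤ B) (hb : |b| ≤ B) (hc : |c| ≤ B) :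
    d * |Λ (y + loopDisplacement o s a b c e y) - Λ y| ≤ ‖loopDisplacement o s a b c e y‖ := by
  have := h.good.lip _ (h.displacement_mem (o := o) hs ha hb hc)
  rwa [add_sub_cancel_left] at this

theorem scale_bounds (h : IsLoopBound O H Λ y d B κ e δ) (hs : |s| = 1)
    (ha : |a| ≤ B) (hb : |b| ≤ B) (hc : |c| ≤ B) :
    Λ y / 2 ≤ Λ (y + loopDisplacement o s a b c e y) ∧
      Λ (y + loopDisplacement o s a b c e y) ≤ 2 * Λ y := by
  have h1 := (h.abs_scale_sub_le (o := o) hs ha hb hc).trans (h.norm_displacement_le_sq hs ha hb hc)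
  have h2 : |Λ (y + loopDisplacement o s a b c e y) - Λ y| ≤ d / 10 := by
    have hd := h.good.pos
    refine le_of_mul_le_mul_left (h1.trans_eq ?_) hd
    ring
  have h3 := abs_le.1 h2
  have h4 := h.good.le_scale
  have h5 := h.good.pos
  constructor <;> linarith

theorem norm_fderiv_le (h : IsLoopBound O H Λ y d B κ e δ) (hs : |s| = 1)
    (ha : |a| ≤ B) (hb : |b| ≤ B) (hc : |c| ≤ B) :
    ‖fderiv ℝ H (y + loopDisplacement o s a b c e y)‖ ≤ ‖fderiv ℝ H y‖ + 1 / 4 := by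
  have := h.good.fderiv _ (h.displacement_mem (o := o) hs ha hb hc)
  linarith [norm_le_norm_add_norm_sub' (fderiv ℝ H (y + loopDisplacement o s a b c e y))
    (fderiv ℝ H y)]

theorem norm_differential_le (h : IsLoopBound O H Λ y d B κ e δ) (hs : |s| = 1)
    (ha : |a| ≤ B) (hb : |b| ≤ B) (hc : |c| ≤ B) (v : Eucl n) :
    ‖loopDifferential o s a b c e y v (δ v)‖ ≤ d ^ 3 / 20 * ‖fderiv ℝ H y v‖ := by
  refine (norm_loopDifferential_le o hs h.nonneg h.size_le_one ha hb hc y v _).trans ?_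
  have hd := h.good.pos
  have hN := norm_nonneg (fderiv ℝ H y v)
  have h1 : 4 * B * (1 + ‖y‖) * |δ v| ≤ 4 * (κ * d ^ 3 / 100) * ‖fderiv ℝ H y v‖ := by
    refine le_of_mul_le_mul_left ?_ hd
    have e1 : d * (4 * B * (1 + ‖y‖) * |δ v|) = 4 * (d * (1 + ‖y‖)) * (|δ v| * B) := by ring
    have e2 : d * (4 * (κ * d ^ 3 / 100) * ‖fderiv ℝ H y v‖) =
      4 * 1 * (κ * d ^ 4 / 100 * ‖fderiv ℝ H y v‖) := by ring
    rw [e1, e2]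
    have := h.deriv_mul v
    have hB := h.one_le_B
    have hn := h.good.norm
    gcongr
  have h2 : e * B * ‖v‖ ≤ κ * d ^ 4 / 100 * ‖fderiv ℝ H y v‖ := by
    have := h.size_mul
    have := h.norm_le v
    have := h.kappa_pos
    gcongr
  have h3 : κ * d ^ 3 ≤ d ^ 3 := mul_le_of_le_one_left (by positivity) h.kappa_le
  have h4 : κ * d ^ 4 ≤ d ^ 3 := by
    have : κ * d ^ 4 = (κ * d ^ 1) * d ^ 3 := by ring
    rw [this]
    exact mul_le_of_le_one_left (by positivity) (h.kappa_pow_le 1)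
  calc _ ≤ 4 * (d ^ 3 / 100) * ‖fderiv ℝ H y v‖ + d ^ 3 / 100 * ‖fderiv ℝ H y v‖ := by
        refine add_le_add (h1.trans ?_) (h2.trans ?_) <;> gcongr
    _ = _ := by ring

theorem norm_differential_le_half (h : IsLoopBound O H Λ y d B κ e δ) (hs : |s| = 1)
    (ha : |a| ≤ B) (hb : |b| ≤ B) (hc : |c| ≤ B) (v : Eucl n) :
    ‖loopDifferential o s a b c e y v (δ v)‖ ≤ 1 / 2 * ‖v‖ := by
  refine (h.norm_differential_le hs ha hb hc v).trans ?_
  have hd := h.good.pos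
  have h1 : ‖fderiv ℝ H y v‖ ≤ ‖fderiv ℝ H y‖ * ‖v‖ := (fderiv ℝ H y).le_opNorm v
  have h2 : d ^ 2 ≤ 1 := pow_le_one₀ hd.le h.good.le_one
  calc d ^ 3 / 20 * ‖fderiv ℝ H y v‖ ≤ d ^ 3 / 20 * (‖fderiv ℝ H y‖ * ‖v‖) := by gcongr
    _ = d ^ 2 / 20 * (d * ‖fderiv ℝ H y‖) * ‖v‖ := by ring
    _ ≤ 1 / 20 * 1 * ‖v‖ := by
        have := h.good.norm_fderiv
        gcongr
    _ ≤ 1 / 2 * ‖v‖ := by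
        have := norm_nonneg v
        nlinarith

/-- The differential of `H` changes by at most `1/4` on the ball, and the differential of the loop
is so small that it compensates the possibly large norm of `fderiv ℝ H y`. -/
theorem norm_pushforward_le (h : IsLoopBound O H Λ y d B κ e δ) (hs : |s| = 1)
    (ha : |a| ≤ B) (hb : |b| ≤ B) (hc : |c| ≤ B) (v : Eucl n) :
    ‖fderiv ℝ H (y + loopDisplacement o s a b c e y)
      (v + loopDifferential o s a b c e y v (δ v))‖ ≤ 2 * ‖fderiv ℝ H y v‖ := by
  have hd := h.good.pos
  set A := fderiv ℝ H (y + loopDisplacement o s a b c e y)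
  set w := loopDifferential o s a b c e y v (δ v)
  have h1 : ‖A - fderiv ℝ H y‖ ≤ 1 / 4 := h.good.fderiv _ (h.displacement_mem hs ha hb hc)
  have h2 : ‖A‖ ≤ ‖fderiv ℝ H y‖ + 1 / 4 := h.norm_fderiv_le hs ha hb hc
  have h3 : ‖w‖ ≤ d ^ 3 / 20 * ‖fderiv ℝ H y v‖ := h.norm_differential_le hs ha hb hc v
  have e1 : A (v + w) = fderiv ℝ H y v + (A - fderiv ℝ H y) v + A w := by
    simp
  have h4 : ‖(A - fderiv ℝ H y) v‖ ≤ 1 / 4 * ‖fderiv ℝ H y v‖ :=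
    ((A - fderiv ℝ H y).le_of_opNorm_le h1 v).trans (by gcongr; exact h.norm_le v)
  have h5 : ‖A w‖ ≤ (‖fderiv ℝ H y‖ + 1 / 4) * (d ^ 3 / 20 * ‖fderiv ℝ H y v‖) :=
    (A.le_of_opNorm_le h2 w).trans (by gcongr)
  have h6 : (‖fderiv ℝ H y‖ + 1 / 4) * (d ^ 3 / 20 * ‖fderiv ℝ H y v‖) ≤
      1 / 2 * ‖fderiv ℝ H y v‖ := by
    have e2 : (‖fderiv ℝ H y‖ + 1 / 4) * (d ^ 3 / 20 * ‖fderiv ℝ H y v‖) =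
      (d ^ 2 * (d * ‖fderiv ℝ H y‖) + d ^ 3 / 4) / 20 * ‖fderiv ℝ H y v‖ := by ring
    rw [e2]
    have h7 : d ^ 2 ≤ 1 := pow_le_one₀ hd.le h.good.le_one
    have h8 : d ^ 3 ≤ 1 := pow_le_one₀ hd.le h.good.le_one
    have h9 : d ^ 2 * (d * ‖fderiv ℝ H y‖) ≤ 1 :=
      mul_le_one₀ h7 (by positivity) h.good.norm_fderiv
    have h10 : (d ^ 2 * (d * ‖fderiv ℝ H y‖) + d ^ 3 / 4) / 20 ≤ 1 / 2 := by linarith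
    exact mul_le_mul_of_nonneg_right h10 (norm_nonneg _)
  rw [e1]
  refine (norm_add₃_le).trans ?_
  have := norm_nonneg (fderiv ℝ H y v)
  linarith

theorem scale_pos (h : IsLoopBound O H Λ y d B κ e δ) (hs : |s| = 1)
    (ha : |a| ≤ B) (hb : |b| ≤ B) (hc : |c| ≤ B) :
    0 < Λ (y + loopDisplacement o s a b c e y) := by
  have := (h.scale_bounds (o := o) hs ha hb hc).1
  linarith [h.good.pos, h.good.le_scale]

/-- The factor `2` in the field `scale` is used up here, since `Λ` may be halved between `y` and the
displaced point. -/
theorem le_sqrt_scale (h : IsLoopBound O H Λ y d B κ e δ) (hs : |s| = 1)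
    (ha : |a| ≤ B) (hb : |b| ≤ B) (hc : |c| ≤ B) :
    3 * B * (‖fderiv ℝ H y‖ + 1) * (1 + ‖y‖) ≤ √(Λ (y + loopDisplacement o s a b c e y)) := by
  refine Real.le_sqrt_of_sq_le ?_
  have := (h.scale_bounds (o := o) hs ha hb hc).1
  linarith [h.scale]

theorem sqrt_scale_bounds (h : IsLoopBound O H Λ y d B κ e δ) (hs : |s| = 1)
    (ha : |a| ≤ B) (hb : |b| ≤ B) (hc : |c| ≤ B) :
    d / 2 ≤ √(Λ (y + loopDisplacement o s a b c e y)) ∧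
      d * √(Λ (y + loopDisplacement o s a b c e y)) ≤ 2 := by
  obtain ⟨h1, h2⟩ := h.scale_bounds (o := o) hs ha hb hc
  have h3 := h.good.le_scale
  have h4 := h.good.scale_le
  have hd := h.good.pos
  have hd1 := h.good.le_one
  constructor
  · refine Real.le_sqrt_of_sq_le ?_
    nlinarith
  · have : √(Λ (y + loopDisplacement o s a b c e y)) ≤ 2 / d := by
      refine Real.sqrt_le_iff.2 ⟨by positivity, h2.trans ?_⟩
      rw [div_pow, le_div_iff₀ (by positivity)]
      nlinarith
    rwa [le_div_iff₀ hd, mul_comm] at this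

theorem energy_le_one (h : IsLoopBound O H Λ y d B κ e δ) (hs : |s| = 1)
    (ha : |a| ≤ B) (hb : |b| ≤ B) (hc : |c| ≤ B) :
    √(Λ (y + loopDisplacement o s a b c e y)) * e ≤ 1 := by
  have h1 := (h.sqrt_scale_bounds (o := o) hs ha hb hc).2
  have h2 := h.size_mul
  have hB := h.one_le_B
  have he := h.nonneg
  have h3 : e ≤ d / 100 := by
    have : κ * d ^ 4 = (κ * d ^ 3) * d := by ring
    rw [this] at h2
    have := h.kappa_pow_le 3
    nlinarith [h.good.pos]
  have h4 := Real.sqrt_nonneg (Λ (y + loopDisplacement o s a b c e y))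
  nlinarith

/-- The purpose of the large scale `Λ`: the speed is at most the square root `√Λ e` of the value `Λ
e²` that the scaled form takes on the velocity of a transverse loop. -/
theorem norm_velocity_le (h : IsLoopBound O H Λ y d B κ e δ) (hs : |s| = 1)
    (ha : |a| ≤ B) (hb : |b| ≤ B) (hc : |c| ≤ B) {a' b' c' : ℝ} (ha' : |a'| ≤ B) (hb' : |b'| ≤ B)
    (hc' : |c'| ≤ B) :
    ‖fderiv ℝ H (y + loopDisplacement o s a b c e y) (loopDisplacement o s a' b' c' e y)‖ ≤
      √(Λ (y + loopDisplacement o s a b c e y)) * e := by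
  have h1 := h.norm_fderiv_le (o := o) hs ha hb hc
  have h2 := norm_loopDisplacement_le o hs h.nonneg h.size_le_one ha' hb' hc' y
  refine ((fderiv ℝ H _).le_opNorm _).trans ?_
  have hB := h.one_le_B
  have he := h.nonneg
  calc _ ≤ (‖fderiv ℝ H y‖ + 1) * (3 * e * B * (1 + ‖y‖)) := by
        gcongr
        linarith
    _ = 3 * B * (‖fderiv ℝ H y‖ + 1) * (1 + ‖y‖) * e := by ring
    _ ≤ _ := by
        gcongr
        exact h.le_sqrt_scale hs ha hb hc

/-- Outside the active times the velocity is vertical, of coordinate length `e²`, so the speed is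
bounded by the value of the form itself and not merely by its root. -/
theorem norm_velocity_le_sq (h : IsLoopBound O H Λ y d B κ e δ) (hs : |s| = 1)
    (ha : |a| ≤ B) (hb : |b| ≤ B) (hc : |c| ≤ B) :
    ‖fderiv ℝ H (y + loopDisplacement o s a b c e y) (loopDisplacement o s 0 0 1 e y)‖ ≤
      (√(Λ (y + loopDisplacement o s a b c e y)) * e) ^ 2 := by
  have h1 := h.norm_fderiv_le (o := o) hs ha hb hc
  have h2 : ‖loopDisplacement o s 0 0 1 e y‖ = e ^ 2 := by
    simp [loopDisplacement, norm_smul, hs]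
  refine ((fderiv ℝ H _).le_opNorm _).trans ?_
  rw [h2, mul_pow, Real.sq_sqrt (h.scale_pos hs ha hb hc).le]
  gcongr
  have h3 := (h.scale_bounds (o := o) hs ha hb hc).1
  have h4 := h.scale
  have hB := h.one_le_B
  set A := ‖fderiv ℝ H y‖ with hA
  have hA0 : 0 ≤ A := norm_nonneg _
  have hy0 := norm_nonneg y
  have h5 : A + 1 ≤ 3 * B * (A + 1) * (1 + ‖y‖) := by
    have h6 : 1 ≤ B * (1 + ‖y‖) := by nlinarith
    nlinarith
  nlinarith

theorem abs_form_sub_le (h : IsLoopBound O H Λ y d B κ e δ) (hs : |s| = 1)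
    (ha : |a| ≤ B) (hb : |b| ≤ B) (hc : |c| ≤ B) (v : Eucl n) :
    |Λ (y + loopDisplacement o s a b c e y) *
        stdContactForm n (y + loopDisplacement o s a b c e y)
          (v + loopDifferential o s a b c e y v (δ v)) - Λ y * stdContactForm n y v| ≤
      |Λ (y + loopDisplacement o s a b c e y) - Λ y| * (B * (1 + ‖y‖) * ‖v‖) +
        Λ (y + loopDisplacement o s a b c e y) *
          (e * ((2 * |c| + |a| * |b|) * |δ v| + (|a| + |b|) * ‖v‖)) := by
  rw [stdContactForm_loopDifferential]
  set Λ' := Λ (y + loopDisplacement o s a b c e y)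
  have hΛ' : 0 < Λ' := h.scale_pos hs ha hb hc
  have e1 : Λ' * (stdContactForm n y v +
      e * (s * (2 * c + a * b) * δ v - s * b * v (xIdx o) + a * v (yIdx o))) -
      Λ y * stdContactForm n y v = (Λ' - Λ y) * stdContactForm n y v +
      Λ' * (e * (s * (2 * c + a * b) * δ v - s * b * v (xIdx o) + a * v (yIdx o))) := by ring
  rw [e1]
  refine (abs_add_le _ _).trans (add_le_add ?_ ?_)
  · rw [abs_mul]
    gcongr
    refine (abs_stdContactForm_le y v).trans ?_
    have := h.one_le
    gcongr
  · rw [abs_mul, abs_mul, abs_of_pos hΛ', abs_of_nonneg h.nonneg]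
    have he := h.nonneg
    gcongr
    refine (abs_add_le _ _).trans ?_
    have h1 : |s * (2 * c + a * b) * δ v| ≤ (2 * |c| + |a| * |b|) * |δ v| := by
      rw [abs_mul, abs_mul, hs, one_mul]
      gcongr
      refine (abs_add_le _ _).trans_eq ?_
      rw [abs_mul, abs_mul, abs_two]
    have h2 : |s * b * v (xIdx o)| ≤ |b| * ‖v‖ := by
      rw [abs_mul, abs_mul, hs, one_mul]
      gcongr
      exact abs_coord_le _ _
    have h3 : |a * v (yIdx o)| ≤ |a| * ‖v‖ := by
      rw [abs_mul]
      gcongr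
      exact abs_coord_le _ _
    linarith [abs_sub (s * (2 * c + a * b) * δ v) (s * b * v (xIdx o))]

theorem form_factor_le (h : IsLoopBound O H Λ y d B κ e δ) (v : Eucl n) :
    d * (B * (1 + ‖y‖) * ‖v‖) ≤ B * ‖fderiv ℝ H y v‖ := by
  have hB := h.one_le_B
  have h1 := h.norm_le v
  have h2 := h.good.norm
  have h3 := h.good.pos
  calc d * (B * (1 + ‖y‖) * ‖v‖) = B * (d * (1 + ‖y‖)) * ‖v‖ := by ring
    _ ≤ B * 1 * ‖fderiv ℝ H y v‖ := by gcongr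
    _ = _ := by ring

/-- Two errors: the variation of `Λ`, which costs `d⁻³ B²`, and the distortion of the standard form,
which costs `d⁻¹ B`. The size `κ d⁴ / (100 B²)` pays for both. -/
theorem form_le (h : IsLoopBound O H Λ y d B κ e δ) (hs : |s| = 1)
    (ha : |a| ≤ B) (hb : |b| ≤ B) (hc : |c| ≤ B) (v : Eucl n) :
    |Λ (y + loopDisplacement o s a b c e y) *
        stdContactForm n (y + loopDisplacement o s a b c e y)
          (v + loopDifferential o s a b c e y v (δ v)) - Λ y * stdContactForm n y v| ≤
      κ * ‖fderiv ℝ H y v‖ := by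
  refine (h.abs_form_sub_le hs ha hb hc v).trans ?_
  have hd := h.good.pos
  have hB := h.one_le_B
  have he := h.nonneg
  have hκ := h.kappa_pos
  have hN := norm_nonneg (fderiv ℝ H y v)
  have hsc := (h.scale_bounds (o := o) hs ha hb hc).2
  have hΛ' := h.scale_pos (o := o) hs ha hb hc
  have hdiff := (h.abs_scale_sub_le (o := o) hs ha hb hc).trans
    (h.norm_displacement_le hs ha hb hc)
  set Λ' := Λ (y + loopDisplacement o s a b c e y)
  set N := ‖fderiv ℝ H y v‖
  have hsize := h.size_mul_sq
  have t1 : |Λ' - Λ y| * (B * (1 + ‖y‖) * ‖v‖) ≤ 3 * κ / 100 * N := by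
    refine le_of_mul_le_mul_left ?_ (pow_pos hd 3)
    calc d ^ 3 * (|Λ' - Λ y| * (B * (1 + ‖y‖) * ‖v‖))
        = d * (d * |Λ' - Λ y|) * (d * (B * (1 + ‖y‖) * ‖v‖)) := by ring
      _ ≤ d * (3 * e * B / d) * (B * N) :=
          mul_le_mul (mul_le_mul_of_nonneg_left hdiff hd.le) (h.form_factor_le v)
            (by positivity) (by positivity)
      _ = 3 * (e * B ^ 2) * N := by
          field_simp
      _ ≤ 3 * (κ * d ^ 4 / 100) * N := by gcongr
      _ = d * (d ^ 3 * (3 * κ / 100 * N)) := by ring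
      _ ≤ 1 * (d ^ 3 * (3 * κ / 100 * N)) := by
          gcongr
          exact h.good.le_one
      _ = _ := one_mul _
  have t2 : Λ' * (e * ((2 * |c| + |a| * |b|) * |δ v| + (|a| + |b|) * ‖v‖)) ≤ κ / 10 * N := by
    have hδ := h.deriv_mul v
    have h1 : (2 * |c| + |a| * |b|) * |δ v| ≤ 3 * B * N := by
      have h2 : 2 * |c| + |a| * |b| ≤ 3 * B ^ 2 := by
        have h3 : |a| * |b| ≤ B * B := mul_le_mul ha hb (abs_nonneg _) (by linarith)
        nlinarith
      have h3 := h.kappa_pow_le 4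
      calc _ ≤ 3 * B ^ 2 * |δ v| := by gcongr
        _ = 3 * B * (|δ v| * B) := by ring
        _ ≤ 3 * B * (κ * d ^ 4 / 100 * N) := by gcongr
        _ ≤ 3 * B * (1 * N) := by
            gcongr
            linarith
        _ = _ := by ring
    have h2 : (|a| + |b|) * ‖v‖ ≤ 2 * B * N := by
      have := h.norm_le v
      have h3 : |a| + |b| ≤ 2 * B := by linarith
      gcongr
    refine le_of_mul_le_mul_left ?_ hd
    have h5 := h.good.scale_le
    have hΛ0 : 0 ≤ Λ y := by linarith [h.good.le_scale]
    calc d * (Λ' * (e * ((2 * |c| + |a| * |b|) * |δ v| + (|a| + |b|) * ‖v‖)))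
        ≤ d * (2 * Λ y * (e * (3 * B * N + 2 * B * N))) := by gcongr
      _ = 10 * (d * Λ y) * (e * B) * N := by ring
      _ ≤ 10 * 1 * (κ * d ^ 4 / 100) * N := by
          have := h.size_mul
          gcongr
      _ = d ^ 3 * (d * (κ / 10 * N)) := by ring
      _ ≤ 1 * (d * (κ / 10 * N)) := by
          gcongr
          exact pow_le_one₀ hd.le h.good.le_one
      _ = _ := one_mul _
  nlinarith [mul_nonneg hκ.le hN]

/-- With `a = b = 0` the displacement is of order `e²` and the distortion of the form involves only
`e` times the derivative of the size. Both errors thus retain a factor `e`, exchanged for `√Λ e` by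
means of `d / 2 ≤ √Λ` and `d √Λ ≤ 2`. -/
theorem form_le_energy (h : IsLoopBound O H Λ y d B κ e δ) (hs : |s| = 1)
    (hc : |c| ≤ B) (v : Eucl n) :
    |Λ (y + loopDisplacement o s 0 0 c e y) *
        stdContactForm n (y + loopDisplacement o s 0 0 c e y)
          (v + loopDifferential o s 0 0 c e y v (δ v)) - Λ y * stdContactForm n y v| ≤
      κ * (√(Λ (y + loopDisplacement o s 0 0 c e y)) * e) * ‖fderiv ℝ H y v‖ := by
  have hB := h.one_le_B
  have h00 : |(0 : ℝ)| ≤ B := by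
    rw [abs_zero]
    linarith
  refine (h.abs_form_sub_le hs h00 h00 hc v).trans ?_
  have hd := h.good.pos
  have hd1 := h.good.le_one
  have he := h.nonneg
  have hκ := h.kappa_pos
  have hN := norm_nonneg (fderiv ℝ H y v)
  have hΛ' := h.scale_pos (o := o) hs h00 h00 hc
  obtain ⟨hq1, hq2⟩ := h.sqrt_scale_bounds (o := o) hs h00 h00 hc
  have hnorm : ‖loopDisplacement o s 0 0 c e y‖ ≤ e ^ 2 * B := by
    have : ‖loopDisplacement o s 0 0 c e y‖ = e ^ 2 * |c| := by
      simp [loopDisplacement, norm_smul, hs]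
    rw [this]
    gcongr
  have hdiff := (h.abs_scale_sub_le (o := o) hs h00 h00 hc).trans hnorm
  have hsq := Real.sq_sqrt hΛ'.le
  set Λ' := Λ (y + loopDisplacement o s 0 0 c e y)
  set q := √Λ'
  set N := ‖fderiv ℝ H y v‖
  have hq0 : 0 ≤ q := Real.sqrt_nonneg _
  have hsize := h.size_mul_sq
  have t1 : |Λ' - Λ y| * (B * (1 + ‖y‖) * ‖v‖) ≤ κ / 50 * (q * e) * N := by
    refine le_of_mul_le_mul_left ?_ (pow_pos hd 2)
    calc d ^ 2 * (|Λ' - Λ y| * (B * (1 + ‖y‖) * ‖v‖))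
        = (d * |Λ' - Λ y|) * (d * (B * (1 + ‖y‖) * ‖v‖)) := by ring
      _ ≤ (e ^ 2 * B) * (B * N) :=
          mul_le_mul hdiff (h.form_factor_le v) (by positivity) (by positivity)
      _ = (e * B ^ 2) * e * N := by ring
      _ ≤ (κ * d ^ 4 / 100) * e * N := by gcongr
      _ = d ^ 2 * (κ / 50 * (d / 2 * e) * N) * d := by ring
      _ ≤ d ^ 2 * (κ / 50 * (q * e) * N) * 1 := by gcongr
      _ = _ := mul_one _
  have t2 : Λ' * (e * ((2 * |c| + |(0 : ℝ)| * |(0 : ℝ)|) * |δ v| + (|(0 : ℝ)| + |(0 : ℝ)|) * ‖v‖)) ≤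
      κ / 25 * (q * e) * N := by
    have hδ := h.deriv_mul v
    rw [abs_zero, mul_zero, add_zero, add_zero, zero_mul, add_zero, ← hsq]
    refine le_of_mul_le_mul_left ?_ hd
    calc d * (q ^ 2 * (e * (2 * |c| * |δ v|))) ≤ d * (q ^ 2 * (e * (2 * B * |δ v|))) := by gcongr
      _ = 2 * (d * q) * (q * e) * (|δ v| * B) := by ring
      _ ≤ 2 * 2 * (q * e) * (κ * d ^ 4 / 100 * N) := by gcongr
      _ = d ^ 3 * (d * (κ / 25 * (q * e) * N)) := by ring
      _ ≤ 1 * (d * (κ / 25 * (q * e) * N)) := by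
          gcongr
          exact pow_le_one₀ hd.le h.good.le_one
      _ = _ := one_mul _
  calc _ ≤ κ / 50 * (q * e) * N + κ / 25 * (q * e) * N := add_le_add t1 t2
    _ = 3 / 50 * (κ * (q * e) * N) := by ring
    _ ≤ _ := by
        have : 0 ≤ κ * (q * e) * N := by positivity
        linarith

end IsLoopBound

end RadiusEstimates

/-! ### Composition of admissible loops -/

section LoopComposition

set_option linter.unusedSectionVars false

variable {n : ℕ} {M : Type*} [TopologicalSpace M] [ChartedSpace (Eucl n) M]
  {V : Type*} [NormedAddCommGroup V] [NormedSpace ℝ V]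

/-- A family of maps whose velocity is positive for the `1`-form `β`, except at rest points, which
lie in `Z`. Lengths are measured by the differential `D` of an immersion, and the family nearly
preserves `β`, with more precision at the times outside `J`. -/
structure IsAdmissibleFamily (β : M → Eucl n →L[ℝ] ℝ) (D : M → Eucl n →L[ℝ] V) (κ : ℝ)
    (J : Set ℝ) (Z : Set M) (C : ℝ → M → M) : Prop where
  smooth : IsSmoothFamily (n := n) C
  norm_mfderiv : ∀ t p (v : Eucl n),
    ‖D (C t p) (mfderiv (𝓡 (2 * n + 1)) (𝓡 (2 * n + 1)) (C t) p v)‖ ≤ 2 * ‖D p v‖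
  form_mfderiv : ∀ t p (v : Eucl n),
    |β (C t p) (mfderiv (𝓡 (2 * n + 1)) (𝓡 (2 * n + 1)) (C t) p v) - β p v| ≤ κ * ‖D p v‖
  energy : ∀ t p, ∃ e : ℝ, 0 ≤ e ∧ e ≤ 1 ∧
    β (C t p) (velocity (n := n) C t p) = e ^ 2 ∧
    ‖D (C t p) (velocity (n := n) C t p)‖ ≤ e ∧
    (t ∉ J → ‖D (C t p) (velocity (n := n) C t p)‖ ≤ e ^ 2 ∧ ∀ v : Eucl n,
      |β (C t p) (mfderiv (𝓡 (2 * n + 1)) (𝓡 (2 * n + 1)) (C t) p v) - β p v| ≤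
        κ * e * ‖D p v‖) ∧
    (e = 0 → C t p = p ∧ p ∈ Z)

/-- The arithmetic-geometric inequality `2 e ν ≤ e² + ν²` together with `ν² ≤ E`: a product of two
first-order quantities is bounded by the positive parts of the two families. -/
theorem error_le_of_le {E ν e N P κ κ' : ℝ} (hP0 : 0 ≤ P) (hP : 2 * P * κ ≤ κ') (hκ : 0 ≤ κ)
    (he : 0 ≤ e) (he1 : e ≤ 1) (hE : 0 ≤ E) (hνE : ν ^ 2 ≤ E) (hN : N ≤ P * (E + ν)) :
    κ * e * N ≤ κ' * (E + e ^ 2) := by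
  have h1 : e * (E + ν) ≤ 2 * (E + e ^ 2) := by
    nlinarith [sq_nonneg (e - ν), mul_le_of_le_one_left hE he1]
  calc κ * e * N ≤ κ * e * (P * (E + ν)) := by gcongr
    _ = P * κ * (e * (E + ν)) := by ring
    _ ≤ P * κ * (2 * (E + e ^ 2)) := by gcongr
    _ = 2 * P * κ * (E + e ^ 2) := by ring
    _ ≤ _ := by gcongr

/-- The composition of admissible families that are active at different times. -/
theorem exists_composition {β : M → Eucl n →L[ℝ] ℝ} {D : M → Eucl n →L[ℝ] V} {κ κ' : ℝ}
    (hκ : 0 ≤ κ) (k : ℕ) (hk : 2 ^ k * κ ≤ κ')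
    (J : Fin k → Set ℝ) (Z : Fin k → Set M) (C : Fin k → ℝ → Diffeos n M)
    (hC : ∀ i, IsAdmissibleFamily β D κ (J i) (Z i) (fun t => ⇑(C i t)))
    (hJ : ∀ t i j, t ∈ J i → t ∈ J j → i = j)
    (hper : ∀ i t, C i (t + 1) = C i t) (h0 : ∀ i x, C i 0 x = x) :
    ∃ G : ℝ → Diffeos n M, IsSmoothFamily (n := n) (fun t => ⇑(G t)) ∧
      (∀ t, G (t + 1) = G t) ∧ (∀ x, G 0 x = x) ∧
      ∀ t p, ∃ E ν : ℝ, 0 ≤ E ∧ 0 ≤ ν ∧ ν ^ 2 ≤ E ∧ ((∀ i, t ∉ J i) → ν = 0) ∧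
        (1 - k * κ') * E ≤ β (G t p) (velocity (n := n) (fun s => ⇑(G s)) t p) ∧
        ‖D (G t p) (velocity (n := n) (fun s => ⇑(G s)) t p)‖ ≤ 2 ^ k * (E + ν) ∧
        (E = 0 → G t p = p ∧ ∀ i, p ∈ Z i) := by
  induction k with
  | zero =>
    refine ⟨fun _ => Diffeomorph.refl _ M ∞, isSmoothFamily_const contMDiff_id, fun _ => rfl,
      fun _ => rfl, fun t p => ⟨0, 0, le_rfl, le_rfl, by simp, fun _ => rfl, ?_, ?_,
      fun _ => ⟨rfl, fun i => i.elim0⟩⟩⟩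
    · have := velocity_const (n := n) (⇑(Diffeomorph.refl (𝓡 (2 * n + 1)) M ∞)) t p
      rw [mul_zero]
      exact ((congrArg (β p) this).trans (map_zero _)).ge
    · have := velocity_const (n := n) (⇑(Diffeomorph.refl (𝓡 (2 * n + 1)) M ∞)) t p
      have h1 : D p (velocity (n := n) (fun _ => ⇑(Diffeomorph.refl (𝓡 (2 * n + 1)) M ∞)) t p) =
        0 := (congrArg (D p) this).trans (map_zero _)
      refine (congrArg norm h1).le.trans ?_
      simp
  | succ k ih =>
    have hk' : 2 ^ k * κ ≤ κ' := by
      refine le_trans ?_ hk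
      gcongr
      · norm_num
      · omega
    obtain ⟨G, hGs, hGp, hG0, hG⟩ := ih hk' (fun i => J i.castSucc) (fun i => Z i.castSucc)
      (fun i => C i.castSucc) (fun i => hC _)
      (fun t i j hi hj => Fin.castSucc_injective _ (hJ t _ _ hi hj)) (fun i => hper _) fun i => h0 _
    set L := Fin.last k
    have hL := hC L
    refine ⟨fun t => (G t).trans (C L t), hL.smooth.comp hGs, fun t => ?_, fun x => ?_,
      fun t p => ?_⟩
    · exact congrArg₂ Diffeomorph.trans (hGp t) (hper L t)
    · change C L 0 (G 0 x) = x
      rw [hG0, h0]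
    obtain ⟨E, ν, hE, hν, hνE, hνJ, hβ, hN, hz⟩ := hG t p
    obtain ⟨e, he, he1, hv, hn, hoff, hez⟩ := hL.energy t (G t p)
    have hvel := hL.smooth.velocity_comp hGs t p
    set q := G t p with hq
    set W : Eucl n := velocity (n := n) (fun s => ⇑(G s)) t p with hW
    have h1 : β (C L t q) (velocity (n := n) (fun s p => C L s (G s p)) t p) =
        β (C L t q) (mfderiv (𝓡 (2 * n + 1)) (𝓡 (2 * n + 1)) (C L t) q W) + e ^ 2 := by
      rw [← hv]
      exact (congrArg (β (C L t q)) hvel).trans (map_add _ _ _)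
    have h2 : ‖D (C L t q) (velocity (n := n) (fun s p => C L s (G s p)) t p)‖ ≤
        2 * ‖D q W‖ + ‖D (C L t q) (velocity (n := n) (fun s => ⇑(C L s)) t q)‖ := by
      have h3 : D (C L t q) (velocity (n := n) (fun s p => C L s (G s p)) t p) =
        D (C L t q) (mfderiv (𝓡 (2 * n + 1)) (𝓡 (2 * n + 1)) (C L t) q W) +
          D (C L t q) (velocity (n := n) (fun s => ⇑(C L s)) t q) :=
        (congrArg (D (C L t q)) hvel).trans (map_add _ _ _)
      rw [h3]
      exact (norm_add_le _ _).trans (add_le_add_left (hL.norm_mfderiv t q W) _)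
    have hzero : E + e ^ 2 = 0 → C L t q = p ∧ ∀ i, p ∈ Z i := by
      intro h
      have hE0 : E = 0 := by nlinarith
      have he0 : e = 0 := by
        have : e ^ 2 = 0 := by nlinarith
        exact pow_eq_zero_iff (two_ne_zero) |>.1 this
      obtain ⟨h3, h4⟩ := hz hE0
      obtain ⟨h5, h6⟩ := hez he0
      rw [h3] at h5 h6
      refine ⟨h3 ▸ h5, fun i => ?_⟩
      refine Fin.lastCases h6 (fun j => h4 j) i
    have hκ'0 : 0 ≤ κ' := le_trans (by positivity) hk'
    have hpow : (1 : ℝ) ≤ 2 ^ k := one_le_pow₀ (by norm_num)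
    have hpow' : (2 : ℝ) ^ (k + 1) = 2 * 2 ^ k := pow_succ' _ _
    have hcast : ((k + 1 : ℕ) : ℝ) = k + 1 := by push_cast; ring
    have hkE : 0 ≤ (k : ℝ) * κ' * e ^ 2 := by positivity
    -- If the last family is active, the earlier ones are not: their composed speed is at most `2 ^
    -- k * E`, so even an error proportional to speed is bounded by their positive part. The new
    -- first-order term is `e`.
    by_cases ht : t ∈ J L
    · have hν0 : ν = 0 := hνJ fun i hi => (Fin.castSucc_lt_last i).ne (hJ t _ _ hi ht)
      subst hν0
      rw [add_zero] at hN
      have h3 := hL.form_mfderiv t q W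
      have h4 : κ * ‖D q W‖ ≤ κ' * E :=
        calc κ * ‖D q W‖ ≤ κ * (2 ^ k * E) := by gcongr
          _ = 2 ^ k * κ * E := by ring
          _ ≤ κ' * E := by gcongr
      refine ⟨E + e ^ 2, e, by positivity, he, by linarith, fun h => absurd ht (h L), ?_, ?_, hzero⟩
      · refine le_trans ?_ h1.ge
        rw [hcast]
        have := (abs_le.1 (h3.trans h4)).1
        have := mul_nonneg hκ'0 (sq_nonneg e)
        linarith
      · refine h2.trans ?_
        rw [hpow']
        have := mul_nonneg (zero_le_one.trans hpow) (sq_nonneg e)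
        have := mul_nonneg (sub_nonneg.2 hpow) he
        linarith
    -- If the last family is inactive, its distortion has the extra factor `e`, which absorbs the
    -- first-order speed `ν` of the earlier ones; `ν` is carried along unchanged.
    · obtain ⟨h3, h4⟩ := hoff ht
      have h5 := h4 W
      have h6 : κ * e * ‖D q W‖ ≤ κ' * (E + e ^ 2) :=
        error_le_of_le (zero_le_one.trans hpow) (hpow' ▸ hk) hκ he he1 hE hνE hN
      have h8 := sq_nonneg e
      refine ⟨E + e ^ 2, ν, by positivity, hν, by linarith, fun h => hνJ fun i => h _, ?_, ?_,
        hzero⟩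
      · refine le_trans ?_ h1.ge
        rw [hcast]
        have := (abs_le.1 (h5.trans h6)).1
        linarith
      · refine h2.trans ?_
        rw [hpow']
        have := mul_nonneg (sub_nonneg.2 hpow) (sq_nonneg e)
        have := mul_nonneg (zero_le_one.trans hpow) (sq_nonneg e)
        linarith

/-- A finite collection of admissible loops without a common rest point gives a positive loop. -/
theorem exists_isPositiveLoop_of_admissible {α : OneForm n M} {f : M → ℝ} (hf : ∀ p, 0 < f p)
    {D : M → Eucl n →L[ℝ] V} (k : ℕ)
    (J : Fin k → Set ℝ) (Z : Fin k → Set M) (C : Fin k → ℝ → Diffeos n M)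
    (hC : ∀ i, IsAdmissibleFamily (fun p => f p • (α p : Eucl n →L[ℝ] ℝ)) D
      (1 / (2 ^ k * (2 * (k + 1)))) (J i) (Z i) (fun t => ⇑(C i t)))
    (hJ : ∀ t i j, t ∈ J i → t ∈ J j → i = j)
    (hper : ∀ i t, C i (t + 1) = C i t) (h0 : ∀ i x, C i 0 x = x)
    (hZ : ∀ p, ∃ i, p ∉ Z i) : ∃ G : ℝ → Diffeos n M, IsPositiveLoop α G := by
  obtain ⟨G, hGs, hGp, hG0, hG⟩ := exists_composition (κ' := 1 / (2 * (k + 1))) (by positivity) k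
    (by field_simp; rfl) J Z C hC hJ hper h0
  refine ⟨G, hGs, hGp, hG0, fun t p => ?_⟩
  obtain ⟨E, ν, hE, -, -, -, hβ, -, hz⟩ := hG t p
  have hE0 : 0 < E := by
    refine hE.lt_of_ne fun h => ?_
    obtain ⟨i, hi⟩ := hZ p
    exact hi ((hz h.symm).2 i)
  -- The `k` losses together consume at most half of the positive part.
  have h1 : (k : ℝ) * (1 / (2 * (k + 1))) ≤ 1 / 2 := by
    rw [mul_one_div, div_le_iff₀ (by positivity)]
    linarith
  have h2 : 0 < (1 - k * (1 / (2 * ((k : ℝ) + 1)))) * E := mul_pos (by linarith) hE0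
  exact (pos_iff_pos_of_mul_pos (h2.trans_le hβ)).1 (hf _)

end LoopComposition

/-! ### The loop of diffeomorphisms supported in a chart -/

section ChartLoop

set_option linter.unusedSectionVars false

variable {n : ℕ} {M : Type*} [TopologicalSpace M] [ChartedSpace (Eucl n) M]
  {V : Type*} [NormedAddCommGroup V] [NormedSpace ℝ V]

/-- The differential at `p` of a map to a vector space. -/
def vectorDeriv (F : M → V) (p : M) : Eucl n →L[ℝ] V :=
  mfderiv (𝓡 (2 * n + 1)) 𝓘(ℝ, V) F p

/-- A function on `M` read in the chart `ψ`, extended by zero. -/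
def inChartFun (ψ : OpenPartialHomeomorph M (Eucl n)) (ε : M → ℝ) (y : Eucl n) : ℝ :=
  open Classical in if y ∈ ψ.target then ε (ψ.symm y) else 0

/-- Data for a transverse loop in the chart `ψ` of `M`, with `β` the reference form, `ε` the size
of the loop and lengths measured by the differential of `F`. -/
structure IsLoopChart (β : M → Eucl n →L[ℝ] ℝ) (F : M → V) (ψ : OpenPartialHomeomorph M (Eucl n))
    (s : ℝ) (Λ : Eucl n → ℝ) (S : Set M) (ε : M → ℝ) (B κ : ℝ) : Prop where
  chart : ContMDiffOn (𝓡 (2 * n + 1)) 𝓘(ℝ, Eucl n) ∞ ψ ψ.source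
  chart_symm : ContMDiffOn 𝓘(ℝ, Eucl n) (𝓡 (2 * n + 1)) ∞ ψ.symm ψ.target
  form : ∀ p ∈ ψ.source, ∀ v : Eucl n,
    β p v = s * (Λ (ψ p) * stdContactForm n (ψ p) (coordDeriv ψ p v))
  sign : |s| = 1
  smooth_map : ContMDiff (𝓡 (2 * n + 1)) 𝓘(ℝ, V) ∞ F
  smooth_size : ContMDiff (𝓡 (2 * n + 1)) 𝓘(ℝ, ℝ) ∞ ε
  closed : IsClosed S
  subset : S ⊆ ψ.source
  supp : ∀ p ∉ S, ε p = 0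
  bound : ∀ p ∈ S, ∃ d, IsLoopBound ψ.target (F ∘ ψ.symm) Λ (ψ p) d B κ (ε p)
    (fderiv ℝ (inChartFun ψ ε) (ψ p))

namespace IsLoopChart

variable {β : M → Eucl n →L[ℝ] ℝ} {F : M → V} {ψ : OpenPartialHomeomorph M (Eucl n)}
    {s : ℝ} {Λ : Eucl n → ℝ} {S : Set M} {ε : M → ℝ} {B κ : ℝ}

theorem inChartFun_apply (_ : IsLoopChart β F ψ s Λ S ε B κ) {p : M} (hp : p ∈ ψ.source) :
    inChartFun ψ ε (ψ p) = ε p := by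
  rw [inChartFun, if_pos (ψ.map_source hp), ψ.left_inv hp]

theorem mem_of_ne_zero (h : IsLoopChart β F ψ s Λ S ε B κ) {y : Eucl n}
    (hy : inChartFun ψ ε y ≠ 0) : y ∈ ψ.target ∧ ψ.symm y ∈ S := by
  unfold inChartFun at hy
  split_ifs at hy with h1
  · refine ⟨h1, ?_⟩
    by_contra h2
    exact hy (h.supp _ h2)
  · exact absurd rfl hy

theorem contDiffOn_inChartFun (h : IsLoopChart β F ψ s Λ S ε B κ) :
    ContDiffOn ℝ ∞ (inChartFun ψ ε) ψ.target := by
  have h1 : ContMDiffOn 𝓘(ℝ, Eucl n) 𝓘(ℝ, ℝ) ∞ (ε ∘ ψ.symm) ψ.target :=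
    h.smooth_size.comp_contMDiffOn h.chart_symm
  refine h1.contDiffOn.congr fun y hy => ?_
  rw [inChartFun, if_pos hy]
  rfl

theorem differentiableAt_inChartFun (h : IsLoopChart β F ψ s Λ S ε B κ) {y : Eucl n}
    (hy : y ∈ ψ.target) : DifferentiableAt ℝ (inChartFun ψ ε) y :=
  (h.contDiffOn_inChartFun.differentiableOn (by simp)).differentiableAt
    (ψ.open_target.mem_nhds hy)

theorem vectorDeriv_eq (h : IsLoopChart β F ψ s Λ S ε B κ) {p : M} (hp : p ∈ ψ.source)
    (v : Eucl n) :
    vectorDeriv F p v = fderiv ℝ (F ∘ ψ.symm) (ψ p) (coordDeriv ψ p v) := by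
  have h1 : ContMDiffOn 𝓘(ℝ, Eucl n) 𝓘(ℝ, V) ∞ (F ∘ ψ.symm) ψ.target :=
    h.smooth_map.comp_contMDiffOn h.chart_symm
  have h2 : MDifferentiableAt 𝓘(ℝ, Eucl n) 𝓘(ℝ, V) (F ∘ ψ.symm) (ψ p) :=
    ((h1 _ (ψ.map_source hp)).contMDiffAt
      (ψ.open_target.mem_nhds (ψ.map_source hp))).mdifferentiableAt (by simp)
  have h3 : MDifferentiableAt (𝓡 (2 * n + 1)) 𝓘(ℝ, Eucl n) ψ p :=
    ((h.chart p hp).contMDiffAt (ψ.open_source.mem_nhds hp)).mdifferentiableAt (by simp)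
  have h4 := mfderiv_comp (x := p) h2 h3
  have h5 : F =ᶠ[𝓝 p] (F ∘ ψ.symm) ∘ ψ := by
    filter_upwards [ψ.open_source.mem_nhds hp] with q hq
    exact (congrArg F (ψ.left_inv hq)).symm
  have h6 := h5.mfderiv_eq.trans h4
  rw [mfderiv_eq_fderiv] at h6
  exact congrArg (fun L : Eucl n →L[ℝ] V => L v) h6

/-- The displacement of the loop in the chart. -/
def displacement (_ : IsLoopChart β F ψ s Λ S ε B κ) (o : Fin n) (a b c : ℝ → ℝ) (t : ℝ)
    (y : Eucl n) : Eucl n :=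
  loopDisplacement o s (a t) (b t) (c t) (inChartFun ψ ε y) y

variable {o : Fin n} {a b c : ℝ → ℝ} {J : Set ℝ}

theorem displacement_eq_zero (h : IsLoopChart β F ψ s Λ S ε B κ) (t : ℝ) {y : Eucl n}
    (hy : inChartFun ψ ε y = 0) : h.displacement o a b c t y = 0 := by
  simp [displacement, loopDisplacement, hy]

theorem inChartFun_eq_zero (h : IsLoopChart β F ψ s Λ S ε B κ) {p : M} (hp : p ∉ S)
    (hp' : p ∈ ψ.source) : inChartFun ψ ε (ψ p) = 0 := by
  rw [h.inChartFun_apply hp', h.supp p hp]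

theorem inChartFun_eventually (h : IsLoopChart β F ψ s Λ S ε B κ) {y : Eucl n}
    (hy : y ∈ ψ.target) (hS : ψ.symm y ∉ S) : inChartFun ψ ε =ᶠ[𝓝 y] 0 := by
  have h1 : ψ.symm ⁻¹' Sᶜ ∈ 𝓝 y :=
    (ψ.continuousAt_symm hy).preimage_mem_nhds (h.closed.isOpen_compl.mem_nhds hS)
  filter_upwards [h1, ψ.open_target.mem_nhds hy] with z hz hz'
  rw [inChartFun, if_pos hz', h.supp _ hz]
  rfl

theorem exists_hasFDerivAt (h : IsLoopChart β F ψ s Λ S ε B κ) (t : ℝ) {y : Eucl n}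
    (hy : y ∈ ψ.target) : ∃ L : Eucl n →L[ℝ] Eucl n,
      HasFDerivAt (h.displacement o a b c t) L y ∧ ∀ v, L v =
        loopDifferential o s (a t) (b t) (c t) (inChartFun ψ ε y) y v
          (fderiv ℝ (inChartFun ψ ε) y v) :=
  hasFDerivAt_loopDisplacement o s (a t) (b t) (c t) (h.differentiableAt_inChartFun hy)

/-- A good radius never exceeds the distance to a point outside the target, and the displacement is
at most its square. -/
theorem norm_displacement_le (h : IsLoopChart β F ψ s Λ S ε B κ) (hl : IsTransverseLoop a b c J B)
    (t : ℝ) {y : Eucl n} (hy : y ∉ ψ.target) (x : Eucl n) :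
    ‖h.displacement o a b c t x‖ ≤ ‖x - y‖ ^ 2 := by
  by_cases hx : inChartFun ψ ε x = 0
  · rw [h.displacement_eq_zero t hx, norm_zero]
    positivity
  obtain ⟨h1, h2⟩ := h.mem_of_ne_zero hx
  obtain ⟨d, hd⟩ := h.bound _ h2
  have e1 : inChartFun ψ ε x = ε (ψ.symm x) := by rw [inChartFun, if_pos h1]
  rw [ψ.right_inv h1, ← e1] at hd
  have h3 := hl.bound t
  have h4 : d ≤ ‖x - y‖ := by
    by_contra! h5
    refine hy (hd.good.ball ?_)
    rwa [mem_ball_iff_norm, norm_sub_rev]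
  refine (hd.norm_displacement_le_sq h.sign h3.1 h3.2.1 h3.2.2.1).trans ?_
  have := hd.good.pos
  nlinarith

/-- The support is closed in `M` but its image in the chart may accumulate at the boundary of the
target. The Lipschitz bound comes from bounding the derivative on the whole vector space, where the
displacement is extended by zero. -/
theorem isChartPerturbation (h : IsLoopChart β F ψ s Λ S ε B κ) (o : Fin n)
    (hl : IsTransverseLoop a b c J B) : IsChartPerturbation ψ (h.displacement o a b c) where
  chart := h.chart
  chart_symm := h.chart_symm
  smooth := by
    have he : ContDiffOn ℝ ∞ (fun q : ℝ × Eucl n => inChartFun ψ ε q.2) (univ ×ˢ ψ.target) :=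
      h.contDiffOn_inChartFun.comp contDiffOn_snd fun q hq => hq.2
    have ha : ContDiffOn ℝ ∞ (fun q : ℝ × Eucl n => a q.1) (univ ×ˢ ψ.target) :=
      (hl.contDiff_a.comp contDiff_fst).contDiffOn
    have hb : ContDiffOn ℝ ∞ (fun q : ℝ × Eucl n => b q.1) (univ ×ˢ ψ.target) :=
      (hl.contDiff_b.comp contDiff_fst).contDiffOn
    have hc : ContDiffOn ℝ ∞ (fun q : ℝ × Eucl n => c q.1) (univ ×ˢ ψ.target) :=
      (hl.contDiff_c.comp contDiff_fst).contDiffOn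
    have hx : ContDiffOn ℝ ∞ (fun q : ℝ × Eucl n => q.2 (xIdx o)) (univ ×ˢ ψ.target) :=
      ((EuclideanSpace.proj (xIdx o) : Eucl n →L[ℝ] ℝ).contDiff.comp contDiff_snd).contDiffOn
    exact (((he.mul ha).smul contDiffOn_const).add
      (((contDiffOn_const.mul he).mul hb).smul contDiffOn_const)).add
      ((contDiffOn_const.mul (((he.pow 2).mul hc).sub ((he.mul hx).mul hb))).smul contDiffOn_const)
  lip := by
    intro t
    obtain ⟨b1, b2, b3, -⟩ := hl.bound t
    have key : ∀ y, ∃ L : Eucl n →L[ℝ] Eucl n, HasFDerivAt (h.displacement o a b c t) L y ∧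
        ‖L‖ ≤ 1 / 2 := by
      intro y
      by_cases hy : y ∈ ψ.target
      · by_cases hS : ψ.symm y ∈ S
        · obtain ⟨L, hL, hLv⟩ := h.exists_hasFDerivAt (o := o) (a := a) (b := b) (c := c) t hy
          refine ⟨L, hL, L.opNorm_le_bound (by norm_num) fun v => ?_⟩
          obtain ⟨d, hd⟩ := h.bound _ hS
          have e1 : inChartFun ψ ε y = ε (ψ.symm y) := by rw [inChartFun, if_pos hy]
          rw [ψ.right_inv hy, ← e1] at hd
          rw [hLv]
          exact hd.norm_differential_le_half h.sign b1 b2 b3 v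
        · refine ⟨0, (hasFDerivAt_const 0 y).congr_of_eventuallyEq ?_, by simp⟩
          filter_upwards [h.inChartFun_eventually hy hS] with z hz
          exact h.displacement_eq_zero t hz
      -- At points outside the target the displacement is of second order in the distance, hence
      -- differentiable with derivative zero.
      · refine ⟨0, Asymptotics.IsBigO.hasFDerivAt (n := 2) ?_ one_lt_two, by simp⟩
        refine Asymptotics.IsBigO.of_bound 1 (Filter.Eventually.of_forall fun x => ?_)
        rw [one_mul, norm_pow, norm_norm]
        exact h.norm_displacement_le hl t hy x
    refine lipschitzWith_of_nnnorm_fderiv_le (𝕜 := ℝ)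
      (fun y => (key y).choose_spec.1.differentiableAt) fun y => ?_
    rw [(key y).choose_spec.1.fderiv, ← NNReal.coe_le_coe]
    simpa using (key y).choose_spec.2
  supp := by
    refine ⟨S, h.closed, h.subset, fun t y hy => ?_⟩
    have hy' : inChartFun ψ ε y ≠ 0 := fun h0 => hy (h.displacement_eq_zero t h0)
    obtain ⟨h1, h2⟩ := h.mem_of_ne_zero hy'
    exact ⟨_, h2, ψ.right_inv h1⟩

theorem perturb_of_notMem (h : IsLoopChart β F ψ s Λ S ε B κ) (t : ℝ) {p : M} (hp : p ∉ S) :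
    perturb ψ (h.displacement o a b c t) p = p := by
  by_cases hp' : p ∈ ψ.source
  · exact perturb_of_eq_zero (h.displacement_eq_zero t (h.inChartFun_eq_zero hp hp'))
  · exact _root_.perturb_of_notMem _ hp'

theorem mfderiv_of_notMem (h : IsLoopChart β F ψ s Λ S ε B κ) (t : ℝ) {p : M} (hp : p ∉ S)
    (v : Eucl n) : (mfderiv (𝓡 (2 * n + 1)) (𝓡 (2 * n + 1))
      (perturb ψ (h.displacement o a b c t)) p v : Eucl n) = v := by
  have h1 : perturb ψ (h.displacement o a b c t) =ᶠ[𝓝 p] id := by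
    filter_upwards [h.closed.isOpen_compl.mem_nhds hp] with q hq
    exact h.perturb_of_notMem t hq
  refine (congrArg (fun L : Eucl n →L[ℝ] Eucl n => L v) h1.mfderiv_eq).trans ?_
  exact congrArg (fun L : Eucl n →L[ℝ] Eucl n => L v) (mfderiv_id (I := 𝓡 (2 * n + 1)) (x := p))

theorem form_at (h : IsLoopChart β F ψ s Λ S ε B κ) (hl : IsTransverseLoop a b c J B) (t : ℝ)
    {p : M} (hp : p ∈ ψ.source) (v : Eucl n) :
    β (perturb ψ (h.displacement o a b c t) p) v = s * (Λ (ψ p + h.displacement o a b c t (ψ p)) *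
      stdContactForm n (ψ p + h.displacement o a b c t (ψ p))
        (coordDeriv ψ (perturb ψ (h.displacement o a b c t) p) v)) := by
  have hw := h.isChartPerturbation o hl
  rw [h.form _ (hw.perturb_mem t hp), hw.chart_perturb t hp]

theorem vectorDeriv_at (h : IsLoopChart β F ψ s Λ S ε B κ) (hl : IsTransverseLoop a b c J B)
    (t : ℝ) {p : M} (hp : p ∈ ψ.source) (v : Eucl n) :
    vectorDeriv F (perturb ψ (h.displacement o a b c t) p) v =
      fderiv ℝ (F ∘ ψ.symm) (ψ p + h.displacement o a b c t (ψ p))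
        (coordDeriv ψ (perturb ψ (h.displacement o a b c t) p) v) := by
  have hw := h.isChartPerturbation o hl
  rw [h.vectorDeriv_eq (hw.perturb_mem t hp), hw.chart_perturb t hp]

theorem coordDeriv_mfderiv (h : IsLoopChart β F ψ s Λ S ε B κ) (hl : IsTransverseLoop a b c J B)
    (t : ℝ) {p : M} (hp : p ∈ ψ.source) (v : Eucl n) :
    coordDeriv ψ (perturb ψ (h.displacement o a b c t) p)
      (mfderiv (𝓡 (2 * n + 1)) (𝓡 (2 * n + 1)) (perturb ψ (h.displacement o a b c t)) p v) =
      coordDeriv ψ p v + loopDifferential o s (a t) (b t) (c t) (ε p) (ψ p) (coordDeriv ψ p v)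
        (fderiv ℝ (inChartFun ψ ε) (ψ p) (coordDeriv ψ p v)) := by
  have hw := h.isChartPerturbation o hl
  obtain ⟨L, hL, hLv⟩ := h.exists_hasFDerivAt (o := o) (a := a) (b := b) (c := c) t
    (ψ.map_source hp)
  refine (hw.mfderiv_mfderiv t hp v).trans ?_
  rw [hL.fderiv, hLv, h.inChartFun_apply hp]

theorem coordDeriv_velocity (h : IsLoopChart β F ψ s Λ S ε B κ) (hl : IsTransverseLoop a b c J B)
    (t : ℝ) {p : M} (hp : p ∈ ψ.source) :
    coordDeriv ψ (perturb ψ (h.displacement o a b c t) p)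
      (velocity (n := n) (fun r => perturb ψ (h.displacement o a b c r)) t p) =
      loopDisplacement o s (deriv a t) (deriv b t) (deriv c t) (ε p) (ψ p) := by
  have hw := h.isChartPerturbation o hl
  refine (hw.mfderiv_velocity t hp).trans ?_
  rw [← h.inChartFun_apply hp]
  exact (hasDerivAt_loopDisplacement o s _ (ψ p) (hl.contDiff_a.differentiable (by simp) t)
    (hl.contDiff_b.differentiable (by simp) t) (hl.contDiff_c.differentiable (by simp) t)).deriv

theorem displacement_apply (h : IsLoopChart β F ψ s Λ S ε B κ) (t : ℝ) {p : M}
    (hp : p ∈ ψ.source) : h.displacement o a b c t (ψ p) =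
      loopDisplacement o s (a t) (b t) (c t) (ε p) (ψ p) := by
  rw [displacement, h.inChartFun_apply hp]

theorem abs_form_sub (h : IsLoopChart β F ψ s Λ S ε B κ) (hl : IsTransverseLoop a b c J B)
    (t : ℝ) {p : M} (hp : p ∈ ψ.source) (v : Eucl n) :
    |β (perturb ψ (h.displacement o a b c t) p) (mfderiv (𝓡 (2 * n + 1)) (𝓡 (2 * n + 1))
      (perturb ψ (h.displacement o a b c t)) p v) - β p v| =
    |Λ (ψ p + loopDisplacement o s (a t) (b t) (c t) (ε p) (ψ p)) *
      stdContactForm n (ψ p + loopDisplacement o s (a t) (b t) (c t) (ε p) (ψ p))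
        (coordDeriv ψ p v + loopDifferential o s (a t) (b t) (c t) (ε p) (ψ p) (coordDeriv ψ p v)
        (fderiv ℝ (inChartFun ψ ε) (ψ p) (coordDeriv ψ p v))) -
      Λ (ψ p) * stdContactForm n (ψ p) (coordDeriv ψ p v)| := by
  have h1 := h.form_at (o := o) hl t hp (mfderiv (𝓡 (2 * n + 1)) (𝓡 (2 * n + 1))
      (perturb ψ (h.displacement o a b c t)) p v)
  rw [h.coordDeriv_mfderiv hl t hp, h.displacement_apply t hp] at h1
  refine (congrArg (fun r => |r - β p v|) h1).trans ?_
  rw [h.form p hp v, ← mul_sub, abs_mul, h.sign, one_mul]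

/-- The energy witness is `√Λ ε p`, with `Λ` taken at the displaced point: its square is the value
of the form on the velocity. Off `S` the family is the identity and the witness is `0`. -/
theorem isAdmissibleFamily (h : IsLoopChart β F ψ s Λ S ε B κ) (o : Fin n)
    (hl : IsTransverseLoop a b c J B) (hκ : 0 ≤ κ) :
    IsAdmissibleFamily β (vectorDeriv F) κ J {p | ε p = 0}
      (fun t => perturb ψ (h.displacement o a b c t)) where
  smooth := (h.isChartPerturbation o hl).isSmoothFamily
  norm_mfderiv := by
    intro t p v
    by_cases hS : p ∈ S
    · have hp := h.subset hS
      obtain ⟨d, hd⟩ := h.bound p hS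
      obtain ⟨b1, b2, b3, -⟩ := hl.bound t
      refine (congrArg norm (h.vectorDeriv_at hl t hp _)).le.trans ?_
      rw [h.coordDeriv_mfderiv hl t hp, h.displacement_apply t hp, h.vectorDeriv_eq hp]
      exact hd.norm_pushforward_le h.sign b1 b2 b3 _
    · refine (congrArg (fun u => ‖vectorDeriv F _ u‖)
        (h.mfderiv_of_notMem (o := o) (a := a) (b := b) (c := c) t hS v)).le.trans ?_
      rw [h.perturb_of_notMem t hS]
      linarith [norm_nonneg (vectorDeriv F p v)]
  form_mfderiv := by
    intro t p v
    by_cases hS : p ∈ S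
    · have hp := h.subset hS
      obtain ⟨d, hd⟩ := h.bound p hS
      obtain ⟨b1, b2, b3, -⟩ := hl.bound t
      refine (h.abs_form_sub hl t hp v).le.trans ?_
      rw [h.vectorDeriv_eq hp]
      exact hd.form_le h.sign b1 b2 b3 _
    · refine (congrArg (fun u => |β _ u - β p v|)
        (h.mfderiv_of_notMem (o := o) (a := a) (b := b) (c := c) t hS v)).le.trans ?_
      rw [h.perturb_of_notMem t hS, sub_self, abs_zero]
      positivity
  energy := by
    intro t p
    by_cases hS : p ∈ S
    · have hp := h.subset hS
      obtain ⟨d, hd⟩ := h.bound p hS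
      obtain ⟨b1, b2, b3, b4, b5, b6⟩ := hl.bound t
      have hΛ := hd.scale_pos (o := o) h.sign b1 b2 b3
      have hss : s * s = 1 := by
        rw [← abs_mul_abs_self, h.sign, one_mul]
      have hvel := (h.vectorDeriv_at (o := o) hl t hp
        (velocity (n := n) (fun r => perturb ψ (h.displacement o a b c r)) t p))
      rw [h.coordDeriv_velocity hl t hp, h.displacement_apply t hp] at hvel
      refine ⟨√(Λ (ψ p + loopDisplacement o s (a t) (b t) (c t) (ε p) (ψ p))) * ε p,
        mul_nonneg (Real.sqrt_nonneg _) hd.nonneg, hd.energy_le_one h.sign b1 b2 b3, ?_, ?_, ?_, ?_⟩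
      · refine (h.form_at hl t hp _).trans ?_
        rw [h.coordDeriv_velocity hl t hp, h.displacement_apply t hp,
          stdContactForm_loopDisplacement, hl.transverse, mul_pow, Real.sq_sqrt hΛ.le]
        linear_combination (Λ (ψ p + loopDisplacement o s (a t) (b t) (c t) (ε p) (ψ p)) *
          ε p ^ 2) * hss
      · exact (congrArg norm hvel).le.trans (hd.norm_velocity_le h.sign b1 b2 b3 b4 b5 b6)
      · intro ht
        obtain ⟨c1, c2, c3, c4⟩ := hl.off_J t ht
        have c5 : deriv c t = 1 := by
          have := hl.transverse t
          rwa [c1, zero_mul, add_zero] at this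
        refine ⟨?_, fun v => ?_⟩
        · rw [c3, c4, c5] at hvel
          exact (congrArg norm hvel).le.trans (hd.norm_velocity_le_sq h.sign b1 b2 b3)
        · refine (h.abs_form_sub hl t hp v).le.trans ?_
          rw [h.vectorDeriv_eq hp, c1, c2]
          exact hd.form_le_energy h.sign b3 _
      · intro h0
        have hε : ε p = 0 := (mul_eq_zero.1 h0).resolve_left (Real.sqrt_pos.2 hΛ).ne'
        refine ⟨perturb_of_eq_zero (h.displacement_eq_zero t ?_), hε⟩
        rw [h.inChartFun_apply hp, hε]
    · have hv : velocity (n := n) (fun r => perturb ψ (h.displacement o a b c r)) t p = 0 :=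
        velocity_eq_zero (q := p) (Filter.Eventually.of_forall fun r => h.perturb_of_notMem r hS)
      have hD : vectorDeriv F (perturb ψ (h.displacement o a b c t) p)
          (velocity (n := n) (fun r => perturb ψ (h.displacement o a b c r)) t p) = 0 :=
        (congrArg (vectorDeriv F _) hv).trans (map_zero _)
      refine ⟨0, le_rfl, zero_le_one, ?_, ?_, fun _ => ⟨?_, fun v => ?_⟩, fun _ =>
        ⟨h.perturb_of_notMem t hS, h.supp p hS⟩⟩
      · refine (congrArg (β _) hv).trans ((map_zero _).trans ?_)
        simp
      · exact (congrArg norm hD).le.trans (by simp)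
      · exact (congrArg norm hD).le.trans (by simp)
      · refine (congrArg (fun u => |β _ u - β p v|)
          (h.mfderiv_of_notMem (o := o) (a := a) (b := b) (c := c) t hS v)).le.trans ?_
        rw [h.perturb_of_notMem t hS, sub_self, abs_zero]
        simp

/-- Data for a transverse loop in a chart give an admissible loop of diffeomorphisms. -/
theorem exists_loop (h : IsLoopChart β F ψ s Λ S ε B κ) (o : Fin n)
    (hl : IsTransverseLoop a b c J B) (hκ : 0 ≤ κ) : ∃ C : ℝ → Diffeos n M,
      IsAdmissibleFamily β (vectorDeriv F) κ J {p | ε p = 0} (fun t => ⇑(C t)) ∧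
      (∀ t, C (t + 1) = C t) ∧ ∀ x, C 0 x = x := by
  obtain ⟨C, hC, -⟩ := (h.isChartPerturbation o hl).exists_diffeos
  refine ⟨C, ?_, fun t => ?_, fun x => ?_⟩
  · have : (fun t => ⇑(C t)) = fun t => perturb ψ (h.displacement o a b c t) := by
      funext t p
      exact hC t p
    rw [this]
    exact h.isAdmissibleFamily o hl hκ
  · ext x
    rw [hC, hC]
    have : h.displacement o a b c (t + 1) = h.displacement o a b c t := by
      funext y
      simp only [displacement, hl.periodic_a t, hl.periodic_b t, hl.periodic_c t]
    rw [this]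
  · rw [hC]
    refine perturb_of_eq_zero ?_
    simp [displacement, loopDisplacement, hl.zero_a, hl.zero_b, hl.zero_c]

end IsLoopChart

end ChartLoop

/-! ### Functions that are small, or proper, on a noncompact manifold -/

section Sizes

/-- A smooth positive function which is small together with its derivative. -/
theorem exists_contDiff_small {θ : ℝ → ℝ} (hθ : Antitone θ) (hpos : ∀ r, 0 < θ r) :
    ∃ Φ : ℝ → ℝ, ContDiff ℝ ∞ Φ ∧ ∀ r, 0 < Φ r ∧ Φ r ≤ θ r ∧ |deriv Φ r| ≤ θ r := by
  obtain ⟨φ, hφ⟩ := exists_contMDiffMap_forall_mem_convex_of_local_const 𝓘(ℝ, ℝ) (n := (⊤ : ℕ∞))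
    (t := fun r => Ioc 0 (θ r)) (fun r => convex_Ioc _ _) (fun r => ⟨θ (r + 1), by
      filter_upwards [Iio_mem_nhds (lt_add_one r)] with x hx
      exact ⟨hpos _, hθ hx.le⟩⟩)
  have hs : ContDiff ℝ ∞ φ := φ.contMDiff.contDiff
  have hc : Continuous φ := hs.continuous
  have hint : ∀ a b, IntervalIntegrable φ MeasureTheory.volume a b := fun a b =>
    hc.intervalIntegrable a b
  set P : ℝ → ℝ := fun r => ∫ x in (0 : ℝ)..r, φ x with hP
  have hPd : ∀ r, HasDerivAt P (φ r) r := fun r => hc.integral_hasStrictDerivAt 0 r |>.hasDerivAt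
  have hd : ∀ r, HasDerivAt (fun r => P (r + 1) - P r) (φ (r + 1) - φ r) r := fun r =>
    ((hPd (r + 1)).comp_add_const r 1).sub (hPd r)
  have hle : ∀ r, ∀ x, r ≤ x → φ x ≤ θ r := fun r x hx => (hφ x).2.trans (hθ hx)
  -- The average of `φ` over `[r, r + 1]`: its derivative is a difference of two values of `φ`, so
  -- it is as small as `φ` without any control of `φ'`.
  refine ⟨fun r => P (r + 1) - P r, ?_, fun r => ?_⟩
  · rw [contDiff_infty_iff_deriv]
    refine ⟨fun r => (hd r).differentiableAt, ?_⟩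
    have : deriv (fun r => P (r + 1) - P r) = fun r => φ (r + 1) - φ r := by
      funext r
      exact (hd r).deriv
    rw [this]
    exact (hs.comp (contDiff_id.add contDiff_const)).sub hs
  · have e1 : P (r + 1) - P r = ∫ x in r..(r + 1), φ x :=
      intervalIntegral.integral_interval_sub_left (hint _ _) (hint _ _)
    refine ⟨?_, ?_, ?_⟩
    · simp only [e1]
      exact intervalIntegral.intervalIntegral_pos_of_pos (hint _ _) (fun x => (hφ x).1)
        (lt_add_one r)
    · simp only [e1]
      calc ∫ x in r..(r + 1), φ x ≤ ∫ x in r..(r + 1), θ r :=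
            intervalIntegral.integral_mono_on (lt_add_one r).le (hint _ _) (by simp)
              fun x hx => hle r x hx.1
        _ = θ r := by simp
    · rw [(hd r).deriv, abs_sub_le_iff]
      constructor <;> linarith [hle r r le_rfl, hle r (r + 1) (lt_add_one r).le, (hφ r).1,
        (hφ (r + 1)).1]

variable {n : ℕ} {M : Type*} [TopologicalSpace M] [T2Space M] [SigmaCompactSpace M]
  [ChartedSpace (Eucl n) M] [IsManifold (𝓡 (2 * n + 1)) ∞ M]

/-- Smooth a function that is at least `N` outside the `N`-th set of a compact exhaustion; this
condition is convex and locally satisfied by constants. -/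
theorem exists_smooth_proper [LocallyCompactSpace M] :
    ∃ g : M → ℝ, ContMDiff (𝓡 (2 * n + 1)) 𝓘(ℝ, ℝ) ∞ g ∧ ∀ r, IsCompact {p | g p ≤ r} := by
  let K : CompactExhaustion M := default
  obtain ⟨g, hg⟩ := exists_contMDiffMap_forall_mem_convex_of_local_const (𝓡 (2 * n + 1)) (n := (⊤ : ℕ∞))
    (t := fun p : M => {r : ℝ | ∀ N : ℕ, p ∉ K N → (N : ℝ) ≤ r})
    (fun p => by
      have : {r : ℝ | ∀ N : ℕ, p ∉ K N → (N : ℝ) ≤ r} = ⋂ (N : ℕ) (_ : p ∉ K N), Ici (N : ℝ) := by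
        ext r
        simp
      rw [this]
      exact convex_iInter fun N => convex_iInter fun _ => convex_Ici _)
    (fun p => by
      obtain ⟨m, hm⟩ := K.exists_mem p
      refine ⟨m + 1, ?_⟩
      filter_upwards [isOpen_interior.mem_nhds (K.subset_interior_succ m hm)] with q hq N hN
      have : N < m + 1 := by
        by_contra! h
        exact hN (K.subset h (interior_subset hq))
      exact_mod_cast this.le)
  refine ⟨g, g.contMDiff, fun r => ?_⟩
  obtain ⟨N, hN⟩ := exists_nat_gt r
  refine (K.isCompact N).of_isClosed_subset (isClosed_le g.contMDiff.continuous continuous_const)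
    fun p hp => ?_
  by_contra h
  exact absurd ((hg p N h).trans hp) (not_le.2 hN)

/-- A local choice of positive numbers, made uniform on the sublevel sets of a proper function. -/
theorem exists_antitone_of_local {X : Type*} [TopologicalSpace X] {g : X → ℝ}
    (hg : ∀ r, IsCompact {p | g p ≤ r}) {P : ℝ → X → Prop}
    (hmono : ∀ d d' p, 0 < d' → d' ≤ d → P d p → P d' p)
    (hloc : ∀ p, ∃ d, 0 < d ∧ ∀ᶠ q in 𝓝 p, P d q) :
    ∃ θ : ℝ → ℝ, Antitone θ ∧ (∀ r, 0 < θ r) ∧ ∀ p, P (θ (g p)) p := by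
  have h1 : ∀ r, ∃ d, 0 < d ∧ d ≤ 1 ∧ ∀ p, g p ≤ r → P d p := by
    intro r
    refine (hg r).induction_on (p := fun A => ∃ d, 0 < d ∧ d ≤ 1 ∧ ∀ p ∈ A, P d p)
      ⟨1, one_pos, le_rfl, fun p hp => hp.elim⟩ ?_ ?_ ?_
    · rintro A A' hA ⟨d, h1, h2, h3⟩
      exact ⟨d, h1, h2, fun p hp => h3 p (hA hp)⟩
    · rintro A A' ⟨d, h1, h2, h3⟩ ⟨d', h1', h2', h3'⟩
      refine ⟨min d d', lt_min h1 h1', (min_le_left _ _).trans h2, fun p hp => ?_⟩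
      rcases hp with hp | hp
      · exact hmono _ _ p (lt_min h1 h1') (min_le_left _ _) (h3 p hp)
      · exact hmono _ _ p (lt_min h1 h1') (min_le_right _ _) (h3' p hp)
    · intro p _
      obtain ⟨d, hd, hP⟩ := hloc p
      refine ⟨_, nhdsWithin_le_nhds hP, min d 1, lt_min hd one_pos, min_le_right _ _,
        fun q hq => hmono _ _ q (lt_min hd one_pos) (min_le_left _ _) hq⟩
  -- The bound `d ≤ 1` makes the supremum finite. The supremum need not be admissible, hence the
  -- half of it in `θ`.
  set A : ℝ → Set ℝ := fun r => {d | 0 < d ∧ d ≤ 1 ∧ ∀ p, g p ≤ r → P d p} with hA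
  have hbdd : ∀ r, BddAbove (A r) := fun r => ⟨1, fun d hd => hd.2.1⟩
  have hpos : ∀ r, 0 < sSup (A r) := fun r => by
    obtain ⟨d, hd⟩ := h1 r
    exact hd.1.trans_le (le_csSup (hbdd r) hd)
  refine ⟨fun r => sSup (A r) / 2, fun r r' hr => ?_, fun r => half_pos (hpos r), fun p => ?_⟩
  · have : sSup (A r') ≤ sSup (A r) := csSup_le_csSup (hbdd r) (h1 r')
      fun d hd => ⟨hd.1, hd.2.1, fun p hp => hd.2.2 p (hp.trans hr)⟩
    simp only
    linarith
  · obtain ⟨d, hd, hlt⟩ := exists_lt_of_lt_csSup (h1 (g p)) (half_lt_self (hpos (g p)))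
    exact hmono d _ p (half_pos (hpos _)) hlt.le (hd.2.2 p le_rfl)

end Sizes

/-! ### Local existence of good radii -/

section GoodRadius

variable {n : ℕ} {V : Type*} [NormedAddCommGroup V] [NormedSpace ℝ V]
  {O : Set (Eucl n)} {H : Eucl n → V} {Λ : Eucl n → ℝ}

theorem IsGoodRadius.mono {y : Eucl n} {d d' : ℝ} (h : IsGoodRadius O H Λ y d) (hd' : 0 < d')
    (hle : d' ≤ d) : IsGoodRadius O H Λ y d' where
  pos := hd'
  le_one := hle.trans h.le_one
  ball := (Metric.ball_subset_ball hle).trans h.ball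
  fderiv := fun y' hy' => h.fderiv y' (Metric.ball_subset_ball hle hy')
  lip := fun y' hy' => (mul_le_mul_of_nonneg_right hle (abs_nonneg _)).trans
    (h.lip y' (Metric.ball_subset_ball hle hy'))
  norm := (mul_le_mul_of_nonneg_right hle (by positivity)).trans h.norm
  norm_fderiv := (mul_le_mul_of_nonneg_right hle (norm_nonneg _)).trans h.norm_fderiv
  le_scale := hle.trans h.le_scale
  scale_le := (mul_le_mul_of_nonneg_right hle (h.pos.le.trans h.le_scale)).trans h.scale_le

/-- Nearby points have a common good radius. -/
theorem exists_isGoodRadius (hO : IsOpen O) (hH : ContDiffOn ℝ ∞ H O) (hΛ : ContDiffOn ℝ ∞ Λ O)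
    {y₀ : Eucl n} (hy₀ : y₀ ∈ O) (hpos : 0 < Λ y₀) :
    ∃ d, 0 < d ∧ ∀ᶠ y in 𝓝 y₀, IsGoodRadius O H Λ y d := by
  have hH0 : ContDiffAt ℝ ∞ H y₀ := hH.contDiffAt (hO.mem_nhds hy₀)
  have hΛ0 : ContDiffAt ℝ ∞ Λ y₀ := hΛ.contDiffAt (hO.mem_nhds hy₀)
  have h1 : ContinuousAt (fderiv ℝ H) y₀ := (hH0.fderiv_right (m := 0) (by simp)).continuousAt
  obtain ⟨K, t, ht, hK⟩ := (hΛ0.of_le (by simp : (1 : ℕ∞ω) ≤ ∞)).exists_lipschitzOnWith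
  have e1 : ∀ᶠ y in 𝓝 y₀, ‖fderiv ℝ H y - fderiv ℝ H y₀‖ < 1 / 8 := by
    have := Metric.tendsto_nhds.1 h1 (1 / 8) (by norm_num)
    simpa only [dist_eq_norm] using this
  have e2 : ∀ᶠ y in 𝓝 y₀, Λ y₀ / 2 < Λ y := hΛ0.continuousAt.eventually_const_lt (half_lt_self hpos)
  have e3 : ∀ᶠ y in 𝓝 y₀, Λ y < Λ y₀ + 1 := hΛ0.continuousAt.eventually_lt_const (lt_add_one _)
  have e4 : ∀ᶠ y in 𝓝 y₀, ‖y‖ < ‖y₀‖ + 1 :=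
    continuous_norm.continuousAt.eventually_lt_const (lt_add_one _)
  obtain ⟨r, hr, hball⟩ := Metric.eventually_nhds_iff_ball.1
    (e1.and (e2.and (e3.and (e4.and ((show ∀ᶠ y in 𝓝 y₀, y ∈ O from hO.mem_nhds hy₀).and
      (show ∀ᶠ y in 𝓝 y₀, y ∈ t from ht))))))
  -- A single constant for all conditions of the form `d * X ≤ 1`. The summand `2 / Λ y₀` gives `d ≤
  -- Λ y₀ / 2`, which is below `Λ y` nearby.
  set C : ℝ := 1 + K + (‖y₀‖ + 2) + (‖fderiv ℝ H y₀‖ + 1) + (Λ y₀ + 1) + 2 / Λ y₀ with hC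
  have hq : 0 < 2 / Λ y₀ := by positivity
  have hn1 := norm_nonneg y₀
  have hn2 := norm_nonneg (fderiv ℝ H y₀)
  have hK0 : (0 : ℝ) ≤ K := K.2
  have hC0 : 0 < C := by positivity
  set d := min (r / 2) (1 / C) with hd
  have hd0 : 0 < d := lt_min (half_pos hr) (by positivity)
  have hdC : d * C ≤ 1 := by
    rw [← le_div_iff₀ hC0]
    exact min_le_right _ _
  have hdX : ∀ X, X ≤ C → d * X ≤ 1 := fun X hX =>
    (mul_le_mul_of_nonneg_left hX hd0.le).trans hdC
  refine ⟨d, hd0, ?_⟩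
  filter_upwards [Metric.ball_mem_nhds y₀ (half_pos hr)] with y hy
  have hsub : Metric.ball y d ⊆ Metric.ball y₀ r := by
    refine Metric.ball_subset_ball' ?_
    have : d ≤ r / 2 := min_le_left _ _
    linarith [Metric.mem_ball.1 hy]
  obtain ⟨f1, f2, f3, f4, f5, f6⟩ := hball y (hsub (Metric.mem_ball_self hd0))
  have hdle : d ≤ Λ y₀ / 2 := by
    have := hdX (2 / Λ y₀) (by linarith)
    rwa [← le_div_iff₀ hq, one_div_div] at this
  refine ⟨hd0, by simpa using hdX 1 (by linarith), fun y' hy' => (hball y' (hsub hy')).2.2.2.2.1,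
    fun y' hy' => ?_, fun y' hy' => ?_, hdX _ (by linarith), hdX _ ?_, by linarith,
    hdX _ (by linarith)⟩
  · have g1 := (hball y' (hsub hy')).1
    have := norm_sub_le_norm_sub_add_norm_sub (fderiv ℝ H y') (fderiv ℝ H y₀) (fderiv ℝ H y)
    rw [norm_sub_rev (fderiv ℝ H y₀)] at this
    linarith
  · have g1 := hK.dist_le_mul _ (hball y' (hsub hy')).2.2.2.2.2 _ f6
    rw [Real.dist_eq, dist_eq_norm] at g1
    calc d * |Λ y' - Λ y| ≤ d * (K * ‖y' - y‖) := by gcongr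
      _ = d * K * ‖y' - y‖ := by ring
      _ ≤ 1 * ‖y' - y‖ := by
          gcongr
          exact hdX _ (by linarith)
      _ = _ := one_mul _
  · have := norm_le_norm_add_norm_sub' (fderiv ℝ H y) (fderiv ℝ H y₀)
    linarith

end GoodRadius

/-! ### Conformal factors and splitting Darboux charts by sign -/

section SignedDarboux

set_option linter.unusedSectionVars false

variable {n : ℕ} {M : Type*} [TopologicalSpace M] [ChartedSpace (Eucl n) M]

/-- A chart of `M` in which `α` is the standard contact form multiplied by the sign `s` and by the
positive function `Λ`. -/
structure IsSignedDarbouxMap (α : OneForm n M) (ψ : OpenPartialHomeomorph M (Eucl n)) (s : ℝ)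
    (Λ : Eucl n → ℝ) : Prop where
  chart : ContMDiffOn (𝓡 (2 * n + 1)) 𝓘(ℝ, Eucl n) ∞ ψ ψ.source
  chart_symm : ContMDiffOn 𝓘(ℝ, Eucl n) (𝓡 (2 * n + 1)) ∞ ψ.symm ψ.target
  sign : |s| = 1
  contDiffOn : ContDiffOn ℝ ∞ Λ ψ.target
  pos : ∀ y ∈ ψ.target, 0 < Λ y
  form : ∀ p ∈ ψ.source, ∀ v : Eucl n,
    (α p : Eucl n →L[ℝ] ℝ) v = s * (Λ (ψ p) * stdContactForm n (ψ p) (coordDeriv ψ p v))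

/-- The factor by which `α` differs from the standard contact form in the chart `ψ`. -/
def conformalFactor (α : OneForm n M) (ψ : OpenPartialHomeomorph M (Eucl n)) (y : Eucl n) : ℝ :=
  α (ψ.symm y) (mfderiv 𝓘(ℝ, Eucl n) (𝓡 (2 * n + 1)) ψ.symm y (basisVec zIdx : Eucl n))

variable {α : OneForm n M} {ψ : OpenPartialHomeomorph M (Eucl n)}

theorem stdContactForm_z (y : Eucl n) : stdContactForm n y (basisVec zIdx) = 1 := by
  simp [stdContactForm_apply]

namespace IsDarbouxMap

theorem mdifferentiableAt (h : IsDarbouxMap α ψ) {p : M} (hp : p ∈ ψ.source) :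
    MDifferentiableAt (𝓡 (2 * n + 1)) 𝓘(ℝ, Eucl n) ψ p :=
  ((h.chart p hp).contMDiffAt (ψ.open_source.mem_nhds hp)).mdifferentiableAt (by simp)

theorem mdifferentiableAt_symm (h : IsDarbouxMap α ψ) {y : Eucl n} (hy : y ∈ ψ.target) :
    MDifferentiableAt 𝓘(ℝ, Eucl n) (𝓡 (2 * n + 1)) ψ.symm y :=
  ((h.chart_symm y hy).contMDiffAt (ψ.open_target.mem_nhds hy)).mdifferentiableAt (by simp)

theorem coordDeriv_symm (h : IsDarbouxMap α ψ) {y : Eucl n} (hy : y ∈ ψ.target) (u : Eucl n) :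
    coordDeriv ψ (ψ.symm y) (mfderiv 𝓘(ℝ, Eucl n) (𝓡 (2 * n + 1)) ψ.symm y u) = u := by
  have h1 := mfderiv_comp (x := y) (h.mdifferentiableAt (ψ.map_target hy))
    (h.mdifferentiableAt_symm hy)
  have h2 : ψ ∘ ψ.symm =ᶠ[𝓝 y] id := by
    filter_upwards [ψ.open_target.mem_nhds hy] with z hz
    exact ψ.right_inv hz
  have h3 := h1.symm.trans (h2.mfderiv_eq.trans mfderiv_id)
  exact congrArg (fun L : Eucl n →L[ℝ] Eucl n => L u) h3

theorem symm_coordDeriv (h : IsDarbouxMap α ψ) {p : M} (hp : p ∈ ψ.source) (v : Eucl n) :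
    (mfderiv 𝓘(ℝ, Eucl n) (𝓡 (2 * n + 1)) ψ.symm (ψ p) (coordDeriv ψ p v) : Eucl n) = v := by
  have h1 := mfderiv_comp (x := p) (h.mdifferentiableAt_symm (ψ.map_source hp))
    (h.mdifferentiableAt hp)
  have h2 : ψ.symm ∘ ψ =ᶠ[𝓝 p] id := by
    filter_upwards [ψ.open_source.mem_nhds hp] with z hz
    exact ψ.left_inv hz
  have h3 := h1.symm.trans (h2.mfderiv_eq.trans mfderiv_id)
  exact congrArg (fun L : Eucl n →L[ℝ] Eucl n => L v) h3

theorem conformalFactor_ne_zero (h : IsDarbouxMap α ψ) {y : Eucl n} (hy : y ∈ ψ.target) :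
    conformalFactor α ψ y ≠ 0 := by
  intro h0
  have h1 := (h.ker _ (ψ.map_target hy) _).2 h0
  rw [h.coordDeriv_symm hy, stdContactForm_z] at h1
  exact one_ne_zero h1

/-- Subtracting the multiple of the `z`-vector with the same standard value puts a vector into the
common kernel, so the two forms are proportional, with factor the value of `α` on the `z`-vector. -/
theorem form_eq (h : IsDarbouxMap α ψ) {p : M} (hp : p ∈ ψ.source) (v : Eucl n) :
    (α p : Eucl n →L[ℝ] ℝ) v =
      conformalFactor α ψ (ψ p) * stdContactForm n (ψ p) (coordDeriv ψ p v) := by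
  have hy := ψ.map_source hp
  set A : Eucl n →L[ℝ] Eucl n := mfderiv 𝓘(ℝ, Eucl n) (𝓡 (2 * n + 1)) ψ.symm (ψ p) with hA
  set u := coordDeriv ψ p v with hu
  set c := stdContactForm n (ψ p) u with hc
  have h1 : coordDeriv ψ p (A (u - c • basisVec zIdx)) = u - c • basisVec zIdx := by
    have := h.coordDeriv_symm hy (u - c • basisVec zIdx)
    rwa [ψ.left_inv hp] at this
  set a : Eucl n →L[ℝ] ℝ := α p with ha
  have h2 : a (A (u - c • basisVec zIdx)) = 0 := by
    refine (h.ker p hp _).1 ?_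
    rw [h1, map_sub, map_smul, stdContactForm_z]
    simp [hc]
  have h3 : A u = v := h.symm_coordDeriv hp v
  have h4 : conformalFactor α ψ (ψ p) = a (A (basisVec zIdx)) :=
    α.apply_congr (ψ.left_inv hp) _
  rw [h4]
  rw [map_sub, map_smul, h3, map_sub, map_smul, smul_eq_mul] at h2
  exact (sub_eq_zero.1 h2).trans (mul_comm _ _)

/-- The factor is `α` evaluated on the velocity at time `0` of the coordinate `z`-lines, so
`OneForm.IsSmooth.contMDiffAt_velocity` applies. -/
theorem contDiffOn_conformalFactor [IsManifold (𝓡 (2 * n + 1)) ∞ M] (h : IsDarbouxMap α ψ)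
    (hα : α.IsSmooth n) : ContDiffOn ℝ ∞ (conformalFactor α ψ) ψ.target := by
  intro y hy
  refine ContDiffAt.contDiffWithinAt ?_
  have h1 : ContMDiffAt (𝓘(ℝ, ℝ).prod 𝓘(ℝ, Eucl n)) (𝓡 (2 * n + 1)) ∞
      (fun q : ℝ × Eucl n => ψ.symm (q.2 + q.1 • basisVec zIdx)) (0, y) := by
    refine ContMDiffAt.comp (I' := 𝓘(ℝ, Eucl n)) (0, y) (g := ψ.symm)
      (f := fun q : ℝ × Eucl n => q.2 + q.1 • basisVec zIdx) ?_ ?_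
    · simp only [zero_smul, add_zero]
      exact (h.chart_symm y hy).contMDiffAt (ψ.open_target.mem_nhds hy)
    · exact contMDiffAt_snd.add (contMDiffAt_fst.smul contMDiffAt_const)
  have h2 := hα.contMDiffAt_velocity h1
  have h3 := ContMDiffAt.comp (I := 𝓘(ℝ, Eucl n)) y (f := fun z : Eucl n => ((0 : ℝ), z)) h2
    (contMDiffAt_const.prodMk contMDiffAt_id)
  refine (contMDiffAt_iff_contDiffAt.1 h3).congr_of_eventuallyEq ?_
  filter_upwards [ψ.open_target.mem_nhds hy] with z hz
  have h4 : HasDerivAt (fun r : ℝ => z + r • (basisVec zIdx : Eucl n)) (basisVec zIdx) 0 := by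
    simpa using ((hasDerivAt_id (0 : ℝ)).smul_const (basisVec zIdx : Eucl n)).const_add z
  have hz' : z + (0 : ℝ) • (basisVec zIdx : Eucl n) = z := by simp
  have h5 := mfderiv_comp (x := (0 : ℝ)) (g := ψ.symm)
    (f := fun r : ℝ => z + r • (basisVec zIdx : Eucl n)) (I := 𝓘(ℝ, ℝ))
    (hz'.symm ▸ h.mdifferentiableAt_symm hz) h4.differentiableAt.mdifferentiableAt
  have h6 := congrArg (fun L : ℝ →L[ℝ] Eucl n => L (1 : ℝ)) h5
  have h7 : (mfderiv 𝓘(ℝ, ℝ) 𝓘(ℝ, Eucl n) (fun r : ℝ => z + r • (basisVec zIdx : Eucl n)) 0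
      (1 : ℝ) : Eucl n) = basisVec zIdx := by
    rw [mfderiv_eq_fderiv]
    exact fderiv_apply_one_eq_deriv.trans h4.deriv
  have h8 : (mfderiv 𝓘(ℝ, Eucl n) (𝓡 (2 * n + 1)) ψ.symm
      (z + (0 : ℝ) • (basisVec zIdx : Eucl n)) (basisVec zIdx : Eucl n) : Eucl n) =
      mfderiv 𝓘(ℝ, Eucl n) (𝓡 (2 * n + 1)) ψ.symm z (basisVec zIdx : Eucl n) := by
    rw [hz']
  have h9 := (h6.trans (congrArg (fun u : Eucl n => (mfderiv 𝓘(ℝ, Eucl n) (𝓡 (2 * n + 1)) ψ.symm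
      (z + (0 : ℝ) • (basisVec zIdx : Eucl n)) u : Eucl n)) h7)).trans h8
  refine Eq.trans ?_ (congrArg (fun u : Eucl n =>
    (α (ψ.symm (z + (0 : ℝ) • (basisVec zIdx : Eucl n))) : Eucl n →L[ℝ] ℝ) u) h9).symm
  exact α.apply_congr (congrArg ψ.symm hz').symm _

/-- The part of a Darboux chart where the conformal factor has a given sign. -/
theorem exists_signed [IsManifold (𝓡 (2 * n + 1)) ∞ M] (h : IsDarbouxMap α ψ)
    (hα : α.IsSmooth n) {s : ℝ} (hs : |s| = 1) :
    ∃ (φ : OpenPartialHomeomorph M (Eucl n)) (Λ : Eucl n → ℝ), IsSignedDarbouxMap α φ s Λ ∧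
      φ.source = {p ∈ ψ.source | 0 < s * conformalFactor α ψ (ψ p)} := by
  have hc := h.contDiffOn_conformalFactor hα
  have hO : IsOpen {p ∈ ψ.source | 0 < s * conformalFactor α ψ (ψ p)} := by
    have : ContinuousOn (fun p => s * conformalFactor α ψ (ψ p)) ψ.source :=
      continuousOn_const.mul (hc.continuousOn.comp ψ.continuousOn fun p hp => ψ.map_source hp)
    exact this.isOpen_inter_preimage ψ.open_source isOpen_Ioi
  set U := {p ∈ ψ.source | 0 < s * conformalFactor α ψ (ψ p)} with hU
  have hsrc : (ψ.restrOpen U hO).source = U := by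
    rw [ψ.restrOpen_source]
    exact inter_eq_right.2 fun p hp => hp.1
  have htgt : ∀ y ∈ (ψ.restrOpen U hO).target, y ∈ ψ.target ∧ 0 < s * conformalFactor α ψ y := by
    intro y hy
    have h1 := (ψ.restrOpen U hO).map_target hy
    rw [hsrc] at h1
    have h2 := (ψ.restrOpen U hO).right_inv hy
    change ψ ((ψ.restrOpen U hO).symm y) = y at h2
    rw [← h2]
    exact ⟨ψ.map_source h1.1, h1.2⟩
  have hss : s * s = 1 := by rw [← abs_mul_abs_self, hs, one_mul]
  refine ⟨ψ.restrOpen U hO, fun y => s * conformalFactor α ψ y, ⟨?_, ?_, hs, ?_, ?_, ?_⟩, hsrc⟩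
  · rw [hsrc]
    exact h.chart.mono fun p hp => hp.1
  · exact h.chart_symm.mono fun y hy => (htgt y hy).1
  · exact contDiffOn_const.mul (hc.mono fun y hy => (htgt y hy).1)
  · exact fun y hy => (htgt y hy).2
  · intro p hp v
    rw [hsrc] at hp
    rw [h.form_eq hp.1]
    change _ = s * (s * conformalFactor α ψ (ψ p) * stdContactForm n (ψ p) (coordDeriv ψ p v))
    linear_combination (-(conformalFactor α ψ (ψ p) *
      stdContactForm n (ψ p) (coordDeriv ψ p v))) * hss

end IsDarbouxMap

variable [T2Space M] [SigmaCompactSpace M] [IsManifold (𝓡 (2 * n + 1)) ∞ M]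

/-- Darboux charts match kernels only, so the factor may have either sign. It has no zero, so each
chart splits into two open pieces, and the cover stays finite. -/
theorem HasFiniteDarbouxCover.exists_signedDarbouxMaps (h : HasFiniteDarbouxCover n α)
    (hα : α.IsSmooth n) : ∃ (k : ℕ) (ψ : Fin k → OpenPartialHomeomorph M (Eucl n)) (s : Fin k → ℝ)
      (Λ : Fin k → Eucl n → ℝ), (∀ i, IsSignedDarbouxMap α (ψ i) (s i) (Λ i)) ∧
        ∀ p, ∃ i, p ∈ (ψ i).source := by
  obtain ⟨m, ψ, hψ, hcov⟩ := h.exists_darbouxMaps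
  let σ : Bool → ℝ := fun b => if b then 1 else -1
  have hσ : ∀ b, |σ b| = 1 := by
    intro b
    cases b <;> simp [σ]
  choose φ Λ hφ hsrc using fun x : Fin m × Bool => (hψ x.1).exists_signed hα (hσ x.2)
  let e := Fintype.equivFin (Fin m × Bool)
  refine ⟨_, fun i => φ (e.symm i), fun i => σ (e.symm i).2, fun i => Λ (e.symm i),
    fun i => hφ _, fun p => ?_⟩
  obtain ⟨j, hj⟩ := mem_iUnion.1 (hcov ▸ mem_univ p : p ∈ ⋃ i, (ψ i).source)
  have hne := (hψ j).conformalFactor_ne_zero ((ψ j).map_source hj)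
  obtain ⟨b, hb⟩ : ∃ b, 0 < σ b * conformalFactor α (ψ j) (ψ j p) := by
    rcases lt_or_gt_of_ne hne with h | h
    · exact ⟨false, by simpa [σ] using h⟩
    · exact ⟨true, by simpa [σ] using h⟩
  refine ⟨e (j, b), ?_⟩
  change p ∈ (φ (e.symm (e (j, b)))).source
  rw [Equiv.symm_apply_apply, hsrc]
  exact ⟨hj, hb⟩

end SignedDarboux

/-! ### Global functions that control the charts -/

section ChartData

set_option linter.unusedSectionVars false

variable {n : ℕ} {M : Type*} [TopologicalSpace M] [ChartedSpace (Eucl n) M]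
  {V : Type*} [NormedAddCommGroup V] [NormedSpace ℝ V] {ψ : OpenPartialHomeomorph M (Eucl n)}

/-- A chart, extended smoothly from a closed set to the whole manifold. -/
theorem exists_contMDiff_eq_chart [T2Space M] [SigmaCompactSpace M]
    [IsManifold (𝓡 (2 * n + 1)) ∞ M] [LocallyCompactSpace M]
    (hψ : ContMDiffOn (𝓡 (2 * n + 1)) 𝓘(ℝ, Eucl n) ∞ ψ ψ.source) {S : Set M} (hS : IsClosed S)
    (hSψ : S ⊆ ψ.source) : ∃ φ : M → Eucl n, ContMDiff (𝓡 (2 * n + 1)) 𝓘(ℝ, Eucl n) ∞ φ ∧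
      ∀ p ∈ S, ∀ᶠ q in 𝓝 p, φ q = ψ q := by
  obtain ⟨χ, h0, h1, -⟩ := exists_contMDiffMap_zero_one_nhds_of_isClosed (𝓡 (2 * n + 1))
    (n := (⊤ : ℕ∞)) ψ.open_source.isClosed_compl hS (disjoint_compl_left_iff_subset.2 hSψ)
  refine ⟨fun p => χ p • ψ p, fun p => ?_, fun p hp => ?_⟩
  · by_cases hp : p ∈ ψ.source
    · exact (χ.contMDiff p).smul ((hψ p hp).contMDiffAt (ψ.open_source.mem_nhds hp))
    · refine (contMDiffAt_const (c := (0 : Eucl n))).congr_of_eventuallyEq ?_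
      filter_upwards [Filter.Eventually.filter_mono (nhds_le_nhdsSet hp) h0] with q hq
      rw [hq, zero_smul]
  · filter_upwards [Filter.Eventually.filter_mono (nhds_le_nhdsSet hp) h1] with q hq
    rw [hq, one_smul]

/-- A component of `F` is the chart itself near `p`, so `F` read in the chart does not shorten
vectors. -/
theorem norm_le_fderiv_of_eq_chart {F : M → V} {pr : V →L[ℝ] Eucl n} (hpr : ∀ u, ‖pr u‖ ≤ ‖u‖)
    {p : M} (hp : p ∈ ψ.source) (hF : DifferentiableAt ℝ (F ∘ ψ.symm) (ψ p))
    (h : ∀ᶠ q in 𝓝 p, pr (F q) = ψ q) (v : Eucl n) :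
    ‖v‖ ≤ ‖fderiv ℝ (F ∘ ψ.symm) (ψ p) v‖ := by
  have hy := ψ.map_source hp
  have h1 : (fun y => pr ((F ∘ ψ.symm) y)) =ᶠ[𝓝 (ψ p)] id := by
    have h2 : Filter.Tendsto ψ.symm (𝓝 (ψ p)) (𝓝 p) := by
      simpa only [ContinuousAt, ψ.left_inv hp] using ψ.continuousAt_symm hy
    filter_upwards [h2.eventually h, ψ.open_target.mem_nhds hy] with y h3 h4
    exact h3.trans (ψ.right_inv h4)
  have h5 := (pr.hasFDerivAt.comp (ψ p) hF.hasFDerivAt).congr_of_eventuallyEq h1.symm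
  have h6 := h5.unique (hasFDerivAt_id (ψ p))
  have h7 : pr (fderiv ℝ (F ∘ ψ.symm) (ψ p) v) = v :=
    congrArg (fun L : Eucl n →L[ℝ] Eucl n => L v) h6
  calc ‖v‖ = ‖pr (fderiv ℝ (F ∘ ψ.symm) (ψ p) v)‖ := by rw [h7]
    _ ≤ _ := hpr _

/-- Both factors of the size are functions of components of `F`, so the length measured by `F`
bounds their derivatives; the `2` counts the terms of the product rule. -/
theorem abs_fderiv_size_le {F : M → V} {r γ : V →L[ℝ] ℝ} (hr : ∀ u, |r u| ≤ ‖u‖)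
    (hγ : ∀ u, |γ u| ≤ ‖u‖) {Φ : ℝ → ℝ} (hΦ : ContDiff ℝ ∞ Φ) {p : M} (hp : p ∈ ψ.source)
    (hF : DifferentiableAt ℝ (F ∘ ψ.symm) (ψ p)) (hr1 : |r (F p)| ≤ 1) {η : ℝ}
    (h0 : |Φ (γ (F p))| ≤ η) (h1 : |deriv Φ (γ (F p))| ≤ η) (v : Eucl n) :
    |fderiv ℝ (inChartFun ψ fun q => Φ (γ (F q)) * r (F q)) (ψ p) v| ≤
      2 * η * ‖fderiv ℝ (F ∘ ψ.symm) (ψ p) v‖ := by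
  have hy := ψ.map_source hp
  have h2 : inChartFun ψ (fun q => Φ (γ (F q)) * r (F q)) =ᶠ[𝓝 (ψ p)]
      fun y => Φ (γ ((F ∘ ψ.symm) y)) * r ((F ∘ ψ.symm) y) := by
    filter_upwards [ψ.open_target.mem_nhds hy] with y hy'
    rw [inChartFun, if_pos hy']
    rfl
  have e1 : (F ∘ ψ.symm) (ψ p) = F p := congrArg F (ψ.left_inv hp)
  have h3 := ((hΦ.differentiable (by simp) (γ ((F ∘ ψ.symm) (ψ p)))).hasDerivAt.comp_hasFDerivAt
    (ψ p) (γ.hasFDerivAt.comp (ψ p) hF.hasFDerivAt)).mul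
    (r.hasFDerivAt.comp (ψ p) hF.hasFDerivAt)
  have h4 := (h3.congr_of_eventuallyEq h2).fderiv
  rw [h4]
  set u := fderiv ℝ (F ∘ ψ.symm) (ψ p) v with hu
  have e2 : ∀ L : Eucl n →L[ℝ] ℝ, L = Φ (γ (F p)) • r.comp (fderiv ℝ (F ∘ ψ.symm) (ψ p)) +
      r (F p) • deriv Φ (γ (F p)) • γ.comp (fderiv ℝ (F ∘ ψ.symm) (ψ p)) →
      |L v| ≤ 2 * η * ‖u‖ := by
    rintro L rfl
    have g1 : |Φ (γ (F p)) * r u| ≤ η * ‖u‖ := by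
      rw [abs_mul]
      exact mul_le_mul h0 (hr u) (abs_nonneg _) ((abs_nonneg _).trans h0)
    have g2 : |r (F p) * (deriv Φ (γ (F p)) * γ u)| ≤ 1 * (η * ‖u‖) := by
      rw [abs_mul, abs_mul]
      exact mul_le_mul hr1 (mul_le_mul h1 (hγ u) (abs_nonneg _) ((abs_nonneg _).trans h1))
        (by positivity) zero_le_one
    refine (abs_add_le _ _).trans ((add_le_add g1 g2).trans_eq ?_)
    ring
  refine e2 _ ?_
  simp only [Function.comp_apply, ψ.left_inv hp]

theorem IsTransverseLoop.mono {a b c : ℝ → ℝ} {J : Set ℝ} {B B' : ℝ}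
    (h : IsTransverseLoop a b c J B) (hB : B ≤ B') : IsTransverseLoop a b c J B' :=
  { h with
    bound := fun t => by
      obtain ⟨h1, h2, h3, h4, h5, h6⟩ := h.bound t
      exact ⟨h1.trans hB, h2.trans hB, h3.trans hB, h4.trans hB, h5.trans hB, h6.trans hB⟩ }

theorem contDiffOn_comp_symm {F : M → V} (hF : ContMDiff (𝓡 (2 * n + 1)) 𝓘(ℝ, V) ∞ F)
    (hψ : ContMDiffOn 𝓘(ℝ, Eucl n) (𝓡 (2 * n + 1)) ∞ ψ.symm ψ.target) :
    ContDiffOn ℝ ∞ (F ∘ ψ.symm) ψ.target :=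
  (hF.comp_contMDiffOn hψ).contDiffOn

/-- A positive function which is large on finitely many closed sets. -/
theorem exists_contMDiff_pos_ge [T2Space M] [SigmaCompactSpace M]
    [IsManifold (𝓡 (2 * n + 1)) ∞ M] {k : ℕ} {S U : Fin k → Set M} (hS : ∀ i, IsClosed (S i))
    (hU : ∀ i, IsOpen (U i)) (hSU : ∀ i, S i ⊆ U i) {T : Fin k → M → ℝ}
    (hT : ∀ i, ContinuousOn (T i) (U i)) :
    ∃ f : M → ℝ, ContMDiff (𝓡 (2 * n + 1)) 𝓘(ℝ, ℝ) ∞ f ∧ (∀ p, 0 < f p) ∧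
      ∀ i, ∀ p ∈ S i, T i p ≤ f p := by
  obtain ⟨f, hf⟩ := exists_contMDiffMap_forall_mem_convex_of_local_const (𝓡 (2 * n + 1))
    (n := (⊤ : ℕ∞)) (t := fun p : M => Ioi (0 : ℝ) ∩ {r | ∀ i, p ∈ S i → T i p ≤ r})
    (fun p => by
      refine (convex_Ioi 0).inter ?_
      have : {r : ℝ | ∀ i, p ∈ S i → T i p ≤ r} = ⋂ (i) (_ : p ∈ S i), Ici (T i p) := by
        ext r
        simp
      rw [this]
      exact convex_iInter fun i => convex_iInter fun _ => convex_Ici _)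
    (fun p => by
      have h1 : ∀ i, ∃ C, 0 < C ∧ ∀ᶠ q in 𝓝 p, q ∈ S i → T i q ≤ C := by
        intro i
        by_cases hp : p ∈ S i
        · have h2 : ContinuousAt (T i) p := (hT i).continuousAt ((hU i).mem_nhds (hSU i hp))
          refine ⟨|T i p| + 1, by positivity, ?_⟩
          filter_upwards [h2.eventually_lt_const (lt_add_one (T i p))] with q hq _
          linarith [le_abs_self (T i p)]
        · refine ⟨1, one_pos, ?_⟩
          filter_upwards [(hS i).isOpen_compl.mem_nhds hp] with q hq hq'
          exact absurd hq' hq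
      choose C hC0 hC using h1
      refine ⟨1 + ∑ i, C i, ?_⟩
      filter_upwards [Filter.eventually_all.2 hC] with q hq
      have h3 : ∀ i, C i ≤ ∑ j, C j := fun i =>
        Finset.single_le_sum (fun j _ => (hC0 j).le) (Finset.mem_univ i)
      refine ⟨?_, fun i hi => ?_⟩
      · have : 0 ≤ ∑ i, C i := Finset.sum_nonneg fun i _ => (hC0 i).le
        exact add_pos_of_pos_of_nonneg one_pos this
      · linarith [hq i hi, h3 i])
  exact ⟨f, f.contMDiff, fun p => (hf p).1, fun i p hp => (hf p).2 i hp⟩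

end ChartData

/-! ### The positive loop and the theorem -/

section PositiveLoop

variable {n : ℕ} {M : Type*} [TopologicalSpace M] [T2Space M] [SigmaCompactSpace M]
  [ChartedSpace (Eucl n) M] [IsManifold (𝓡 (2 * n + 1)) ∞ M] [LocallyCompactSpace M]
  {α : OneForm n M}

/-- The choices must be made in this order: the map `F` from the charts, then the scale `f` from the
derivatives of `F`, then good radii for the scaled factors, then the sizes. None of them depends on
a later one. -/
theorem exists_isPositiveLoop (hn : 1 ≤ n) (hα : α.IsSmooth n)
    (hcover : HasFiniteDarbouxCover n α) : ∃ φ : ℝ → Diffeos n M, IsPositiveLoop α φ := by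
  obtain ⟨k, ψ, s, Λ₀, hψ, hcov⟩ := hcover.exists_signedDarbouxMaps hα
  obtain ⟨a, b, c, J, B₀, -, hl₀, hJ⟩ := exists_transverseLoops k
  -- The bound `n + 1` is needed to estimate the standard form, by `abs_stdContactForm_le`.
  set B := max B₀ (n + 1)
  have hl : ∀ i, IsTransverseLoop (a i) (b i) (c i) (J i) B := fun i =>
    (hl₀ i).mono (le_max_left _ _)
  have hB0 : 0 < B := lt_of_lt_of_le (by positivity) (le_max_right _ _)
  obtain ⟨ρ, hρ⟩ := SmoothPartitionOfUnity.exists_isSubordinate (𝓡 (2 * n + 1)) isClosed_univ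
    (fun i => (ψ i).source) (fun i => (ψ i).open_source) fun p _ => mem_iUnion.2 (hcov p)
  have hS : ∀ i, IsClosed (tsupport (ρ i)) := fun i => isClosed_tsupport _
  choose φ hφ hφψ using fun i => exists_contMDiff_eq_chart (hψ i).chart (hS i) (hρ i)
  obtain ⟨g, hg, hgc⟩ := exists_smooth_proper (n := n) (M := M)
  let V := (Fin k → Eucl n) × (Fin k → ℝ) × ℝ
  -- Its components control the coordinate vectors, the cutoffs `ρ i` and the function `g` all at
  -- once.
  let F : M → V := fun p => (fun i => φ i p, fun i => ρ i p, g p)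
  have hF : ContMDiff (𝓡 (2 * n + 1)) 𝓘(ℝ, V) ∞ F :=
    (contMDiff_pi_space.2 hφ).prodMk_space
      ((contMDiff_pi_space.2 fun i => (ρ i).contMDiff).prodMk_space hg)
  let pr : Fin k → V →L[ℝ] Eucl n := fun i =>
    (ContinuousLinearMap.proj i).comp (ContinuousLinearMap.fst ℝ _ _)
  let r : Fin k → V →L[ℝ] ℝ := fun i => (ContinuousLinearMap.proj i).comp
    ((ContinuousLinearMap.fst ℝ _ _).comp (ContinuousLinearMap.snd ℝ _ _))
  let γ : V →L[ℝ] ℝ := (ContinuousLinearMap.snd ℝ _ _).comp (ContinuousLinearMap.snd ℝ _ _)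
  have hpr : ∀ i u, ‖pr i u‖ ≤ ‖u‖ := fun i u => (norm_le_pi_norm u.1 i).trans (norm_fst_le u)
  have hr : ∀ i u, |r i u| ≤ ‖u‖ := fun i u =>
    (norm_le_pi_norm u.2.1 i).trans ((norm_fst_le u.2).trans (norm_snd_le u))
  have hγ : ∀ u, |γ u| ≤ ‖u‖ := fun u => (norm_snd_le u.2).trans (norm_snd_le u)
  have hH : ∀ i, ContDiffOn ℝ ∞ (F ∘ (ψ i).symm) (ψ i).target := fun i =>
    contDiffOn_comp_symm hF (hψ i).chart_symm
  have hHd : ∀ i, ∀ p ∈ (ψ i).source, DifferentiableAt ℝ (F ∘ (ψ i).symm) (ψ i p) :=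
    fun i p hp => ((hH i).differentiableOn (by simp)).differentiableAt
      ((ψ i).open_target.mem_nhds ((ψ i).map_source hp))
  -- `f` is chosen so large on the support of each `ρ i` that the factor `Λ i` of the scaled form
  -- satisfies the field `scale` of `IsLoopBound`.
  obtain ⟨f, hf, hfpos, hfT⟩ := exists_contMDiff_pos_ge (n := n) hS (fun i => (ψ i).open_source)
    (fun i => hρ i) (T := fun i p => 2 * (3 * B * (‖fderiv ℝ (F ∘ (ψ i).symm) (ψ i p)‖ + 1) *
      (1 + ‖ψ i p‖)) ^ 2 / Λ₀ i (ψ i p)) fun i => by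
    have h1 := ((hH i).continuousOn_fderiv_of_isOpen (ψ i).open_target (by simp)).comp
      (ψ i).continuousOn fun p hp => (ψ i).map_source hp
    have h2 := (hψ i).contDiffOn.continuousOn.comp
      (ψ i).continuousOn fun p hp => (ψ i).map_source hp
    exact (continuousOn_const.mul (((continuousOn_const.mul (h1.norm.add continuousOn_const)).mul
      (continuousOn_const.add (ψ i).continuousOn.norm)).pow 2)).div h2
      fun p hp => ((hψ i).pos _ ((ψ i).map_source hp)).ne'
  let Λ : Fin k → Eucl n → ℝ := fun i y => f ((ψ i).symm y) * Λ₀ i y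
  have hΛ : ∀ i, ContDiffOn ℝ ∞ (Λ i) (ψ i).target := fun i =>
    (contDiffOn_comp_symm hf (hψ i).chart_symm).mul (hψ i).contDiffOn
  have hΛpos : ∀ i, ∀ y ∈ (ψ i).target, 0 < Λ i y := fun i y hy =>
    mul_pos (hfpos _) ((hψ i).pos y hy)
  obtain ⟨θ, hθ, hθpos, hgood⟩ := exists_antitone_of_local hgc
    (P := fun d p => ∀ i, p ∈ tsupport (ρ i) →
      IsGoodRadius (ψ i).target (F ∘ (ψ i).symm) (Λ i) (ψ i p) d)
    (fun d d' p hd' hle h i hi => (h i hi).mono hd' hle) fun p => by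
      have h1 : ∀ i, ∃ d, 0 < d ∧ ∀ᶠ q in 𝓝 p, q ∈ tsupport (ρ i) →
          IsGoodRadius (ψ i).target (F ∘ (ψ i).symm) (Λ i) (ψ i q) d := by
        intro i
        by_cases hp : p ∈ tsupport (ρ i)
        · have hp' := hρ i hp
          have hy := (ψ i).map_source hp'
          obtain ⟨d, hd, h⟩ := exists_isGoodRadius (ψ i).open_target (hH i) (hΛ i) hy
            (hΛpos i _ hy)
          refine ⟨d, hd, ?_⟩
          filter_upwards [((ψ i).continuousAt hp').eventually h] with q hq _
          exact hq
        · refine ⟨1, one_pos, ?_⟩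
          filter_upwards [(hS i).isOpen_compl.mem_nhds hp] with q hq hq'
          exact absurd hq' hq
      choose d hd h using h1
      have h2 : ∀ᶠ x in 𝓝[>] (0 : ℝ), (∀ i, x ≤ d i) ∧ 0 < x :=
        (Filter.eventually_all.2 fun i =>
          (nhdsWithin_le_nhds (Iic_mem_nhds (hd i)) : Iic (d i) ∈ 𝓝[>] (0 : ℝ))).and
          self_mem_nhdsWithin
      obtain ⟨x, hx, hx0⟩ := h2.exists
      refine ⟨x, hx0, ?_⟩
      filter_upwards [Filter.eventually_all.2 h] with q hq i hi
      exact (hq i hi).mono hx0 (hx i)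
  set κ : ℝ := 1 / (2 ^ k * (2 * (k + 1))) with hκ
  have hκ0 : 0 < κ := by positivity
  have hκ1 : κ ≤ 1 := by
    rw [hκ, div_le_one (by positivity)]
    have h1 : (1 : ℝ) ≤ 2 ^ k := one_le_pow₀ (by norm_num)
    have h2 : (0 : ℝ) ≤ k := Nat.cast_nonneg _
    nlinarith
  -- The final `/ 2` offsets the factor `2` in `abs_fderiv_size_le`.
  obtain ⟨Φ, hΦ, hΦθ⟩ := exists_contDiff_small (θ := fun x => κ * θ x ^ 4 / (100 * B ^ 2) / 2)
    (fun x y hxy => by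
      have h1 := hθ hxy
      have h2 := (hθpos y).le
      simp only
      gcongr) fun x => by
      have := hθpos x
      positivity
  have hρ1 : ∀ i p, |ρ i p| ≤ 1 := fun i p => by
    rw [abs_of_nonneg (ρ.nonneg i p)]
    exact ρ.le_one i p
  have hchart : ∀ i, IsLoopChart (fun p => f p • (α p : Eucl n →L[ℝ] ℝ)) F (ψ i) (s i) (Λ i)
      (tsupport (ρ i)) (fun p => Φ (γ (F p)) * r i (F p)) B κ := fun i =>
    { chart := (hψ i).chart
      chart_symm := (hψ i).chart_symm
      form := fun p hp v => by
        have h1 := (hψ i).form p hp v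
        have h2 : Λ i (ψ i p) = f p * Λ₀ i (ψ i p) := by
          simp only [Λ, (ψ i).left_inv hp]
        rw [h2]
        refine (congrArg (fun x => f p * x) h1).trans ?_
        ring
      sign := (hψ i).sign
      smooth_map := hF
      smooth_size := (hΦ.contMDiff.comp hg).mul (ρ i).contMDiff
      closed := hS i
      subset := hρ i
      supp := fun p hp => by
        have : ρ i p = 0 := image_eq_zero_of_notMem_tsupport hp
        exact (congrArg (fun x => Φ (g p) * x) this).trans (mul_zero _)
      bound := fun p hp => by
        have hp' := hρ i hp
        obtain ⟨h1, h2, h3⟩ := hΦθ (g p)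
        have h4 : |Φ (γ (F p))| ≤ κ * θ (g p) ^ 4 / (100 * B ^ 2) / 2 := by
          exact (abs_of_pos h1).trans_le h2
        refine ⟨θ (g p), hgood p i hp, le_max_right _ _, hκ0, hκ1,
          mul_nonneg h1.le (ρ.nonneg i p), ?_, fun v => ?_, ?_, ?_⟩
        · have h5 : Φ (g p) * ρ i p ≤ Φ (g p) := mul_le_of_le_one_right h1.le (ρ.le_one i p)
          change Φ (g p) * ρ i p ≤ _
          linarith
        · refine (abs_fderiv_size_le (hr i) hγ hΦ hp' (hHd i p hp') (hρ1 i p) h4 h3 v).trans_eq ?_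
          ring
        · exact norm_le_fderiv_of_eq_chart (hpr i) hp' (hHd i p hp') (hφψ i p hp)
        · have h5 := hfT i p hp
          have h6 := (hψ i).pos _ ((ψ i).map_source hp')
          rw [div_le_iff₀ h6] at h5
          refine h5.trans_eq ?_
          simp only [Λ, (ψ i).left_inv hp'] }
  choose C hC hCper hC0 using fun i => (hchart i).exists_loop (⟨0, hn⟩ : Fin n) (hl i) hκ0.le
  refine exists_isPositiveLoop_of_admissible hfpos k J _ C hC hJ hCper hC0 fun p => ?_
  -- Some `ρ i` is positive at `p`, so the `i`-th loop has nonzero size there: no point is a rest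
  -- point of all the loops.
  obtain ⟨i, hi⟩ := ρ.exists_pos_of_mem (mem_univ p)
  exact ⟨i, (mul_pos (hΦθ (g p)).1 hi).ne'⟩

end PositiveLoop

end

theorem mainTheorem4 (n : ℕ) (hn : 1 ≤ n) {M : Type*} [TopologicalSpace M] [T2Space M]
    [SecondCountableTopology M] [ChartedSpace (Eucl n) M] [IsManifold (𝓡 (2 * n + 1)) ∞ M]
    (α : OneForm n M) (hα : IsContactForm n α) (hcover : HasFiniteDarbouxCover n α)
    (f : ℝ → Diffeos n M) (hf : IsSmoothPath n f) (hfc : IsCompactlySupportedPath n f) :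
    (∃ g : ℝ → Diffeos n M, IsSmoothPath n g ∧ IsCompactlySupportedPath n g ∧
        IsNullPath n α g ∧ g 0 = f 0 ∧ g 1 = f 1) ∧
      (∃ g : ℝ → Diffeos n M, IsSmoothPath n g ∧
        IsPositivePath n α g ∧ g 0 = f 0 ∧ g 1 = f 1) := by
  have : LocallyCompactSpace M := Manifold.locallyCompact_of_finiteDimensional (𝓡 (2 * n + 1))
  obtain ⟨φ, hφ⟩ := exists_isPositiveLoop hn hα.smooth hcover
  exact ⟨exists_null_path hn hcover hf hfc, exists_positive_path hα.smooth hφ hf hfc⟩
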